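/- **Conventions.** A *closed smooth surface* is a compact connected smooth embedded surface $A\subset\mathbb R^3$ without boundary; $\nu$ is its surface measure and $S=\nu(A)$ its area. For a constant $\alpha\in\mathbb R$ let $H_\alpha$ (formally $-\Delta-\alpha\,\delta(x-A)$) be the operator in $L^2(\mathbb R^3)$ associated with the form $$Q_\alpha(\phi,\psi)=\int_{\mathbb R^3}\nabla\phi\cdot\overline{\nabla\psi}\,dx-\alpha\int_A\phi\,\overline{\psi}\,d\nu,\qquad \phi,\psi\in W^{1,2}(\mathbb R^3),$$ with traces on $A$ in the second term; that is, $u\in D(H_\alpha)$ and $H_\alpha u=w$ iff $u\in W^{1,2}(\mathbb R^3)$, $w\in L^2(\mathbb R^3)$ and $Q_\alpha(u,\psi)=\int w\,\overline\psi\,dx$ for all $\psi\in W^{1,2}(\mathbb R^3)$. $H_\alpha$ is called positive if $Q_\alpha(u,u)\ge 0$ for all $u\in W^{1,2}(\mathbb R^3)$. The discrete spectrum is the set of eigenvalues of finite multiplicity that are isolated points of the spectrum. Let $\Gamma$ be the integral operator on $L^2(A,d\nu)$ with kernel $\frac{1}{4\pi|x-y|}$, $\|\cdot\|$ the operator norm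 on $L^2(A,d\nu)$, and $$\|\Gamma\|_\infty=\frac1{4\pi}\sup_{x\in A}\int_A\frac{d\nu(y)}{|x-y|}.$$ The *critical strength* for constant density is $[\hat\alpha]_c=S\cdot\sup\{\alpha\ge0: H_\alpha \text{ is positive}\}$; the *interaction radius* is $[\hat\alpha]_c/(4\pi)$ and the *surface radius* is $\overline S=\sqrt{S/(4\pi)}$. A *spindle profile* is a continuous $f:[-1,1]\to\mathbb R$, smooth and positive on $(-1,1)$, with $f(\pm1)=0$, $f'(v)\to+\infty$ as $v\to-1^+$, $f'(v)\to-\infty$ as $v\to1^-$, $2\pi\int_{-1}^1 f=1$, and such that $A_1$ below is a closed smooth surface. For $\varepsilon>0$ the *spindle* $A_\varepsilon$ is the surface $$(x,y,z)=(\varepsilon f(v)\cos t,\ \varepsilon f(v)\sin t,\ \varepsilon^{-1}v),\qquad v\in[-1,1],\ t\in\mathbb R.$$ **Theorem.** 1. For every $\alpha_0>0$ there is a closed smooth surface $A$ of area $1$ for which $H_{\alpha_0}$ has empty discrete spectrum. 2. For every closed smooth surface, $\|\Gamma\|_\infty<\infty$, $\Gamma$ is a bounded operator on $L^2(A,d\nu)$,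 and for every constant $\alpha=\alpha_0>0$, $$\|(\alpha\Gamma)^2\|\le 2\alpha_0\,\|\Gamma\|_\infty\,\|\alpha\Gamma\|.$$ 3. Spindle profiles exist; moreover there is one for which some $A_\varepsilon$ is a round sphere centred at the origin. 4. Let $f$ be any spindle profile. Every $A_\varepsilon$, $\varepsilon>0$, is a closed smooth surface whose area $S_\varepsilon$ satisfies $1<S_\varepsilon<\infty$, and $S_\varepsilon\to1$ and $\|\Gamma_\varepsilon\|_\infty\to0$ as $\varepsilon\to0^+$. For every $\alpha_0>0$ and all sufficiently small $\varepsilon>0$, on $A_\varepsilon$ one has $\|\alpha_0\Gamma_\varepsilon\|<1$, and $H_{\alpha_0}$ is positive and has empty discrete spectrum. 5. Let $f$ be any spindle profile, $S>0$ and $\alpha_0>0$. For all sufficiently small $\varepsilon>0$ the dilation $A$ of $A_\varepsilon$ (about the origin) that has area $S$ is a closed smooth surface for which $H_{\alpha_0}$ is positive and has empty discrete spectrum, and for which $$\overline S<\frac{[\hat\alpha]_c}{4\pi}.$$ Hence the strict inequality $\overline S>[\hat\alpha]_c/(4\pi)$, which holds for sufficiently small nontrivial smooth radial deformations of a sphere,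 does not extend to general area-preserving deformations. -/

import Mathlib

open MeasureTheory Filter Topology Set
open scoped ENNReal ContDiff

namespace SurfaceInteraction

/-- Euclidean three-space. -/
abbrev E3 : Type := EuclideanSpace ℝ (Fin 3)

/-- The complex Hilbert space `L²(ℝ³)`. -/
abbrev L2 : Type := Lp ℂ 2 (volume : Measure E3)

/-! ### Closed smooth surfaces, surface measure -/

/-- A closed (compact, connected, without boundary) smooth surface embedded in `ℝ³`: near each of
its points the set is a regular level set of a smooth real function. -/
structure IsClosedSmoothSurface (A : Set E3) : Prop where
  isCompact : IsCompact A
  isConnected : IsConnected A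
  regular : ∀ p ∈ A, ∃ U : Set E3, ∃ F : E3 → ℝ, IsOpen U ∧ p ∈ U ∧ ContDiffOn ℝ ∞ F U ∧
    (∀ q ∈ U, q ∈ A ↔ F q = 0) ∧ ∀ q ∈ U ∩ A, fderiv ℝ F q ≠ 0

/-- The surface measure `ν` of `A`, as a measure on `ℝ³` that is concentrated on `A`: the
two-dimensional Hausdorff measure, normalised to agree with Lebesgue measure on planes. -/
noncomputable def surfaceMeasure (A : Set E3) : Measure E3 :=
  (Measure.euclideanHausdorffMeasure 2 : Measure E3).restrict A

/-- The surface area `S = ν(A)`. -/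
noncomputable def area (A : Set E3) : ℝ≥0∞ := surfaceMeasure A univ

/-- The complex Hilbert space `L²(A, dν)`. -/
abbrev L2Surf (A : Set E3) : Type := Lp ℂ 2 (surfaceMeasure A)

/-- The dilated copy of `A` (centre of dilation at the origin) that has area `S`. -/
noncomputable def rescaleToArea (S : ℝ) (A : Set E3) : Set E3 :=
  (fun p : E3 => Real.sqrt (S / (area A).toReal) • p) '' A

/-! ### The Sobolev space `W^{1,2}(ℝ³)` and the trace on a surface -/

/-- Complex test functions on `ℝ³`. -/
def IsTest (φ : E3 → ℂ) : Prop := ContDiff ℝ ∞ φ ∧ HasCompactSupport φ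

/-- The `i`-th partial derivative. -/
noncomputable def partialDeriv (i : Fin 3) (φ : E3 → ℂ) (x : E3) : ℂ :=
  fderiv ℝ φ x (EuclideanSpace.single i 1)

/-- `G ∈ L²` is the weak gradient of `u ∈ L²`; thus `u ∈ W^{1,2}(ℝ³)` iff such a `G` exists. -/
def HasWeakGradient (u : L2) (G : Fin 3 → L2) : Prop :=
  ∀ i : Fin 3, ∀ φ : E3 → ℂ, IsTest φ →
    ∫ x, u x * partialDeriv i φ x = - ∫ x, G i x * φ x

/-- `g ∈ L²(A, dν)` is the trace on `A` of the function `u` with weak gradient `G`: some sequence of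
test functions converges to `u` in `W^{1,2}(ℝ³)` while its restrictions to `A` converge to `g` in
`L²(A, dν)`. -/
def IsTrace (A : Set E3) (u : L2) (G : Fin 3 → L2) (g : L2Surf A) : Prop :=
  ∃ φ : ℕ → E3 → ℂ, (∀ n, IsTest (φ n)) ∧
    Tendsto (fun n => eLpNorm (fun x => φ n x - u x) 2 volume) atTop (𝓝 0) ∧
    (∀ i, Tendsto (fun n => eLpNorm (fun x => partialDeriv i (φ n) x - G i x) 2 volume)
      atTop (𝓝 0)) ∧
    Tendsto (fun n => eLpNorm (fun x => φ n x - g x) 2 (surfaceMeasure A)) atTop (𝓝 0)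

/-- `u ∈ W^{1,2}(ℝ³)`, with weak gradient `G` and with trace `g` on `A`. -/
def InFormDomain (A : Set E3) (u : L2) (G : Fin 3 → L2) (g : L2Surf A) : Prop :=
  HasWeakGradient u G ∧ IsTrace A u G g

theorem IsTest.memLp {φ : E3 → ℂ} (h : IsTest φ) : MemLp φ 2 volume :=
  h.1.continuous.memLp_of_hasCompactSupport h.2

theorem IsTest.memLp_partialDeriv {φ : E3 → ℂ} (h : IsTest φ) (i : Fin 3) :
    MemLp (partialDeriv i φ) 2 volume := by
  have hc : Continuous (partialDeriv i φ) :=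
    (h.1.continuous_fderiv (by simp)).clm_apply continuous_const
  exact hc.memLp_of_hasCompactSupport (h.2.fderiv_apply ℝ (EuclideanSpace.single i 1))

theorem IsTest.add {φ ψ : E3 → ℂ} (hφ : IsTest φ) (hψ : IsTest ψ) :
    IsTest (fun x => φ x + ψ x) :=
  ⟨hφ.1.add hψ.1, hφ.2.add hψ.2⟩

theorem IsTest.smul {φ : E3 → ℂ} (c : ℂ) (hφ : IsTest φ) : IsTest (fun x => c * φ x) :=
  ⟨contDiff_const.mul hφ.1, hφ.2.mul_left⟩

theorem partialDeriv_add {φ ψ : E3 → ℂ} (hφ : IsTest φ) (hψ : IsTest ψ) (i : Fin 3) (x : E3) :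
    partialDeriv i (fun y => φ y + ψ y) x = partialDeriv i φ x + partialDeriv i ψ x := by
  have h1 : DifferentiableAt ℝ φ x := (hφ.1.differentiable (by simp)) x
  have h2 : DifferentiableAt ℝ ψ x := (hψ.1.differentiable (by simp)) x
  simp only [partialDeriv]
  rw [fderiv_fun_add h1 h2]
  rfl

theorem partialDeriv_smul {φ : E3 → ℂ} (hφ : IsTest φ) (c : ℂ) (i : Fin 3) (x : E3) :
    partialDeriv i (fun y => c * φ y) x = c * partialDeriv i φ x := by
  have h1 : DifferentiableAt ℝ φ x := (hφ.1.differentiable (by simp)) x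
  simp only [partialDeriv]
  rw [fderiv_const_mul h1]
  rfl

theorem tendsto_eLpNorm_add {μ : Measure E3} {a b : ℕ → E3 → ℂ} (u v : Lp ℂ 2 μ)
    (ha : ∀ n, AEStronglyMeasurable (a n) μ) (hb : ∀ n, AEStronglyMeasurable (b n) μ)
    (h1 : Tendsto (fun n => eLpNorm (fun x => a n x - u x) 2 μ) atTop (𝓝 0))
    (h2 : Tendsto (fun n => eLpNorm (fun x => b n x - v x) 2 μ) atTop (𝓝 0)) :
    Tendsto (fun n => eLpNorm (fun x => a n x + b n x - (u + v : Lp ℂ 2 μ) x) 2 μ)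
      atTop (𝓝 0) := by
  have h12 := h1.add h2
  rw [add_zero] at h12
  refine tendsto_of_tendsto_of_tendsto_of_le_of_le tendsto_const_nhds h12
    (fun n => zero_le) (fun n => ?_)
  have e : (fun x => a n x + b n x - (u + v : Lp ℂ 2 μ) x) =ᵐ[μ]
      (fun x => a n x - u x) + (fun x => b n x - v x) := by
    filter_upwards [Lp.coeFn_add u v] with x hx
    simp only [hx, Pi.add_apply]
    ring
  change eLpNorm _ 2 μ ≤ _
  rw [eLpNorm_congr_ae e]
  exact eLpNorm_add_le ((ha n).sub (Lp.aestronglyMeasurable u))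
    ((hb n).sub (Lp.aestronglyMeasurable v)) (by norm_num)

theorem tendsto_eLpNorm_smul {μ : Measure E3} {a : ℕ → E3 → ℂ} (u : Lp ℂ 2 μ) (c : ℂ)
    (h1 : Tendsto (fun n => eLpNorm (fun x => a n x - u x) 2 μ) atTop (𝓝 0)) :
    Tendsto (fun n => eLpNorm (fun x => c * a n x - (c • u : Lp ℂ 2 μ) x) 2 μ)
      atTop (𝓝 0) := by
  have h2 := ENNReal.Tendsto.const_mul (a := ‖c‖ₑ) h1 (Or.inr enorm_ne_top)
  rw [mul_zero] at h2
  refine h2.congr (fun n => ?_)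
  have e : (fun x => c * a n x - (c • u : Lp ℂ 2 μ) x) =ᵐ[μ] c • (fun x => a n x - u x) := by
    filter_upwards [Lp.coeFn_smul c u] with x hx
    simp only [hx, Pi.smul_apply, smul_eq_mul]
    ring
  rw [eLpNorm_congr_ae e, eLpNorm_const_smul]

theorem integrable_L2_mul (u : L2) {φ : E3 → ℂ} (h : MemLp φ 2 volume) :
    Integrable (fun x => u x * φ x) volume :=
  (Lp.memLp u).integrable_mul h

theorem InFormDomain.zero (A : Set E3) : InFormDomain A 0 0 0 := by
  have hz : ∀ μ : Measure E3,
      eLpNorm (fun x => (0 : ℂ) - (0 : Lp ℂ 2 μ) x) 2 μ = 0 := fun μ => by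
    have e : (fun x => (0 : ℂ) - (0 : Lp ℂ 2 μ) x) =ᵐ[μ] 0 := by
      filter_upwards [Lp.coeFn_zero ℂ 2 μ] with x hx
      rw [hx]
      simp
    rw [eLpNorm_congr_ae e, eLpNorm_zero]
  have hd : ∀ i, partialDeriv i (fun _ : E3 => (0 : ℂ)) = fun _ => 0 := fun i => by
    funext x
    simp [partialDeriv]
  refine ⟨fun i φ _ => ?_, fun _ _ => 0, fun _ => ⟨contDiff_const, HasCompactSupport.zero⟩,
    ?_, fun i => ?_, ?_⟩
  · have e : ∀ ψ : E3 → ℂ, ∫ x, (0 : L2) x * ψ x = 0 := fun ψ => by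
      rw [integral_eq_zero_of_ae]
      filter_upwards [Lp.coeFn_zero ℂ 2 (volume : Measure E3)] with x hx
      rw [hx]
      simp
    simp only [Pi.zero_apply]
    rw [e, e, neg_zero]
  · simp only [hz]; exact tendsto_const_nhds
  · simp only [hd, Pi.zero_apply, hz]; exact tendsto_const_nhds
  · simp only [hz]; exact tendsto_const_nhds

theorem InFormDomain.add {A : Set E3} {u v : L2} {G K : Fin 3 → L2} {g k : L2Surf A}
    (hu : InFormDomain A u G g) (hv : InFormDomain A v K k) :
    InFormDomain A (u + v) (G + K) (g + k) := by
  obtain ⟨wu, a, ha, a1, a2, a3⟩ := hu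
  obtain ⟨wv, b, hb, b1, b2, b3⟩ := hv
  have key : ∀ (p q : L2) {ψ : E3 → ℂ}, MemLp ψ 2 volume →
      ∫ x, (p + q : L2) x * ψ x = (∫ x, p x * ψ x) + ∫ x, q x * ψ x := fun p q ψ h => by
    rw [← integral_add (integrable_L2_mul p h) (integrable_L2_mul q h)]
    refine integral_congr_ae ?_
    filter_upwards [Lp.coeFn_add p q] with x hx
    simp only [hx, Pi.add_apply]
    ring
  refine ⟨fun i φ hφ => ?_, fun n x => a n x + b n x, fun n => (ha n).add (hb n), ?_, fun i => ?_,
    ?_⟩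
  · rw [key u v (hφ.memLp_partialDeriv i), Pi.add_apply, key (G i) (K i) hφ.memLp,
      wu i φ hφ, wv i φ hφ]
    ring
  · exact tendsto_eLpNorm_add u v (fun n => (ha n).1.continuous.aestronglyMeasurable)
      (fun n => (hb n).1.continuous.aestronglyMeasurable) a1 b1
  · have := tendsto_eLpNorm_add (G i) (K i)
      (fun n => ((ha n).memLp_partialDeriv i).aestronglyMeasurable)
      (fun n => ((hb n).memLp_partialDeriv i).aestronglyMeasurable) (a2 i) (b2 i)
    simpa only [partialDeriv_add (ha _) (hb _), Pi.add_apply] using this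
  · exact tendsto_eLpNorm_add g k (fun n => (ha n).1.continuous.aestronglyMeasurable)
      (fun n => (hb n).1.continuous.aestronglyMeasurable) a3 b3

theorem InFormDomain.smul {A : Set E3} {u : L2} {G : Fin 3 → L2} {g : L2Surf A} (c : ℂ)
    (hu : InFormDomain A u G g) : InFormDomain A (c • u) (c • G) (c • g) := by
  obtain ⟨wu, a, ha, a1, a2, a3⟩ := hu
  have key : ∀ (p : L2) (ψ : E3 → ℂ),
      ∫ x, (c • p : L2) x * ψ x = c * ∫ x, p x * ψ x := fun p ψ => by
    rw [← integral_const_mul]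
    refine integral_congr_ae ?_
    filter_upwards [Lp.coeFn_smul c p] with x hx
    simp only [hx, Pi.smul_apply, smul_eq_mul]
    ring
  refine ⟨fun i φ hφ => ?_, fun n x => c * a n x, fun n => (ha n).smul c, ?_, fun i => ?_, ?_⟩
  · rw [key, Pi.smul_apply, key, wu i φ hφ]
    ring
  · exact tendsto_eLpNorm_smul u c a1
  · have := tendsto_eLpNorm_smul (G i) c (a2 i)
    simpa only [partialDeriv_smul (ha _), Pi.smul_apply] using this
  · exact tendsto_eLpNorm_smul g c a3

/-! ### The form `Q_α` and the operator `H_α`, for a constant coupling `α` -/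

/-- `Q_α(u, v) = ∫ ∇u · conj (∇v) dx - α ∫_A u conj v dν`, where `u` has gradient `G` and trace `g`,
and `v` has gradient `K` and trace `k`. (`inner ℂ` is conjugate-linear in its first argument.) -/
noncomputable def formQ {A : Set E3} (α : ℝ) (G : Fin 3 → L2) (g : L2Surf A) (K : Fin 3 → L2)
    (k : L2Surf A) : ℂ :=
  (∑ i, inner ℂ (K i) (G i)) - (α : ℂ) * inner ℂ k g

/-- The graph of `H_α`, the operator associated with the form `Q_α`: `u` belongs to the domain and
`H_α u = w` iff `u ∈ W^{1,2}(ℝ³)` and `Q_α(u, v) = (w, v)` for all `v ∈ W^{1,2}(ℝ³)`. -/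
noncomputable def hamiltonianGraph (A : Set E3) (α : ℝ) : Submodule ℂ (L2 × L2) where
  carrier := {p | ∃ (G : Fin 3 → L2) (g : L2Surf A), InFormDomain A p.1 G g ∧
    ∀ (v : L2) (K : Fin 3 → L2) (k : L2Surf A), InFormDomain A v K k →
      formQ α G g K k = inner ℂ v p.2}
  zero_mem' := ⟨0, 0, InFormDomain.zero A, fun v K k _ => by simp [formQ]⟩
  add_mem' := by
    rintro p q ⟨G, g, h1, h2⟩ ⟨G', g', h1', h2'⟩
    refine ⟨G + G', g + g', h1.add h1', fun v K k h => ?_⟩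
    rw [Prod.snd_add, inner_add_right, ← h2 v K k h, ← h2' v K k h]
    simp only [formQ, Pi.add_apply, inner_add_right, Finset.sum_add_distrib]
    ring
  smul_mem' := by
    rintro c p ⟨G, g, h1, h2⟩
    refine ⟨c • G, c • g, h1.smul c, fun v K k h => ?_⟩
    rw [Prod.smul_snd, inner_smul_right, ← h2 v K k h]
    simp only [formQ, Pi.smul_apply, inner_smul_right, ← Finset.mul_sum]
    ring

/-- The singular Schrödinger operator `H_α = -Δ - α δ(x - A)` in `L²(ℝ³)` with constant coupling
`α`. -/
noncomputable def hamiltonian (A : Set E3) (α : ℝ) : L2 →ₗ.[ℂ] L2 :=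
  (hamiltonianGraph A α).toLinearPMap

/-- `H_α` is positive: `Q_α(u, u) ≥ 0` for all `u ∈ W^{1,2}(ℝ³)`. -/
def IsPositiveForm (A : Set E3) (α : ℝ) : Prop :=
  ∀ (u : L2) (G : Fin 3 → L2) (g : L2Surf A), InFormDomain A u G g →
    0 ≤ (∑ i, ‖G i‖ ^ 2) - α * ‖g‖ ^ 2

/-! ### Spectrum and discrete spectrum of an unbounded operator -/

/-- `z` is in the resolvent set of `T`: `T - z` is a bijection of the domain onto the space, with a
bounded inverse `R`. -/
def InResolventSet {X : Type*} [NormedAddCommGroup X] [NormedSpace ℂ X] (T : X →ₗ.[ℂ] X) (z : ℂ) :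
    Prop :=
  ∃ R : X →L[ℂ] X,
    (∀ y : X, ∃ hy : R y ∈ T.domain, T ⟨R y, hy⟩ - z • R y = y) ∧
    ∀ x : T.domain, R (T x - z • (x : X)) = x

/-- The spectrum of an unbounded operator. -/
def opSpectrum {X : Type*} [NormedAddCommGroup X] [NormedSpace ℂ X] (T : X →ₗ.[ℂ] X) : Set ℂ :=
  {z | ¬ InResolventSet T z}

/-- The eigenspace of an unbounded operator. -/
def opEigenspace {X : Type*} [NormedAddCommGroup X] [NormedSpace ℂ X] (T : X →ₗ.[ℂ] X) (z : ℂ) :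
    Submodule ℂ X :=
  (LinearMap.ker (T.toFun - z • T.domain.subtype)).map T.domain.subtype

/-- The discrete spectrum (of a self-adjoint operator): the eigenvalues of finite multiplicity that
are isolated points of the spectrum. -/
def discreteSpectrum {X : Type*} [NormedAddCommGroup X] [NormedSpace ℂ X] (T : X →ₗ.[ℂ] X) :
    Set ℂ :=
  {z | opEigenspace T z ≠ ⊥ ∧ FiniteDimensional ℂ (opEigenspace T z) ∧
    ∃ r > 0, Metric.ball z r ∩ opSpectrum T = {z}}

/-! ### The operator `Γ` with kernel `1 / (4π|x - y|)` on `L²(A, dν)` -/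

/-- `T` is the bounded operator `Γ` on `L²(A, dν)` with the kernel `1 / (4π|x - y|)`. -/
def IsGammaOperator (A : Set E3) (T : L2Surf A →L[ℂ] L2Surf A) : Prop :=
  ∀ u : L2Surf A, ∀ᵐ x ∂(surfaceMeasure A),
    Integrable (fun y => ((1 / (4 * Real.pi * dist x y) : ℝ) : ℂ) * u y) (surfaceMeasure A) ∧
    T u x = ∫ y, ((1 / (4 * Real.pi * dist x y) : ℝ) : ℂ) * u y ∂(surfaceMeasure A)

/-- `‖Γ‖_∞ = (4π)⁻¹ sup_{x ∈ A} ∫_A |x - y|⁻¹ dν(y)`. -/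
noncomputable def gammaSup (A : Set E3) : ℝ≥0∞ :=
  (ENNReal.ofReal (4 * Real.pi))⁻¹ * ⨆ x ∈ A, ∫⁻ y, (edist x y)⁻¹ ∂(surfaceMeasure A)

/-! ### Critical strength and radii -/

/-- The critical strength `[α̂]_c` for the constant relative density: the threshold value of the
global strength `[α] = α S` up to which `H_α` with constant coupling `α` stays positive. -/
noncomputable def criticalStrength (A : Set E3) : ℝ≥0∞ :=
  ⨆ (α : ℝ) (_ : 0 ≤ α) (_ : IsPositiveForm A α), ENNReal.ofReal α * area A

/-- The interaction radius `[α̂]_c / (4π)`. -/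
noncomputable def interactionRadius (A : Set E3) : ℝ≥0∞ :=
  criticalStrength A / ENNReal.ofReal (4 * Real.pi)

/-- The surface radius `√(S / (4π))`. -/
noncomputable def surfaceRadius (A : Set E3) : ℝ≥0∞ :=
  (area A / ENNReal.ofReal (4 * Real.pi)) ^ (1 / 2 : ℝ)

/-! ### Spindles -/

/-- The surface of revolution `A_ε`: `x = ε f(v) cos t`, `y = ε f(v) sin t`, `z = ε⁻¹ v`. -/
noncomputable def spindle (f : ℝ → ℝ) (ε : ℝ) : Set E3 :=
  {p | ∃ v ∈ Icc (-1 : ℝ) 1, ∃ t : ℝ,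
    p = !₂[ε * f v * Real.cos t, ε * f v * Real.sin t, ε⁻¹ * v]}

/-- Admissible profiles of spindles. The last field says that the surface of revolution closes up
smoothly at its two poles. -/
structure IsSpindleProfile (f : ℝ → ℝ) : Prop where
  continuousOn : ContinuousOn f (Icc (-1) 1)
  smooth : ContDiffOn ℝ ∞ f (Ioo (-1) 1)
  pos : ∀ v ∈ Ioo (-1 : ℝ) 1, 0 < f v
  left_end : f (-1) = 0
  right_end : f 1 = 0
  deriv_left : Tendsto (deriv f) (𝓝[>] (-1)) atTop
  deriv_right : Tendsto (deriv f) (𝓝[<] 1) atBot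
  normalized : 2 * Real.pi * ∫ v in (-1 : ℝ)..1, f v = 1
  closes_up : IsClosedSmoothSurface (spindle f 1)

end SurfaceInteraction

namespace SurfaceInteraction

/-! ### Hausdorff measure and bounds on distances -/

/-! Everything is controlled by the Newtonian potential `∫ dν(y)/|x - y|` of the surface measure.

Finiteness. Near each point a closed smooth surface projects bijectively onto a subset of a
coordinate plane, with Lipschitz inverse. Projection shortens distances, so the potential is bounded
by the planar integral of `1/|w|`; compactness does the rest. Passing from `x` to its nearest point
on `A` shows that the potential in all of space is at most twice its supremum on `A`, that is, at
most `M = 8π‖Γ‖_∞`. With a symmetric kernel, the Schur test gives `‖Γ‖ ≤ ‖Γ‖_∞`, and the inequality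
for `(αΓ)²` follows.

Positivity. For `w > 0` one has the Hardy inequality `∫ (-Δw/w)|φ|² ≤ ∫ |∇φ|²`. If `w` is the
potential of `ν`, then formally `-Δw = 4πν` and `w ≤ M`, which bounds `∫_A |φ|² dν` by a multiple of
`M ∫ |∇φ|²`. Regularising `1/|x|` to `(|x|² + δ²)^(-1/2)` makes this rigorous with the non-optimal
constant `M` (`IsTest.integral_norm_sq_le`). Hence `Q_α` is positive as soon as `α M ≤ 1`.

Discrete spectrum. Plane waves, cut off slowly and far away from `A`, do not see the interaction, so
`[0, ∞)` lies in the spectrum. An eigenvalue of a positive `H_α` is real and nonnegative, hence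
never isolated.

Spindles. In the coordinates `(v, t)` the area element is `f √(1 + ε⁴ f'²)`, which lies between `f`
and `f + ε² f|f'|`; so the area exceeds `2π ∫ f = 1` and tends to it. The distance of two points is
at least `|v - v₀|/ε`, `ε|f(v) - f(v₀)|` and `ε f(v)|t - t₀|/π`. Splitting `1/d = d^(-3/4) d^(-1/4)`
between the meridian and the angular direction leaves integrable singularities and a factor `√ε`.
Where `f'` blows up, near the poles, the substitution `w = f(v)` absorbs it. So `‖Γ_ε‖_∞ = O(√ε)`.

Rescaling. A dilation by `c` multiplies `‖Γ‖_∞` by `c`, and `c ≤ √S` here, so for small `ε` the form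
is positive even for a coupling so large that the interaction radius exceeds the surface radius. The
ellipsoids of revolution provide profiles. -/

theorem euclideanHausdorffMeasure_image_le {ι X Y : Type*} [MetricSpace X] [MeasurableSpace X]
    [BorelSpace X] [MetricSpace Y] [MeasurableSpace Y] [BorelSpace Y] (d : ℕ) {f : ι → X}
    {g : ι → Y} {s : Set ι} (K : NNReal)
    (h : ∀ a ∈ s, ∀ b ∈ s, dist (f a) (f b) ≤ K * dist (g a) (g b)) :
    (Measure.euclideanHausdorffMeasure d : Measure X) (f '' s) ≤
      (K : ℝ≥0∞) ^ d * (Measure.euclideanHausdorffMeasure d : Measure Y) (g '' s) := by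
  rcases s.eq_empty_or_nonempty with rfl | ⟨a₀, ha₀⟩
  · simp
  -- The bound makes `f` constant on the fibres of `g`, so `f` composed with any choice `c` of
  -- preimages under `g` is a `K`-Lipschitz map whose image of `g '' s` covers `f '' s`.
  have hsel : ∀ y : Y, ∃ a, y ∈ g '' s → a ∈ s ∧ g a = y := by
    intro y
    by_cases hy : y ∈ g '' s
    · obtain ⟨a, ha, rfl⟩ := hy
      exact ⟨a, fun _ => ⟨ha, rfl⟩⟩
    · exact ⟨a₀, fun h => absurd h hy⟩
  choose c hc using hsel
  have hL : LipschitzOnWith K (f ∘ c) (g '' s) := by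
    refine LipschitzOnWith.of_dist_le_mul fun x hx y hy => ?_
    have := h _ (hc x hx).1 _ (hc y hy).1
    rwa [(hc x hx).2, (hc y hy).2] at this
  have hsub : f '' s ⊆ (f ∘ c) '' (g '' s) := by
    rintro _ ⟨a, ha, rfl⟩
    have hga : g a ∈ g '' s := mem_image_of_mem g ha
    refine ⟨g a, hga, ?_⟩
    have h1 := h _ (hc _ hga).1 _ ha
    rw [(hc _ hga).2, dist_self, mul_zero] at h1
    exact dist_le_zero.1 h1
  refine (measure_mono hsub).trans ?_
  simp only [Measure.euclideanHausdorffMeasure_def, Measure.smul_apply]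
  have h2 := hL.hausdorffMeasure_image_le (d := (d : ℝ)) (by positivity)
  rw [ENNReal.rpow_natCast] at h2
  simp only [ENNReal.smul_def, smul_eq_mul]
  rw [mul_left_comm]
  gcongr

/-- The Riesz kernels of order below the dimension are integrable over sets of finite measure. -/
theorem lintegral_ball_enorm_rpow_lt_top {E : Type*} [NormedAddCommGroup E] [NormedSpace ℝ E]
    [FiniteDimensional ℝ E] [MeasurableSpace E] [BorelSpace E] (μ : Measure E)
    [μ.IsAddHaarMeasure] (hd : 1 ≤ Module.finrank ℝ E) {α : ℝ} (hα : α < Module.finrank ℝ E) :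
    ∫⁻ w in Metric.ball (0 : E) 1, ‖w‖ₑ ^ (-α) ∂μ < ⊤ := by
  have : Nontrivial E := Module.nontrivial_of_finrank_pos (R := ℝ) (by positivity)
  have hI : IntegrableOn (fun w : E => ‖w‖ ^ (-α)) (Metric.ball 0 1) μ := by
    refine integrableOn_ball_of_norm_le_rpow hd (C := 1) hα (ae_of_all _ fun x => ?_) ?_
    · rw [one_mul, Real.norm_of_nonneg (by positivity)]
    · exact (measurable_norm.pow_const _).aestronglyMeasurable
  refine lt_of_le_of_lt (le_of_eq ?_) hI.2
  refine lintegral_congr_ae (ae_restrict_of_ae ?_)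
  have h0 : ∀ᵐ w ∂μ, w ≠ (0 : E) := by
    simp [ae_iff]
  filter_upwards [h0] with w hw
  rw [Real.enorm_of_nonneg (by positivity), ← ENNReal.ofReal_rpow_of_pos (norm_pos_iff.2 hw),
    ofReal_norm]

/-- Within distance 1 of `a` the integral is translated to the origin, and beyond it the integrand
is at most 1. The bound is independent of `a`, which is what makes potentials bounded uniformly in
the base point. -/
theorem setLIntegral_enorm_sub_rpow_le {E : Type*} [NormedAddCommGroup E] [NormedSpace ℝ E]
    [FiniteDimensional ℝ E] [MeasurableSpace E] [BorelSpace E] (μ : Measure E)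
    [μ.IsAddHaarMeasure] {α : ℝ} (hα : 0 < α) (D : Set E) (a : E) :
    ∫⁻ w in D, ‖w - a‖ₑ ^ (-α) ∂μ ≤ (∫⁻ w in Metric.ball (0 : E) 1, ‖w‖ₑ ^ (-α) ∂μ) + μ D := by
  have hm : Measurable fun w : E => ‖w‖ₑ ^ (-α) := measurable_enorm.pow_const _
  have e : ∫⁻ w in Metric.ball a 1, ‖w - a‖ₑ ^ (-α) ∂μ =
      ∫⁻ w in Metric.ball (0 : E) 1, ‖w‖ₑ ^ (-α) ∂μ := by
    have hb : (fun w => w - a) ⁻¹' Metric.ball (0 : E) 1 = Metric.ball a 1 := by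
      ext w
      simp [dist_eq_norm]
    rw [← hb]
    exact (measurePreserving_sub_right μ a).setLIntegral_comp_preimage Metric.isOpen_ball.measurableSet hm
  have hb : MeasurableSet (Metric.ball a 1) := Metric.isOpen_ball.measurableSet
  have hle : ∀ w, ‖w - a‖ₑ ^ (-α) ≤ (Metric.ball a 1).indicator (fun w => ‖w - a‖ₑ ^ (-α)) w + 1 := by
    intro w
    by_cases hw : w ∈ Metric.ball a 1
    · rw [indicator_of_mem hw]
      exact le_self_add
    · rw [indicator_of_notMem hw, zero_add, ENNReal.rpow_neg]
      refine ENNReal.inv_le_one.2 (ENNReal.one_le_rpow ?_ hα)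
      rw [Metric.mem_ball, not_lt, dist_eq_norm] at hw
      rw [← ofReal_norm]
      simpa using ENNReal.ofReal_le_ofReal hw
  calc ∫⁻ w in D, ‖w - a‖ₑ ^ (-α) ∂μ
      ≤ ∫⁻ w in D, ((Metric.ball a 1).indicator (fun w => ‖w - a‖ₑ ^ (-α)) w + 1) ∂μ :=
        lintegral_mono hle
    _ ≤ (∫⁻ w, (Metric.ball a 1).indicator (fun w => ‖w - a‖ₑ ^ (-α)) w ∂μ) + μ D := by
        rw [lintegral_add_right _ measurable_const, setLIntegral_one]
        exact add_le_add_left (setLIntegral_le_lintegral _ _) _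
    _ = _ := by rw [lintegral_indicator hb, e]

/-! ### Local projections of closed smooth surfaces -/

/-- Omission of one coordinate. -/
noncomputable def dropCoord (i : Fin 3) (x : E3) : EuclideanSpace ℝ (Fin 2) :=
  WithLp.toLp 2 fun j => x (i.succAbove j)

theorem dist_sq_eq_dropCoord (i : Fin 3) (x y : E3) :
    dist x y ^ 2 = (x i - y i) ^ 2 + dist (dropCoord i x) (dropCoord i y) ^ 2 := by
  rw [EuclideanSpace.dist_eq, EuclideanSpace.dist_eq, Real.sq_sqrt (by positivity),
    Real.sq_sqrt (by positivity), Fin.sum_univ_succAbove _ i]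
  simp [dropCoord, Real.dist_eq, sq_abs]

theorem continuous_dropCoord (i : Fin 3) : Continuous (dropCoord i) := by
  unfold dropCoord
  fun_prop

theorem dist_dropCoord_le (i : Fin 3) (x y : E3) :
    dist (dropCoord i x) (dropCoord i y) ≤ dist x y := by
  have := dist_sq_eq_dropCoord i x y
  exact abs_le_of_sq_le_sq' (by nlinarith [sq_nonneg (x i - y i)]) dist_nonneg |>.2

/-- If the `i`-th partial derivative of the defining function does not vanish at `p`, the surface
near `p` is a Lipschitz graph over the plane of the other two coordinates. Strict differentiability
yields this directly, since `F` vanishes at both points. -/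
theorem IsClosedSmoothSurface.exists_dist_le_dropCoord {A : Set E3} (hA : IsClosedSmoothSurface A)
    {p : E3} (hp : p ∈ A) : ∃ r > 0, ∃ i : Fin 3, ∃ K : NNReal,
      ∀ x ∈ A ∩ Metric.ball p r, ∀ y ∈ A ∩ Metric.ball p r,
        dist x y ≤ K * dist (dropCoord i x) (dropCoord i y) := by
  obtain ⟨U, F, hU, hpU, hF, hFA, hF'⟩ := hA.regular p hp
  have hs : HasStrictFDerivAt F (fderiv ℝ F p) p :=
    (hF.contDiffAt (hU.mem_nhds hpU)).hasStrictFDerivAt (by simp)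
  set L := fderiv ℝ F p with hL
  have hL0 : L ≠ 0 := hF' p ⟨hpU, hp⟩
  obtain ⟨i, hi⟩ : ∃ i, L (EuclideanSpace.single i 1) ≠ 0 := by
    by_contra! hcon
    apply hL0
    ext x
    have hx : x = ∑ i, x i • EuclideanSpace.single i (1 : ℝ) := by
      have := (EuclideanSpace.basisFun (Fin 3) ℝ).sum_repr x
      simpa using this.symm
    rw [hx]
    simp [hcon]
  set c := |L (EuclideanSpace.single i 1)| with hc
  have hcpos : 0 < c := abs_pos.2 hi
  -- Half of `c`, so that the error `c / 2 * |x i - y i|` can be absorbed into `c * |x i - y i|`.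
  have hev := hs.isLittleO.def (show 0 < c / 2 by positivity)
  rw [nhds_prod_eq] at hev
  obtain ⟨t, ht, hev⟩ := (eventually_prod_self_iff (r := fun a b : E3 =>
    ‖F a - F b - L (a - b)‖ ≤ c / 2 * ‖a - b‖)).1 hev
  obtain ⟨r, hr, hrt⟩ := Metric.mem_nhds_iff.1 (inter_mem ht (hU.mem_nhds hpU))
  refine ⟨r, hr, i, (2 + 2 * ‖L‖ / c).toNNReal, fun x hx y hy => ?_⟩
  rw [Real.coe_toNNReal _ (by positivity)]
  have h1 := hev x (hrt hx.2).1 y (hrt hy.2).1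
  rw [(hFA x (hrt hx.2).2).1 hx.1, (hFA y (hrt hy.2).2).1 hy.1] at h1
  -- `z` shares its `i`-th coordinate with `x` and the others with `y`; thus `x - z` is the
  -- projected difference and `z - y` is a multiple of the `i`-th basis vector.
  set z : E3 := y + (x i - y i) • EuclideanSpace.single i (1 : ℝ) with hz
  have hzi : z i = x i := by simp [hz]
  have hzd : dropCoord i z = dropCoord i y := by
    ext j
    simp [hz, dropCoord, Fin.succAbove_ne]
  set d := dist (dropCoord i x) (dropCoord i y) with hd
  have hxz : ‖x - z‖ = d := by
    have := dist_sq_eq_dropCoord i x z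
    rw [hzi, hzd, sub_self, zero_pow two_ne_zero, zero_add] at this
    rw [← dist_eq_norm]
    exact (pow_left_inj₀ dist_nonneg dist_nonneg two_ne_zero).1 this
  have hxy : dist x y ≤ |x i - y i| + d := by
    have := dist_sq_eq_dropCoord i x y
    rw [← sq_abs (x i - y i)] at this
    refine abs_le_of_sq_le_sq' ?_ (by positivity) |>.2
    nlinarith [mul_nonneg (abs_nonneg (x i - y i)) (dist_nonneg : 0 ≤ d)]
  have hL1 : L (x - y) = L (x - z) + (x i - y i) * L (EuclideanSpace.single i 1) := by
    rw [← smul_eq_mul, ← map_smul, ← map_add]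
    congr 1
    rw [hz]
    abel
  have h2 : |x i - y i| * c ≤ c / 2 * dist x y + ‖L‖ * d := by
    calc |x i - y i| * c = |L (x - y) - L (x - z)| := by rw [hL1, hc, ← abs_mul]; ring_nf
      _ ≤ |L (x - y)| + |L (x - z)| := abs_sub _ _
      _ ≤ _ := by
        gcongr
        · rwa [sub_self, zero_sub, norm_neg, Real.norm_eq_abs, ← dist_eq_norm] at h1
        · rw [← hxz]
          exact L.le_opNorm _
  have h3 : |x i - y i| ≤ d + 2 * ‖L‖ / c * d := by
    have h4 : |x i - y i| * (c / 2) ≤ (d + 2 * ‖L‖ / c * d) * (c / 2) := by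
      have : 2 * ‖L‖ / c * d * (c / 2) = ‖L‖ * d := by field_simp
      nlinarith [mul_le_mul_of_nonneg_left hxy (show 0 ≤ c / 2 by positivity)]
    exact le_of_mul_le_mul_right h4 (by positivity)
  linarith

/-- The inverse of the projection is `K`-Lipschitz, so the projected surface measure is at most `K ^
2` times Lebesgue measure on a disc. The projection shortens distances, so the potential is
dominated by an integral of `1/|w - a|` in the plane, which converges. -/
theorem IsClosedSmoothSurface.exists_local_potential_bound {A : Set E3}
    (hA : IsClosedSmoothSurface A) {p : E3} (hp : p ∈ A) : ∃ r > 0, ∃ C : ℝ≥0∞, C ≠ ⊤ ∧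
      (Measure.euclideanHausdorffMeasure 2 : Measure E3) (A ∩ Metric.ball p r) ≤ C ∧
      ∀ x : E3, ∫⁻ y in A ∩ Metric.ball p r, (edist x y)⁻¹
        ∂(Measure.euclideanHausdorffMeasure 2 : Measure E3) ≤ C := by
  obtain ⟨r, hr, i, K, hK⟩ := hA.exists_dist_le_dropCoord hp
  set H : Measure E3 := Measure.euclideanHausdorffMeasure 2 with hH
  set B := A ∩ Metric.ball p r with hB
  have hBm : MeasurableSet B := hA.isCompact.measurableSet.inter Metric.isOpen_ball.measurableSet
  set D := Metric.closedBall (dropCoord i p) r with hD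
  have hDm : MeasurableSet D := Metric.isClosed_closedBall.measurableSet
  have hP : Measurable (dropCoord i) := (continuous_dropCoord i).measurable
  have hmap : (H.restrict B).map (dropCoord i) ≤ (K : ℝ≥0∞) ^ 2 • volume.restrict D := by
    refine Measure.le_iff.2 fun E hE => ?_
    rw [Measure.map_apply hP hE, Measure.restrict_apply (hP hE), Measure.smul_apply,
      Measure.restrict_apply hE, smul_eq_mul]
    have h1 := euclideanHausdorffMeasure_image_le 2 (f := id) (g := dropCoord i)
      (s := dropCoord i ⁻¹' E ∩ B) K fun a ha b hb => hK a ha.2 b hb.2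
    rw [image_id, EuclideanSpace.euclideanHausdorffMeasure_eq_volume] at h1
    refine h1.trans ?_
    gcongr
    rintro _ ⟨a, ha, rfl⟩
    refine ⟨ha.1, ?_⟩
    rw [hD, Metric.mem_closedBall]
    exact (dist_dropCoord_le i a p).trans (Metric.mem_ball.1 ha.2.2).le
  set c := ∫⁻ w in Metric.ball (0 : EuclideanSpace ℝ (Fin 2)) 1, ‖w‖ₑ ^ (-1 : ℝ) with hc
  have hcfin : c < ⊤ := lintegral_ball_enorm_rpow_lt_top volume (by simp) (by simp)
  have hDfin : volume D < ⊤ := measure_closedBall_lt_top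
  refine ⟨r, hr, (K : ℝ≥0∞) ^ 2 * (c + volume D),
    ENNReal.mul_ne_top (by simp) (ENNReal.add_lt_top.2 ⟨hcfin, hDfin⟩).ne, ?_, fun x => ?_⟩
  · have h1 := hmap univ
    rw [Measure.map_apply hP MeasurableSet.univ, preimage_univ, Measure.restrict_apply_univ,
      Measure.smul_apply, Measure.restrict_apply_univ, smul_eq_mul] at h1
    refine h1.trans ?_
    gcongr
    exact le_add_self
  · calc ∫⁻ y in B, (edist x y)⁻¹ ∂H
        ≤ ∫⁻ y in B, ‖dropCoord i y - dropCoord i x‖ₑ ^ (-1 : ℝ) ∂H := by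
          refine lintegral_mono fun y => ?_
          rw [ENNReal.rpow_neg_one, ENNReal.inv_le_inv, ← edist_eq_enorm_sub, edist_comm,
            edist_dist, edist_dist]
          exact ENNReal.ofReal_le_ofReal (dist_dropCoord_le i x y)
      _ = ∫⁻ w, ‖w - dropCoord i x‖ₑ ^ (-1 : ℝ) ∂((H.restrict B).map (dropCoord i)) := by
          rw [lintegral_map (by fun_prop) hP]
      _ ≤ ∫⁻ w, ‖w - dropCoord i x‖ₑ ^ (-1 : ℝ) ∂((K : ℝ≥0∞) ^ 2 • volume.restrict D) :=
          lintegral_mono' hmap le_rfl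
      _ ≤ _ := by
          rw [lintegral_smul_measure, smul_eq_mul]
          gcongr
          exact setLIntegral_enorm_sub_rpow_le volume one_pos D _

/-- Surface area and Newtonian potential of a closed smooth surface are bounded. -/
theorem IsClosedSmoothSurface.exists_potential_bound {A : Set E3}
    (hA : IsClosedSmoothSurface A) : ∃ C : ℝ≥0∞, C ≠ ⊤ ∧ area A ≤ C ∧
      ∀ x : E3, ∫⁻ y, (edist x y)⁻¹ ∂(surfaceMeasure A) ≤ C := by
  choose! r hr C hC hC1 hC2 using fun p (hp : p ∈ A) => hA.exists_local_potential_bound hp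
  obtain ⟨t, htA, ht⟩ := hA.isCompact.elim_nhds_subcover (fun p => Metric.ball p (r p))
    fun p hp => Metric.ball_mem_nhds p (hr p hp)
  have hcov : A ⊆ ⋃ p ∈ t, A ∩ Metric.ball p (r p) := by
    intro x hx
    obtain ⟨p, hp, hxp⟩ := mem_iUnion₂.1 (ht hx)
    exact mem_iUnion₂.2 ⟨p, hp, hx, hxp⟩
  refine ⟨∑ p ∈ t, C p, ENNReal.sum_ne_top.2 fun p hp => hC p (htA p hp), ?_, fun x => ?_⟩
  · rw [area, surfaceMeasure, Measure.restrict_apply_univ]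
    exact (measure_mono hcov).trans ((measure_biUnion_finset_le _ _).trans
      (Finset.sum_le_sum fun p hp => hC1 p (htA p hp)))
  · rw [surfaceMeasure]
    calc _ ≤ ∫⁻ y in ⋃ p ∈ t, A ∩ Metric.ball p (r p), (edist x y)⁻¹
          ∂(Measure.euclideanHausdorffMeasure 2 : Measure E3) := lintegral_mono_set hcov
      _ ≤ ∑ p ∈ t, ∫⁻ y in A ∩ Metric.ball p (r p), (edist x y)⁻¹
          ∂(Measure.euclideanHausdorffMeasure 2 : Measure E3) := by
        rw [← lintegral_finsetSum_measure]
        refine lintegral_mono' (Measure.le_iff.2 fun s hs => ?_) le_rfl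
        simp only [Measure.restrict_apply hs, Measure.finsetSum_apply, inter_iUnion]
        exact measure_biUnion_finset_le _ _
      _ ≤ _ := Finset.sum_le_sum fun p hp => hC2 p (htA p hp) x

theorem IsClosedSmoothSurface.area_lt_top {A : Set E3} (hA : IsClosedSmoothSurface A) :
    area A < ⊤ := by
  obtain ⟨C, hC, h, -⟩ := hA.exists_potential_bound
  exact h.trans_lt hC.lt_top

theorem lintegral_potential_le_gammaSup {A : Set E3} {x : E3} (hx : x ∈ A) :
    ∫⁻ y, (edist x y)⁻¹ ∂(surfaceMeasure A) ≤ ENNReal.ofReal (4 * Real.pi) * gammaSup A := by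
  rw [gammaSup, ← mul_assoc, ENNReal.mul_inv_cancel (by simp [Real.pi_pos]) ENNReal.ofReal_ne_top,
    one_mul]
  exact le_iSup₂ (f := fun x (_ : x ∈ A) => ∫⁻ y, (edist x y)⁻¹ ∂(surfaceMeasure A)) x hx

theorem IsClosedSmoothSurface.gammaSup_lt_top {A : Set E3} (hA : IsClosedSmoothSurface A) :
    gammaSup A < ⊤ := by
  obtain ⟨C, hC, -, h⟩ := hA.exists_potential_bound
  refine ENNReal.mul_lt_top ?_ (lt_of_le_of_lt (iSup₂_le fun x _ => h x) hC.lt_top)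
  exact ENNReal.inv_lt_top.2 (by simp [Real.pi_pos])

/-- Off the surface the potential is at most twice its supremum on the surface. -/
theorem lintegral_potential_le_two_mul_gammaSup {A : Set E3} (hA : IsCompact A)
    (hne : A.Nonempty) (x : E3) :
    ∫⁻ y, (edist x y)⁻¹ ∂(surfaceMeasure A) ≤ ENNReal.ofReal (8 * Real.pi) * gammaSup A := by
  obtain ⟨x', hx', hd⟩ := hA.exists_infEDist_eq_edist hne x
  calc ∫⁻ y, (edist x y)⁻¹ ∂(surfaceMeasure A)
      ≤ ∫⁻ y, 2 * (edist x' y)⁻¹ ∂(surfaceMeasure A) := by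
        rw [surfaceMeasure]
        refine setLIntegral_mono' hA.measurableSet fun y hy => ?_
        -- The nearest point `x'` is no further from `x` than `y` is.
        have h1 : edist x' y ≤ 2 * edist x y := by
          calc edist x' y ≤ edist x' x + edist x y := edist_triangle _ _ _
            _ ≤ edist x y + edist x y := by
              gcongr
              rw [edist_comm, ← hd]
              exact Metric.infEDist_le_edist_of_mem hy
            _ = _ := (two_mul _).symm
        rw [← ENNReal.inv_le_inv, ENNReal.mul_inv (by simp) (by simp)] at h1
        calc (edist x y)⁻¹ = 2 * (2⁻¹ * (edist x y)⁻¹) := by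
              rw [← mul_assoc, ENNReal.mul_inv_cancel (by simp) (by simp), one_mul]
          _ ≤ _ := by gcongr
    _ = 2 * ∫⁻ y, (edist x' y)⁻¹ ∂(surfaceMeasure A) :=
        lintegral_const_mul' _ _ (by simp)
    _ ≤ 2 * (ENNReal.ofReal (4 * Real.pi) * gammaSup A) := by
        gcongr
        exact lintegral_potential_le_gammaSup hx'
    _ = _ := by
        rw [← mul_assoc, show (2 : ℝ≥0∞) = ENNReal.ofReal 2 by simp, ← ENNReal.ofReal_mul (by simp)]
        ring_nf

theorem IsClosedSmoothSurface.image {A : Set E3} (hA : IsClosedSmoothSurface A)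
    (e : E3 ≃L[ℝ] E3) : IsClosedSmoothSurface (e '' A) where
  isCompact := hA.isCompact.image e.continuous
  isConnected := hA.isConnected.image e e.continuous.continuousOn
  regular := by
    rintro _ ⟨p, hp, rfl⟩
    obtain ⟨U, F, hU, hpU, hF, hFA, hF'⟩ := hA.regular p hp
    have hmaps : MapsTo e.symm (e.symm ⁻¹' U) U := fun _ h => h
    refine ⟨e.symm ⁻¹' U, F ∘ e.symm, hU.preimage e.symm.continuous, by simpa using hpU,
      hF.comp e.symm.contDiff.contDiffOn hmaps, fun q hq => ?_, fun q hq h0 => ?_⟩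
    · rw [Function.comp_apply, ← hFA _ hq]
      constructor
      · rintro ⟨a, ha, rfl⟩
        simpa using ha
      · intro h
        exact ⟨_, h, by simp⟩
    · obtain ⟨hqU, a, ha, rfl⟩ := hq
      have haU : a ∈ U := by simpa using hqU
      apply hF' a ⟨haU, ha⟩
      have hd : DifferentiableAt ℝ F (e.symm (e a)) := by
        rw [e.symm_apply_apply]
        exact (hF.contDiffAt (hU.mem_nhds haU)).differentiableAt (by simp)
      rw [fderiv_comp _ hd e.symm.differentiableAt, ContinuousLinearEquiv.fderiv,
        e.symm_apply_apply] at h0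
      ext v
      have := congrArg (fun L => L (e v)) h0
      simpa using this

/-! ### The Hardy inequality of a positive supersolution -/

theorem IsTest.hasLineDerivAt_normSq {φ : E3 → ℂ} (hφ : IsTest φ) (i : Fin 3) (x : E3) :
    HasLineDerivAt ℝ (fun y => ‖φ y‖ ^ 2) (2 * inner ℝ (φ x) (partialDeriv i φ x)) x
      (EuclideanSpace.single i 1) := by
  have h : HasFDerivAt φ (fderiv ℝ φ x) x :=
    ((hφ.1.differentiable (by simp)) x).hasFDerivAt
  simpa [partialDeriv, mul_add] using h.norm_sq.hasLineDerivAt (EuclideanSpace.single i 1)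

theorem IsTest.continuous_partialDeriv {φ : E3 → ℂ} (hφ : IsTest φ) (i : Fin 3) :
    Continuous (partialDeriv i φ) :=
  (hφ.1.continuous_fderiv (by simp)).clm_apply continuous_const

theorem IsTest.hasCompactSupport_partialDeriv {φ : E3 → ℂ} (hφ : IsTest φ) (i : Fin 3) :
    HasCompactSupport (partialDeriv i φ) :=
  hφ.2.fderiv_apply ℝ (EuclideanSpace.single i 1)

/-- With `V = -w₁/w` one has `∂V = -w₂/w + V²`. Expanding `0 ≤ ∫ |∂φ + Vφ|²` and integrating the
cross term `∫ V ∂|φ|²` by parts leaves exactly the claim. Treating a single direction suffices: the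
sum over `i` produces `-Δw/w` and the full gradient. -/
theorem IsTest.integral_supersolution_le {φ : E3 → ℂ} (hφ : IsTest φ) (i : Fin 3)
    {w w₁ w₂ : E3 → ℝ} (hw : Continuous w) (hw₁ : Continuous w₁) (hw₂ : Continuous w₂)
    (hpos : ∀ x, 0 < w x) (hd : ∀ x, HasLineDerivAt ℝ w (w₁ x) x (EuclideanSpace.single i 1))
    (hd₁ : ∀ x, HasLineDerivAt ℝ w₁ (w₂ x) x (EuclideanSpace.single i 1)) :
    ∫ x, (-w₂ x / w x) * ‖φ x‖ ^ 2 ≤ ∫ x, ‖partialDeriv i φ x‖ ^ 2 := by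
  have hne : ∀ x, w x ≠ 0 := fun x => (hpos x).ne'
  have hcφ := hφ.1.continuous
  have hcd := hφ.continuous_partialDeriv i
  have hn : HasCompactSupport fun x => ‖φ x‖ ^ 2 := hφ.2.norm.comp_left (g := fun t => t ^ 2) (by simp)
  have hn' : HasCompactSupport fun x => 2 * inner ℝ (φ x) (partialDeriv i φ x) := by
    refine hφ.2.mono fun x hx => ?_
    contrapose! hx
    simp_all
  have hnd : HasCompactSupport fun x => ‖partialDeriv i φ x‖ ^ 2 :=
    (hφ.hasCompactSupport_partialDeriv i).norm.comp_left (g := fun t => t ^ 2) (by simp)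
  have hdV : ∀ x, HasLineDerivAt ℝ (fun y => -w₁ y / w y) (-w₂ x / w x + w₁ x ^ 2 / w x ^ 2) x
      (EuclideanSpace.single i 1) := by
    intro x
    have h1 : HasDerivAt (fun t : ℝ => w (x + t • EuclideanSpace.single i (1 : ℝ))) (w₁ x) 0 := hd x
    have h2 : HasDerivAt (fun t : ℝ => w₁ (x + t • EuclideanSpace.single i (1 : ℝ))) (w₂ x) 0 :=
      hd₁ x
    have h3 := h2.neg.div h1 (hne _)
    refine HasDerivAt.congr_deriv h3 ?_
    have := hne x
    simp only [zero_smul, add_zero, Pi.neg_apply]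
    field_simp
    ring
  have hVc : Continuous fun x => -w₁ x / w x := hw₁.neg.div hw hne
  have hV'c : Continuous fun x => -w₂ x / w x + w₁ x ^ 2 / w x ^ 2 :=
    (hw₂.neg.div hw hne).add ((hw₁.pow 2).div (hw.pow 2) fun x => pow_ne_zero 2 (hne x))
  have hnc : Continuous fun x => ‖φ x‖ ^ 2 := by fun_prop
  have hn'c : Continuous fun x => 2 * inner ℝ (φ x) (partialDeriv i φ x) := by fun_prop
  have hint : ∀ {f g : E3 → ℝ}, Continuous f → Continuous g → HasCompactSupport g →
      Integrable (fun x => f x * g x) := fun hf hg hs =>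
    (hf.mul hg).integrable_of_hasCompactSupport hs.mul_left
  have hibp := integral_bilinear_hasLineDerivAt_right_eq_neg_left_of_integrable
    (μ := (volume : Measure E3)) (B := ContinuousLinearMap.mul ℝ ℝ)
    (f := fun x => -w₁ x / w x) (g := fun x => ‖φ x‖ ^ 2)
    (hint hV'c hnc hn) (hint hVc hn'c hn') (hint hVc hnc hn)
    (fun x _ => hdV x) (fun x _ => hφ.hasLineDerivAt_normSq i x)
  simp only [ContinuousLinearMap.mul_apply'] at hibp
  have hI1 := hint hV'c hnc hn
  have hI2 := hint hVc hn'c hn'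
  have hI3 : Integrable fun x => (-w₁ x / w x) ^ 2 * ‖φ x‖ ^ 2 := hint (hVc.pow 2) hnc hn
  have hI4 : Integrable fun x => ‖partialDeriv i φ x‖ ^ 2 :=
    (hcd.norm.pow 2).integrable_of_hasCompactSupport hnd
  have hle : 0 ≤ ∫ x, (‖partialDeriv i φ x‖ ^ 2 +
      (-w₁ x / w x) * (2 * inner ℝ (φ x) (partialDeriv i φ x)) +
      (-w₁ x / w x) ^ 2 * ‖φ x‖ ^ 2) := by
    refine integral_nonneg fun x => ?_
    have := norm_add_sq_real (partialDeriv i φ x) ((-w₁ x / w x) • φ x)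
    rw [inner_smul_right, norm_smul, mul_pow, Real.norm_eq_abs, sq_abs, real_inner_comm] at this
    have h2 := sq_nonneg ‖partialDeriv i φ x + (-w₁ x / w x) • φ x‖
    simp only [Pi.zero_apply]
    linarith
  have hI5 : Integrable fun x => ‖partialDeriv i φ x‖ ^ 2 +
      (-w₁ x / w x) * (2 * inner ℝ (φ x) (partialDeriv i φ x)) := hI4.add hI2
  rw [integral_add hI5 hI3, integral_add hI4 hI2, hibp] at hle
  have hsub : ∫ x, (-w₂ x / w x) * ‖φ x‖ ^ 2 =
      (∫ x, (-w₂ x / w x + w₁ x ^ 2 / w x ^ 2) * ‖φ x‖ ^ 2) -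
        ∫ x, (-w₁ x / w x) ^ 2 * ‖φ x‖ ^ 2 := by
    rw [← integral_sub hI1 hI3]
    congr 1
    funext x
    ring
  linarith

/-! ### Regularised Newtonian potentials -/

theorem hasLineDerivAt_integral_sub (ν : Measure E3) [IsFiniteMeasure ν] {k k' : E3 → ℝ} {v : E3}
    (hk : Continuous k) (hk' : Continuous k') {B B' : ℝ} (hB : ∀ x, |k x| ≤ B)
    (hB' : ∀ x, |k' x| ≤ B') (hd : ∀ x, HasLineDerivAt ℝ k (k' x) x v) (x : E3) :
    HasLineDerivAt ℝ (fun x => ∫ y, k (x - y) ∂ν) (∫ y, k' (x - y) ∂ν) x v := by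
  have h := (hasDerivAt_integral_of_dominated_loc_of_deriv_le (μ := ν) (x₀ := (0 : ℝ))
    (F := fun t y => k (x + t • v - y)) (F' := fun t y => k' (x + t • v - y)) (s := univ)
    (bound := fun _ => B') univ_mem (Eventually.of_forall fun t =>
      (hk.comp (by fun_prop)).aestronglyMeasurable) ?_
      (hk'.comp (by fun_prop)).aestronglyMeasurable
      (ae_of_all _ fun y t _ => hB' _) (integrable_const _) (ae_of_all _ fun y t _ => ?_)).2
  · simpa [HasLineDerivAt] using h
  · exact Integrable.mono' (integrable_const B) (hk.comp (by fun_prop)).aestronglyMeasurable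
      (ae_of_all _ fun y => hB _)
  · have h1 : HasDerivAt (fun s : ℝ => k (x + t • v - y + s • v)) (k' (x + t • v - y)) 0 := hd _
    have h2 : HasDerivAt (fun s : ℝ => s - t) 1 t := (hasDerivAt_id t).sub_const t
    have h3 := HasDerivAt.scomp t (h := fun s : ℝ => s - t) (by simpa using h1) h2
    rw [one_smul] at h3
    refine h3.congr_of_eventuallyEq (Eventually.of_forall fun s => ?_)
    simp only [Function.comp_apply, sub_smul]
    congr 1
    abel

theorem continuous_integral_sub (ν : Measure E3) [IsFiniteMeasure ν] {k : E3 → ℝ}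
    (hk : Continuous k) {B : ℝ} (hB : ∀ x, |k x| ≤ B) :
    Continuous fun x => ∫ y, k (x - y) ∂ν :=
  continuous_of_dominated (bound := fun _ => B)
    (fun _ => (hk.comp (by fun_prop)).aestronglyMeasurable) (fun _ => ae_of_all _ fun _ => hB _)
    (integrable_const _) (ae_of_all _ fun _ => hk.comp (by fun_prop))

/-- The regularised distance `√(|x|² + δ²)`. -/
noncomputable def softNorm (δ : ℝ) (x : E3) : ℝ := Real.sqrt (‖x‖ ^ 2 + δ ^ 2)

theorem le_softNorm {δ : ℝ} (x : E3) : δ ≤ softNorm δ x :=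
  Real.le_sqrt_of_sq_le (by nlinarith [sq_nonneg ‖x‖])

theorem softNorm_sq {δ : ℝ} (x : E3) : softNorm δ x ^ 2 = ‖x‖ ^ 2 + δ ^ 2 :=
  Real.sq_sqrt (by positivity)

theorem softNorm_pos {δ : ℝ} (hδ : 0 < δ) (x : E3) : 0 < softNorm δ x :=
  hδ.trans_le (le_softNorm x)

theorem norm_le_softNorm {δ : ℝ} (x : E3) : ‖x‖ ≤ softNorm δ x :=
  Real.le_sqrt_of_sq_le (by nlinarith [sq_nonneg δ])

theorem abs_apply_le_softNorm {δ : ℝ} (x : E3) (i : Fin 3) : |x i| ≤ softNorm δ x :=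
  (PiLp.norm_apply_le x i).trans (norm_le_softNorm x)

theorem continuous_softNorm (δ : ℝ) : Continuous (softNorm δ) := by
  unfold softNorm
  fun_prop

theorem hasDerivAt_softNorm {δ : ℝ} (hδ : 0 < δ) (i : Fin 3) (x : E3) :
    HasDerivAt (fun t : ℝ => softNorm δ (x + t • EuclideanSpace.single i (1 : ℝ)))
      (x i / softNorm δ x) 0 := by
  have h1 : HasLineDerivAt ℝ (fun y : E3 => ‖y‖ ^ 2) (2 * x i) x (EuclideanSpace.single i 1) := by
    simpa [EuclideanSpace.inner_single_right] using (hasFDerivAt_id x).norm_sq.hasLineDerivAt (EuclideanSpace.single i 1)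
  have h2 : HasDerivAt (fun t : ℝ => ‖x + t • EuclideanSpace.single i (1 : ℝ)‖ ^ 2 + δ ^ 2)
      (2 * x i) 0 := HasDerivAt.add_const (δ ^ 2) h1
  have h3 := h2.sqrt (by positivity)
  refine h3.congr_deriv ?_
  have := softNorm_pos hδ x
  simp only [zero_smul, add_zero]
  change 2 * x i / (2 * softNorm δ x) = _
  field_simp

theorem hasDerivAt_coord (i : Fin 3) (x : E3) :
    HasDerivAt (fun t : ℝ => (x + t • EuclideanSpace.single i (1 : ℝ)) i) 1 0 := by
  simpa using (hasDerivAt_id (0 : ℝ)).const_add (x i)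

theorem hasLineDerivAt_inv_softNorm {δ : ℝ} (hδ : 0 < δ) (i : Fin 3) (x : E3) :
    HasLineDerivAt ℝ (fun y => (softNorm δ y)⁻¹) (-(x i / softNorm δ x ^ 3)) x
      (EuclideanSpace.single i 1) := by
  have h := (hasDerivAt_softNorm hδ i x).inv (softNorm_pos hδ _).ne'
  refine HasDerivAt.congr_deriv h ?_
  have := softNorm_pos hδ x
  simp only [zero_smul, add_zero]
  field_simp

theorem hasLineDerivAt_div_softNorm {δ : ℝ} (hδ : 0 < δ) (i : Fin 3) (x : E3) :
    HasLineDerivAt ℝ (fun y => -(y i / softNorm δ y ^ 3))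
      (-(1 / softNorm δ x ^ 3) + 3 * x i ^ 2 / softNorm δ x ^ 5) x
      (EuclideanSpace.single i 1) := by
  have h := ((hasDerivAt_coord i x).div ((hasDerivAt_softNorm hδ i x).pow 3)
    (pow_ne_zero 3 (softNorm_pos hδ _).ne')).neg
  refine HasDerivAt.congr_deriv h ?_
  have := softNorm_pos hδ x
  simp only [Pi.pow_apply, zero_smul, add_zero]
  field_simp
  push_cast
  ring

/-- The mollifier that is minus the Laplacian of `1 / softNorm δ`. -/
noncomputable def softDelta (δ : ℝ) (x : E3) : ℝ := 3 * δ ^ 2 / softNorm δ x ^ 5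

theorem continuous_softDelta {δ : ℝ} (hδ : 0 < δ) : Continuous (softDelta δ) :=
  continuous_const.div ((continuous_softNorm δ).pow 5) fun x =>
    pow_ne_zero 5 (softNorm_pos hδ x).ne'

theorem softDelta_nonneg {δ : ℝ} (x : E3) : 0 ≤ softDelta δ x := by
  unfold softDelta softNorm
  positivity

theorem abs_softDelta_le {δ : ℝ} (hδ : 0 < δ) (x : E3) : |softDelta δ x| ≤ 3 * δ ^ 2 / δ ^ 5 := by
  rw [abs_of_nonneg (softDelta_nonneg x), softDelta]
  have := le_softNorm (δ := δ) x
  gcongr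

/-- Integrated over the ball of radius `δ`, this lower bound gives mass `2π/3 > 1`. Nothing more
about the concentration of `softDelta` is needed, at the price of a constant that is not sharp. -/
theorem le_softDelta {δ : ℝ} (hδ : 0 < δ) {x : E3} (hx : ‖x‖ < δ) :
    1 / (2 * δ ^ 3) ≤ softDelta δ x := by
  have h1 := softNorm_pos hδ x
  have h2 : softNorm δ x ^ 2 ≤ 2 * δ ^ 2 := by
    rw [softNorm_sq]
    nlinarith [norm_nonneg x]
  have h3 : softNorm δ x ≤ 3 / 2 * δ := abs_le_of_sq_le_sq' (by nlinarith) (by positivity) |>.2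
  unfold softDelta
  rw [div_le_div_iff₀ (by positivity) (by positivity)]
  calc 1 * softNorm δ x ^ 5 = (softNorm δ x ^ 2) ^ 2 * softNorm δ x := by ring
    _ ≤ (2 * δ ^ 2) ^ 2 * (3 / 2 * δ) := by gcongr
    _ = 3 * δ ^ 2 * (2 * δ ^ 3) := by ring

/-- The regularised potential `w` of `ν` is positive, satisfies `-Δw = ∫ softDelta δ (x - y) dν(y)`,
and is at most `M` because `softNorm` dominates the norm. Hence `-Δw ≤ M (-Δw/w)`, and the Hardy
inequality applies. -/
theorem IsTest.integral_softDelta_le {φ : E3 → ℂ} (hφ : IsTest φ) (ν : Measure E3)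
    [IsFiniteMeasure ν] (hν : ν ≠ 0) {M : ℝ} (hM0 : 0 ≤ M)
    (hM : ∀ x, ∫⁻ y, (edist x y)⁻¹ ∂ν ≤ ENNReal.ofReal M) {δ : ℝ} (hδ : 0 < δ) :
    ∫ x, (∫ y, softDelta δ (x - y) ∂ν) * ‖φ x‖ ^ 2 ≤ M * ∑ i, ∫ x, ‖partialDeriv i φ x‖ ^ 2 := by
  have hs := fun x => softNorm_pos hδ x
  have hsc := continuous_softNorm δ
  have hsne : ∀ x, softNorm δ x ≠ 0 := fun x => (hs x).ne'
  set k₀ : E3 → ℝ := fun y => (softNorm δ y)⁻¹ with hk₀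
  set k₁ : Fin 3 → E3 → ℝ := fun i y => -(y i / softNorm δ y ^ 3) with hk₁
  set k₂ : Fin 3 → E3 → ℝ :=
    fun i y => -(1 / softNorm δ y ^ 3) + 3 * y i ^ 2 / softNorm δ y ^ 5 with hk₂
  have c₀ : Continuous k₀ := hsc.inv₀ hsne
  have c₁ : ∀ i, Continuous (k₁ i) := fun i =>
    ((by fun_prop : Continuous fun y : E3 => y i).div (hsc.pow 3) fun x => pow_ne_zero 3 (hsne x)).neg
  have c₂ : ∀ i, Continuous (k₂ i) := fun i =>
    ((continuous_const.div (hsc.pow 3) fun x => pow_ne_zero 3 (hsne x)).neg).add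
      ((by fun_prop : Continuous fun y : E3 => 3 * y i ^ 2).div (hsc.pow 5)
        fun x => pow_ne_zero 5 (hsne x))
  have b₀ : ∀ x, |k₀ x| ≤ δ⁻¹ := fun x => by
    rw [hk₀, abs_of_pos (inv_pos.2 (hs x))]
    exact inv_anti₀ hδ (le_softNorm x)
  have b₁ : ∀ i x, |k₁ i x| ≤ (δ ^ 2)⁻¹ := fun i x => by
    rw [hk₁]
    simp only [abs_neg, abs_div, abs_of_pos (pow_pos (hs x) 3)]
    calc |x i| / softNorm δ x ^ 3 ≤ softNorm δ x / softNorm δ x ^ 3 := by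
          have := hs x
          gcongr
          exact abs_apply_le_softNorm x i
      _ = (softNorm δ x ^ 2)⁻¹ := by
          have := hs x
          field_simp
      _ ≤ _ := inv_anti₀ (by positivity) (pow_le_pow_left₀ hδ.le (le_softNorm x) 2)
  have b₂ : ∀ i x, |k₂ i x| ≤ 4 * (δ ^ 3)⁻¹ := fun i x => by
    have h0 := hs x
    have h1 : (softNorm δ x ^ 3)⁻¹ ≤ (δ ^ 3)⁻¹ :=
      inv_anti₀ (by positivity) (pow_le_pow_left₀ hδ.le (le_softNorm x) 3)
    have h2 : 3 * x i ^ 2 / softNorm δ x ^ 5 ≤ 3 * (softNorm δ x ^ 3)⁻¹ := by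
      rw [div_le_iff₀ (by positivity)]
      have h3 : x i ^ 2 ≤ softNorm δ x ^ 2 := by
        rw [← sq_abs]
        exact pow_le_pow_left₀ (abs_nonneg _) (abs_apply_le_softNorm x i) 2
      calc 3 * x i ^ 2 ≤ 3 * softNorm δ x ^ 2 := by linarith
        _ = _ := by field_simp
    have h4 : 0 ≤ 3 * x i ^ 2 / softNorm δ x ^ 5 := by positivity
    have h5 : 0 < (softNorm δ x ^ 3)⁻¹ := by positivity
    simp only [hk₂, abs_le, one_div]
    constructor <;> linarith
  set w : E3 → ℝ := fun x => ∫ y, k₀ (x - y) ∂ν with hw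
  have hwM : ∀ x, w x ≤ M := fun x => by
    rw [hw]
    simp only
    rw [integral_eq_lintegral_of_nonneg_ae (ae_of_all _ fun y => (inv_pos.2 (hs _)).le)
      (c₀.comp (by fun_prop)).aestronglyMeasurable]
    refine ENNReal.toReal_le_of_le_ofReal hM0 (le_trans (lintegral_mono fun y => ?_) (hM x))
    rw [ENNReal.ofReal_inv_of_pos (hs _), ENNReal.inv_le_inv, edist_dist]
    refine ENNReal.ofReal_le_ofReal ?_
    rw [dist_eq_norm]
    exact norm_le_softNorm _
  have hint₀ : ∀ x, Integrable (fun y => k₀ (x - y)) ν := fun x =>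
    Integrable.mono' (integrable_const δ⁻¹) (c₀.comp (by fun_prop)).aestronglyMeasurable
      (ae_of_all _ fun y => b₀ _)
  have hint₂ : ∀ i x, Integrable (fun y => k₂ i (x - y)) ν := fun i x =>
    Integrable.mono' (integrable_const _) ((c₂ i).comp (by fun_prop)).aestronglyMeasurable
      (ae_of_all _ fun y => b₂ i _)
  have hwpos : ∀ x, 0 < w x := fun x => by
    rw [hw]
    refine (integral_pos_iff_support_of_nonneg (fun y => (inv_pos.2 (hs _)).le) (hint₀ x)).2 ?_
    have : Function.support (fun y => k₀ (x - y)) = univ := by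
      ext y
      simp [hk₀, hsne]
    rw [this]
    exact Measure.measure_univ_pos.2 hν
  have cw : Continuous w := continuous_integral_sub ν c₀ b₀
  have cw₂ : ∀ i, Continuous fun x => ∫ y, k₂ i (x - y) ∂ν := fun i =>
    continuous_integral_sub ν (c₂ i) (b₂ i)
  have hmain := fun i => hφ.integral_supersolution_le i cw
    (continuous_integral_sub ν (c₁ i) (b₁ i)) (cw₂ i) hwpos
    (hasLineDerivAt_integral_sub ν c₀ (c₁ i) b₀ (b₁ i) (hasLineDerivAt_inv_softNorm hδ i))
    (hasLineDerivAt_integral_sub ν (c₁ i) (c₂ i) (b₁ i) (b₂ i) (hasLineDerivAt_div_softNorm hδ i))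
  have hn : HasCompactSupport fun x => ‖φ x‖ ^ 2 :=
    hφ.2.norm.comp_left (g := fun t => t ^ 2) (by simp)
  have hnc : Continuous fun x => ‖φ x‖ ^ 2 := by
    have := hφ.1.continuous
    fun_prop
  have hI : ∀ {f : E3 → ℝ}, Continuous f → Integrable (fun x => f x * ‖φ x‖ ^ 2) := fun hf =>
    (hf.mul hnc).integrable_of_hasCompactSupport hn.mul_left
  -- Pointwise this is `3/s³ - 3|x|²/s⁵ = 3δ²/s⁵` with `s² = |x|² + δ²`.
  have hlap : ∀ x, ∫ y, softDelta δ (x - y) ∂ν = ∑ i, -∫ y, k₂ i (x - y) ∂ν := fun x => by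
    rw [Finset.sum_neg_distrib, ← integral_finsetSum _ fun i _ => hint₂ i x, ← integral_neg]
    congr 1
    funext y
    have h1 := softNorm_sq (δ := δ) (x - y)
    rw [EuclideanSpace.norm_sq_eq] at h1
    have h2 := hs (x - y)
    have h3 : δ ^ 2 = softNorm δ (x - y) ^ 2 - ∑ i, (x - y) i ^ 2 := by
      rw [h1]
      simp
    rw [softDelta, h3]
    simp only [hk₂, Fin.sum_univ_three]
    field_simp
    ring
  have hδν : Continuous fun x => ∫ y, softDelta δ (x - y) ∂ν := by
    simp only [hlap]
    exact continuous_finsetSum _ fun i _ => (cw₂ i).neg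
  calc ∫ x, (∫ y, softDelta δ (x - y) ∂ν) * ‖φ x‖ ^ 2
      ≤ ∫ x, M * (((∫ y, softDelta δ (x - y) ∂ν) / w x) * ‖φ x‖ ^ 2) := by
        refine integral_mono (hI hδν) ((hI (hδν.div cw fun x => (hwpos x).ne')).const_mul M)
          fun x => ?_
        have h1 : 0 ≤ ∫ y, softDelta δ (x - y) ∂ν := integral_nonneg fun y => softDelta_nonneg _
        simp only
        rw [← mul_assoc]
        gcongr
        rw [mul_div_assoc', le_div_iff₀ (hwpos x), mul_comm]
        exact mul_le_mul_of_nonneg_right (hwM x) h1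
    _ = M * ∑ i, ∫ x, (-(∫ y, k₂ i (x - y) ∂ν) / w x) * ‖φ x‖ ^ 2 := by
        have hI' : ∀ i ∈ Finset.univ, Integrable fun x =>
            (-(∫ y, k₂ i (x - y) ∂ν) / w x) * ‖φ x‖ ^ 2 := fun i _ =>
          hI ((cw₂ i).neg.div cw fun x => (hwpos x).ne')
        rw [integral_const_mul, ← integral_finsetSum _ hI']
        congr 2
        funext x
        rw [hlap, Finset.sum_div, Finset.sum_mul]
    _ ≤ _ := mul_le_mul_of_nonneg_left (Finset.sum_le_sum fun i _ => hmain i) hM0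

/-- The trace inequality: a finite measure with potential at most `M` is form bounded by the
Laplacian with constant `M`. -/
theorem IsTest.integral_norm_sq_le {φ : E3 → ℂ} (hφ : IsTest φ) (ν : Measure E3)
    [IsFiniteMeasure ν] {M : ℝ} (hM0 : 0 ≤ M)
    (hM : ∀ x, ∫⁻ y, (edist x y)⁻¹ ∂ν ≤ ENNReal.ofReal M) :
    ∫ x, ‖φ x‖ ^ 2 ∂ν ≤ M * ∑ i, ∫ x, ‖partialDeriv i φ x‖ ^ 2 := by
  set R := M * ∑ i, ∫ x, ‖partialDeriv i φ x‖ ^ 2 with hR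
  have hR0 : 0 ≤ R := mul_nonneg hM0 (Finset.sum_nonneg fun i _ => integral_nonneg fun x => by positivity)
  rcases eq_or_ne ν 0 with rfl | hν
  · simpa using hR0
  have hn : HasCompactSupport fun x => ‖φ x‖ ^ 2 :=
    hφ.2.norm.comp_left (g := fun t => t ^ 2) (by simp)
  have hnc : Continuous fun x => ‖φ x‖ ^ 2 := by
    have := hφ.1.continuous
    fun_prop
  have huc : UniformContinuous fun x => ‖φ x‖ ^ 2 := hn.uniformContinuous_of_continuous hnc
  -- The mollified inequality is compared with the one for `ν` at a loss of `e`: `δ` is chosen by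
  -- uniform continuity so that `|φ|²` varies by less than `e` over distances below `δ`.
  have key : ∀ e > 0, ∫ x, (‖φ x‖ ^ 2 - e) ∂ν ≤ R := by
    intro e he
    obtain ⟨δ, hδ, hδe⟩ := Metric.uniformContinuous_iff.1 huc e he
    have h1 := hφ.integral_softDelta_le ν hν hM0 hM hδ
    have hcd : Continuous fun p : E3 × E3 => softDelta δ (p.1 - p.2) * ‖φ p.1‖ ^ 2 :=
      ((continuous_softDelta hδ).comp (by fun_prop)).mul (hnc.comp continuous_fst)
    have hci := continuous_integral_sub ν (continuous_softDelta hδ) (abs_softDelta_le hδ)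
    have hii : ∀ x, Integrable (fun y => softDelta δ (x - y)) ν := fun x =>
      Integrable.mono' (integrable_const _)
        ((continuous_softDelta hδ).comp (by fun_prop)).aestronglyMeasurable
        (ae_of_all _ fun y => abs_softDelta_le hδ _)
    have h2 : ∫⁻ x, ∫⁻ y, ENNReal.ofReal (softDelta δ (x - y) * ‖φ x‖ ^ 2) ∂ν ≤
        ENNReal.ofReal R := by
      refine le_trans (le_of_eq ?_) (ENNReal.ofReal_le_ofReal h1)
      have hint : Integrable fun x => (∫ y, softDelta δ (x - y) ∂ν) * ‖φ x‖ ^ 2 :=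
        (hci.mul hnc).integrable_of_hasCompactSupport hn.mul_left
      rw [ofReal_integral_eq_lintegral_ofReal hint (ae_of_all _ fun x =>
          mul_nonneg (integral_nonneg fun y => softDelta_nonneg _) (by positivity))]
      refine lintegral_congr fun x => ?_
      rw [← integral_mul_const, ofReal_integral_eq_lintegral_ofReal ((hii x).mul_const _)
        (ae_of_all _ fun y => mul_nonneg (softDelta_nonneg _) (by positivity))]
    -- After the interchange, `|φ|²` is averaged against `softDelta` around each fixed point `y`.
    rw [lintegral_lintegral_swap (by
      exact (hcd.measurable.ennreal_ofReal).aemeasurable)] at h2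
    have h3 : ∫⁻ y, ENNReal.ofReal (‖φ y‖ ^ 2 - e) ∂ν ≤ ENNReal.ofReal R := by
      refine le_trans (lintegral_mono fun y => ?_) h2
      rcases le_total (‖φ y‖ ^ 2 - e) 0 with hneg | hpos
      · simp [ENNReal.ofReal_of_nonpos hneg]
      calc ENNReal.ofReal (‖φ y‖ ^ 2 - e)
          ≤ ENNReal.ofReal (1 / (2 * δ ^ 3) * (‖φ y‖ ^ 2 - e) * (δ ^ 3 * (Real.pi * 4 / 3))) := by
            refine ENNReal.ofReal_le_ofReal ?_
            have : 1 / (2 * δ ^ 3) * (‖φ y‖ ^ 2 - e) * (δ ^ 3 * (Real.pi * 4 / 3)) =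
                (‖φ y‖ ^ 2 - e) * (Real.pi * 2 / 3) := by
              field_simp
              ring
            rw [this]
            -- Here `1 ≤ 2π/3` enters.
            nlinarith [Real.pi_gt_three]
        _ = ∫⁻ x in Metric.ball y δ, ENNReal.ofReal (1 / (2 * δ ^ 3) * (‖φ y‖ ^ 2 - e)) := by
            rw [setLIntegral_const, EuclideanSpace.volume_ball_fin_three,
              ← ENNReal.ofReal_pow hδ.le, ← ENNReal.ofReal_mul (by positivity),
              ← ENNReal.ofReal_mul (by positivity)]
        _ ≤ ∫⁻ x in Metric.ball y δ, ENNReal.ofReal (softDelta δ (x - y) * ‖φ x‖ ^ 2) := by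
            refine setLIntegral_mono' Metric.isOpen_ball.measurableSet fun x hx => ?_
            refine ENNReal.ofReal_le_ofReal ?_
            have h4 := hδe (Metric.mem_ball.1 hx)
            rw [Real.dist_eq, abs_lt] at h4
            refine mul_le_mul (le_softDelta hδ ?_) (by linarith) hpos (softDelta_nonneg _)
            rwa [← dist_eq_norm]
        _ ≤ _ := setLIntegral_le_lintegral _ _
    have hint : Integrable (fun x => ‖φ x‖ ^ 2 - e) ν :=
      (hnc.integrable_of_hasCompactSupport hn).sub (integrable_const e)
    rw [integral_eq_lintegral_pos_part_sub_lintegral_neg_part hint]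
    have h5 := ENNReal.toReal_le_of_le_ofReal hR0 h3
    linarith [ENNReal.toReal_nonneg (a := ∫⁻ y, ENNReal.ofReal (-(‖φ y‖ ^ 2 - e)) ∂ν)]
  refine le_of_forall_pos_le_add fun e he => ?_
  set m := ν.real univ with hm
  have hm0 : 0 ≤ m := measureReal_nonneg
  -- The loss is integrated over the total mass `m`; the `+ 1` guards against division by zero.
  have h := key (e / (m + 1)) (by positivity)
  rw [integral_sub (hnc.integrable_of_hasCompactSupport hn) (integrable_const _), integral_const,
    smul_eq_mul, ← hm] at h
  have h6 : m * (e / (m + 1)) ≤ e := by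
    rw [mul_div_assoc', div_le_iff₀ (by positivity)]
    nlinarith
  linarith

/-! ### Positivity of the form and the graph of the operator -/

theorem norm_toLp_sq {μ : Measure E3} {f : E3 → ℂ} (hf : MemLp f 2 μ) :
    ‖hf.toLp f‖ ^ 2 = ∫ x, ‖f x‖ ^ 2 ∂μ := by
  have h0 : 0 ≤ ∫ x, ‖f x‖ ^ 2 ∂μ := integral_nonneg fun x => by positivity
  rw [Lp.norm_toLp, hf.eLpNorm_eq_integral_rpow_norm (by simp) (by simp)]
  simp only [ENNReal.toReal_ofNat, Real.rpow_ofNat]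
  rw [ENNReal.toReal_ofReal (by positivity), ← Real.rpow_natCast, ← Real.rpow_mul h0]
  norm_num

theorem IsTest.memLp_measure {φ : E3 → ℂ} (h : IsTest φ) (ν : Measure E3) [IsFiniteMeasure ν] :
    MemLp φ 2 ν :=
  h.1.continuous.memLp_of_hasCompactSupport h.2

theorem tendsto_integral_norm_sq {μ : Measure E3} {a : ℕ → E3 → ℂ} (g : Lp ℂ 2 μ)
    (ha : ∀ n, MemLp (a n) 2 μ)
    (h : Tendsto (fun n => eLpNorm (fun x => a n x - g x) 2 μ) atTop (𝓝 0)) :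
    Tendsto (fun n => ∫ x, ‖a n x‖ ^ 2 ∂μ) atTop (𝓝 (‖g‖ ^ 2)) := by
  have h1 := (Lp.tendsto_Lp_iff_tendsto_eLpNorm'' a ha g (Lp.memLp g)).2 h
  rw [Lp.toLp_coeFn] at h1
  simpa only [norm_toLp_sq] using (h1.norm.pow 2)

/-- The trace of a Sobolev function is bounded by its gradient. -/
theorem IsTrace.norm_sq_le {A : Set E3} [IsFiniteMeasure (surfaceMeasure A)] {M : ℝ} (hM0 : 0 ≤ M)
    (hM : ∀ x, ∫⁻ y, (edist x y)⁻¹ ∂(surfaceMeasure A) ≤ ENNReal.ofReal M) {u : L2}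
    {G : Fin 3 → L2} {g : L2Surf A} (h : IsTrace A u G g) : ‖g‖ ^ 2 ≤ M * ∑ i, ‖G i‖ ^ 2 := by
  obtain ⟨φ, hφ, -, hG, hg⟩ := h
  refine le_of_tendsto_of_tendsto' (tendsto_integral_norm_sq g
    (fun n => (hφ n).memLp_measure _) hg) (Tendsto.const_mul M (tendsto_finsetSum _ fun i _ =>
      tendsto_integral_norm_sq (G i) (fun n => (hφ n).memLp_partialDeriv i) (hG i)))
    fun n => (hφ n).integral_norm_sq_le _ hM0 hM

theorem isPositiveForm_of_potential_le {A : Set E3} [IsFiniteMeasure (surfaceMeasure A)] {M α : ℝ}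
    (hM0 : 0 ≤ M) (hM : ∀ x, ∫⁻ y, (edist x y)⁻¹ ∂(surfaceMeasure A) ≤ ENNReal.ofReal M)
    (hα : 0 ≤ α) (hαM : α * M ≤ 1) : IsPositiveForm A α := by
  intro u G g h
  have h1 := h.2.norm_sq_le hM0 hM
  have h2 : 0 ≤ ∑ i, ‖G i‖ ^ 2 := Finset.sum_nonneg fun i _ => by positivity
  nlinarith [mul_le_mul_of_nonneg_left h1 hα, mul_le_mul_of_nonneg_right hαM h2]

theorem L2.eq_zero_of_integral_mul_eq_zero (w : L2)
    (h : ∀ φ : E3 → ℂ, IsTest φ → ∫ x, w x * φ x = 0) : w = 0 := by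
  refine (Lp.eq_zero_iff_ae_eq_zero).2 (ae_eq_zero_of_integral_contDiff_smul_eq_zero
    ((Lp.memLp w).locallyIntegrable (by norm_num)) fun g hg hgs => ?_)
  rw [← h (fun x => (g x : ℂ)) ⟨Complex.ofRealCLM.contDiff.comp hg, hgs.comp_left (g := fun t : ℝ => (t : ℂ)) (by simp)⟩]
  congr 1
  funext x
  rw [Complex.real_smul, mul_comm]

theorem IsTest.partialDeriv {φ : E3 → ℂ} (h : IsTest φ) (i : Fin 3) : IsTest (partialDeriv i φ) :=
  ⟨(h.1.fderiv_right (m := ∞) (by simp)).clm_apply contDiff_const,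
    h.hasCompactSupport_partialDeriv i⟩

theorem IsTest.conj {φ : E3 → ℂ} (h : IsTest φ) : IsTest fun x => starRingEnd ℂ (φ x) :=
  ⟨Complex.conjCLE.contDiff.comp h.1, h.2.comp_left (by simp)⟩

theorem IsTest.partialDeriv_conj {φ : E3 → ℂ} (h : IsTest φ) (i : Fin 3) (x : E3) :
    SurfaceInteraction.partialDeriv i (fun x => starRingEnd ℂ (φ x)) x =
      starRingEnd ℂ (SurfaceInteraction.partialDeriv i φ x) := by
  have h1 : HasFDerivAt φ (fderiv ℝ φ x) x := ((h.1.differentiable (by simp)) x).hasFDerivAt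
  have h2 := (Complex.conjCLE.toContinuousLinearMap.hasFDerivAt (x := φ x)).comp x h1
  have h3 : fderiv ℝ (fun x => starRingEnd ℂ (φ x)) x = _ := h2.fderiv
  rw [SurfaceInteraction.partialDeriv, h3]
  rfl

theorem integral_toLp_mul {μ : Measure E3} {f : E3 → ℂ} (hf : MemLp f 2 μ) (ψ : E3 → ℂ) :
    ∫ x, hf.toLp f x * ψ x ∂μ = ∫ x, f x * ψ x ∂μ := by
  refine integral_congr_ae ?_
  filter_upwards [hf.coeFn_toLp] with x hx
  rw [hx]

theorem eLpNorm_sub_toLp {μ : Measure E3} {f : E3 → ℂ} (hf : MemLp f 2 μ) :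
    eLpNorm (fun x => f x - hf.toLp f x) 2 μ = 0 := by
  have : (fun x => f x - hf.toLp f x) =ᵐ[μ] 0 := by
    filter_upwards [hf.coeFn_toLp] with x hx
    simp [hx]
  rw [eLpNorm_congr_ae this, eLpNorm_zero]

theorem IsTest.inFormDomain {φ : E3 → ℂ} (h : IsTest φ) (A : Set E3)
    [IsFiniteMeasure (surfaceMeasure A)] :
    InFormDomain A (h.memLp.toLp φ) (fun i => (h.memLp_partialDeriv i).toLp _)
      ((h.memLp_measure (surfaceMeasure A)).toLp φ) := by
  refine ⟨fun i ψ hψ => ?_, fun _ => φ, fun _ => h, ?_, fun i => ?_, ?_⟩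
  · rw [integral_toLp_mul, integral_toLp_mul]
    have hint : ∀ {f g : E3 → ℂ}, IsTest f → IsTest g → Integrable fun x => f x * g x :=
      fun hf hg => (hf.1.continuous.mul hg.1.continuous).integrable_of_hasCompactSupport
        hg.2.mul_left
    exact integral_mul_fderiv_eq_neg_fderiv_mul_of_integrable (hint (h.partialDeriv i) hψ)
      (hint h (hψ.partialDeriv i)) (hint h hψ) (fun x _ => h.1.differentiable (by simp) x)
      (fun x _ => hψ.1.differentiable (by simp) x)
  · simp only [eLpNorm_sub_toLp]
    exact tendsto_const_nhds
  · simp only [eLpNorm_sub_toLp]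
    exact tendsto_const_nhds
  · simp only [eLpNorm_sub_toLp]
    exact tendsto_const_nhds

theorem inner_toLp_right {μ : Measure E3} (u : Lp ℂ 2 μ) {f : E3 → ℂ} (hf : MemLp f 2 μ) :
    inner ℂ u (hf.toLp f) = starRingEnd ℂ (∫ x, u x * starRingEnd ℂ (f x) ∂μ) := by
  rw [L2.inner_def, ← integral_conj]
  refine integral_congr_ae ?_
  filter_upwards [hf.coeFn_toLp] with x hx
  simp [hx, mul_comm]

theorem HasWeakGradient.inner_eq {v : L2} {K : Fin 3 → L2} (h : HasWeakGradient v K) {φ : E3 → ℂ}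
    (hφ : IsTest φ) (i : Fin 3) :
    inner ℂ (K i) (hφ.memLp.toLp φ) = -inner ℂ v ((hφ.memLp_partialDeriv i).toLp _) := by
  have h1 := h i _ hφ.conj
  simp only [hφ.partialDeriv_conj] at h1
  rw [inner_toLp_right, inner_toLp_right, h1, map_neg, neg_neg]

/-- The Laplacian of a function. -/
noncomputable def lap (φ : E3 → ℂ) (x : E3) : ℂ := ∑ i, partialDeriv i (partialDeriv i φ) x

theorem IsTest.memLp_lap {φ : E3 → ℂ} (h : IsTest φ) : MemLp (lap φ) 2 volume :=
  memLp_finsetSum _ fun i _ => ((h.partialDeriv i).partialDeriv i).memLp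

section Graph

variable {A : Set E3} {M α : ℝ}

/-- `toLinearPMap` has the given submodule as its graph only if that submodule is single-valued. For
`u = 0` the weak gradient vanishes, the trace inequality then forces the trace to vanish too, and
`w` is orthogonal to all test functions. -/
theorem hamiltonianGraph_snd_eq_zero [IsFiniteMeasure (surfaceMeasure A)] (hM0 : 0 ≤ M)
    (hM : ∀ x, ∫⁻ y, (edist x y)⁻¹ ∂(surfaceMeasure A) ≤ ENNReal.ofReal M) (p : L2 × L2)
    (hp : p ∈ hamiltonianGraph A α) (h0 : p.1 = 0) : p.2 = 0 := by
  obtain ⟨G, g, hd, hQ⟩ := hp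
  rw [h0] at hd
  have hG : ∀ i, G i = 0 := fun i => L2.eq_zero_of_integral_mul_eq_zero _ fun φ hφ => by
    have h1 := hd.1 i φ hφ
    rw [eq_comm, neg_eq_iff_eq_neg] at h1
    rw [h1, neg_eq_zero]
    refine integral_eq_zero_of_ae ?_
    filter_upwards [Lp.coeFn_zero ℂ 2 (volume : Measure E3)] with x hx
    rw [hx]
    simp
  have hg : g = 0 := by
    have h1 := hd.2.norm_sq_le hM0 hM
    simp only [hG] at h1
    simpa using h1
  refine L2.eq_zero_of_integral_mul_eq_zero _ fun φ hφ => ?_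
  have h1 := hQ _ _ _ (hφ.conj.inFormDomain A)
  have h2 : formQ α G g (fun i => (hφ.conj.memLp_partialDeriv i).toLp _)
      ((hφ.conj.memLp_measure (surfaceMeasure A)).toLp _) = 0 := by
    simp [formQ, hG, hg]
  rw [h2, eq_comm, ← inner_conj_symm, inner_toLp_right] at h1
  simpa using h1

/-- A test function that vanishes on `A` has zero trace, so the interaction term drops out and `H_α`
acts on it as `-Δ`, whatever `α` is. -/
theorem IsTest.mem_hamiltonianGraph [IsFiniteMeasure (surfaceMeasure A)] (hA : MeasurableSet A)
    {φ : E3 → ℂ} (h : IsTest φ) (hφA : ∀ x ∈ A, φ x = 0) :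
    (h.memLp.toLp φ, -h.memLp_lap.toLp (lap φ)) ∈ hamiltonianGraph A α := by
  have hz : (h.memLp_measure (surfaceMeasure A)).toLp φ = 0 := by
    rw [Lp.eq_zero_iff_ae_eq_zero]
    refine (MemLp.coeFn_toLp _).trans ?_
    rw [surfaceMeasure, EventuallyEq, ae_restrict_iff' hA]
    exact ae_of_all _ hφA
  refine ⟨_, _, h.inFormDomain A, fun v K k hv => ?_⟩
  have hsum : h.memLp_lap.toLp (lap φ) =
      ∑ i, (((h.partialDeriv i).memLp_partialDeriv i).toLp _ : L2) := by
    rw [Fin.sum_univ_three, ← MemLp.toLp_add, ← MemLp.toLp_add]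
    refine MemLp.toLp_congr _ _ (ae_of_all _ fun x => ?_)
    simp only [lap, Fin.sum_univ_three, Pi.add_apply]
  rw [formQ, hz, inner_zero_right, mul_zero, sub_zero, inner_neg_right, hsum, inner_sum,
    ← Finset.sum_neg_distrib]
  exact Finset.sum_congr rfl fun i _ => hv.1.inner_eq (h.partialDeriv i) i

end Graph

/-! ### Weyl functions and the spectrum -/

theorem partialDeriv_mul {f g : E3 → ℂ} {x : E3} (hf : DifferentiableAt ℝ f x)
    (hg : DifferentiableAt ℝ g x) (i : Fin 3) :
    partialDeriv i (fun y => f y * g y) x = f x * partialDeriv i g x + partialDeriv i f x * g x := by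
  simp only [partialDeriv]
  rw [fderiv_fun_mul hf hg]
  simp
  ring

theorem partialDeriv_comp_smul_sub {f : E3 → ℂ} (hf : Differentiable ℝ f) (s : ℝ) (c : E3)
    (i : Fin 3) (x : E3) :
    partialDeriv i (fun y => f (s • (y - c))) x = s * partialDeriv i f (s • (x - c)) := by
  have h1 : HasFDerivAt (fun y : E3 => s • (y - c)) (s • ContinuousLinearMap.id ℝ E3) x :=
    ((hasFDerivAt_id x).sub_const c).const_smul s
  have h2 := (hf (s • (x - c))).hasFDerivAt.comp x h1
  have h3 : fderiv ℝ (fun y => f (s • (y - c))) x = _ := h2.fderiv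
  rw [partialDeriv, h3]
  simp [partialDeriv]

/-- The plane wave with wave number `k` along the first axis. -/
noncomputable def planeWave (k : ℝ) (x : E3) : ℂ := Complex.exp ((k * x 0 : ℝ) * Complex.I)

theorem contDiff_planeWave (k : ℝ) : ContDiff ℝ ∞ (planeWave k) := by
  unfold planeWave
  have h1 : ContDiff ℝ ∞ fun x : E3 => k * x 0 := by fun_prop
  exact ((Complex.ofRealCLM.contDiff.comp h1).mul contDiff_const).cexp

theorem norm_planeWave (k : ℝ) (x : E3) : ‖planeWave k x‖ = 1 := by
  rw [planeWave, Complex.norm_exp_ofReal_mul_I]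

theorem partialDeriv_planeWave (k : ℝ) (i : Fin 3) (x : E3) :
    partialDeriv i (planeWave k) x = (if i = 0 then (k : ℂ) * Complex.I else 0) * planeWave k x := by
  have h1 : HasFDerivAt (fun x : E3 => k * x 0)
      (k • (EuclideanSpace.proj 0 : E3 →L[ℝ] ℝ)) x :=
    (EuclideanSpace.proj (0 : Fin 3) : E3 →L[ℝ] ℝ).hasFDerivAt.const_mul k
  have h2 := ((Complex.ofRealCLM.hasFDerivAt (x := k * x 0)).comp x h1).mul_const Complex.I
  have h3 : fderiv ℝ (planeWave k) x = _ := h2.cexp.fderiv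
  rw [partialDeriv, h3]
  by_cases hi : i = 0
  · subst hi
    simp [planeWave]
    ring
  · simp [planeWave, hi, Ne.symm hi]

theorem IsTest.comp_smul_sub {f : E3 → ℂ} (hf : IsTest f) {s : ℝ} (hs : s ≠ 0) (c : E3) :
    IsTest fun y => f (s • (y - c)) := by
  refine ⟨hf.1.comp (by fun_prop), ?_⟩
  exact hf.2.comp_homeomorph ((Homeomorph.subRight c).trans (Homeomorph.smulOfNeZero s hs))

theorem IsTest.lap_planeWave_mul {χ : E3 → ℂ} (hχ : IsTest χ) (k : ℝ) (x : E3) :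
    lap (fun y => planeWave k y * χ y) x = planeWave k x *
      (lap χ x + 2 * k * Complex.I * SurfaceInteraction.partialDeriv 0 χ x - k ^ 2 * χ x) := by
  have hp : Differentiable ℝ (planeWave k) := (contDiff_planeWave k).differentiable (by simp)
  have hd : ∀ {f : E3 → ℂ}, IsTest f → Differentiable ℝ f := fun hf =>
    hf.1.differentiable (by simp)
  set a : Fin 3 → ℂ := fun i => if i = 0 then (k : ℂ) * Complex.I else 0 with ha
  have h1 : ∀ i, SurfaceInteraction.partialDeriv i (fun y => planeWave k y * χ y) =
      fun y => planeWave k y * (SurfaceInteraction.partialDeriv i χ y + a i * χ y) := fun i => by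
    funext y
    rw [partialDeriv_mul (hp y) (hd hχ y), partialDeriv_planeWave]
    ring
  have h2 : ∀ i, SurfaceInteraction.partialDeriv i
      (SurfaceInteraction.partialDeriv i (fun y => planeWave k y * χ y)) x = planeWave k x *
        (SurfaceInteraction.partialDeriv i (SurfaceInteraction.partialDeriv i χ) x +
          2 * a i * SurfaceInteraction.partialDeriv i χ x + a i ^ 2 * χ x) := fun i => by
    rw [h1, partialDeriv_mul (hp x) (hd ((hχ.partialDeriv i).add (hχ.smul _)) x),
      partialDeriv_planeWave, partialDeriv_add (hχ.partialDeriv i) (hχ.smul _),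
      partialDeriv_smul hχ]
    ring
  simp only [lap, h2, Fin.sum_univ_three, ha]
  simp
  ring_nf
  simp
  ring

theorem measureReal_ball_le_norm_toLp_sq {g : E3 → ℂ} (hg : MemLp g 2 volume) {c : E3} {r : ℝ}
    (hg1 : ∀ x ∈ Metric.ball c r, ‖g x‖ = 1) :
    volume.real (Metric.ball c r) ≤ ‖hg.toLp g‖ ^ 2 := by
  rw [norm_toLp_sq]
  have hgi := hg.integrable_norm_pow (p := 2) (by simp)
  calc volume.real (Metric.ball c r) = ∫ x in Metric.ball c r, ‖g x‖ ^ 2 := by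
        rw [setIntegral_congr_fun measurableSet_ball (g := fun _ => (1 : ℝ))
          fun x hx => by simp [hg1 x hx], setIntegral_const, smul_eq_mul, mul_one]
    _ ≤ _ := setIntegral_le_integral hgi (ae_of_all _ fun x => by positivity)

/-- Doubling the radius multiplies the volume by `8 ≤ 3²`, whence the factor 3. The point is that
the ratio does not depend on `r`. -/
theorem norm_toLp_le_of_ball {f g : E3 → ℂ} (hf : MemLp f 2 volume)
    (hg : MemLp g 2 volume) {c : E3} {r B : ℝ} (hr : 0 ≤ r) (hB : 0 ≤ B) (hfB : ∀ x, ‖f x‖ ≤ B)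
    (hf0 : ∀ x, x ∉ Metric.closedBall c (2 * r) → f x = 0)
    (hg1 : ∀ x ∈ Metric.ball c r, ‖g x‖ = 1) : ‖hf.toLp f‖ ≤ 3 * B * ‖hg.toLp g‖ := by
  have hv : volume.real (Metric.closedBall c (2 * r)) = 8 * volume.real (Metric.ball c r) := by
    rw [measureReal_def, measureReal_def, EuclideanSpace.volume_closedBall_fin_three,
      EuclideanSpace.volume_ball_fin_three, ENNReal.toReal_mul, ENNReal.toReal_mul,
      ENNReal.toReal_pow, ENNReal.toReal_pow, ENNReal.toReal_ofReal hr,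
      ENNReal.toReal_ofReal (by positivity)]
    ring
  have h1 : ‖hf.toLp f‖ ^ 2 ≤ B ^ 2 * volume.real (Metric.closedBall c (2 * r)) := by
    rw [norm_toLp_sq]
    calc ∫ x, ‖f x‖ ^ 2 ≤ ∫ x, (Metric.closedBall c (2 * r)).indicator (fun _ => B ^ 2) x := by
          refine integral_mono ?_ ?_ fun x => ?_
          · exact hf.integrable_norm_pow (p := 2) (by simp)
          · exact (integrable_indicator_iff measurableSet_closedBall).2
              (integrableOn_const measure_closedBall_lt_top.ne)
          · by_cases hx : x ∈ Metric.closedBall c (2 * r)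
            · rw [indicator_of_mem hx]
              exact pow_le_pow_left₀ (norm_nonneg _) (hfB x) 2
            · simp [hf0 x hx, hx]
      _ = _ := by
          rw [integral_indicator measurableSet_closedBall, setIntegral_const, smul_eq_mul, mul_comm]
  have h2 := measureReal_ball_le_norm_toLp_sq hg hg1
  refine abs_le_of_sq_le_sq' ?_ (by positivity) |>.2
  rw [hv] at h1
  have : B ^ 2 * (8 * volume.real (Metric.ball c r)) ≤ B ^ 2 * (8 * ‖hg.toLp g‖ ^ 2) := by gcongr
  nlinarith [sq_nonneg (B * ‖hg.toLp g‖)]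

/-- Approximate eigenfunctions of the Laplacian supported away from a bounded set. -/
theorem exists_approx_eigenfunction {A : Set E3} (hA : Bornology.IsBounded A) {lam : ℝ}
    (hlam : 0 ≤ lam) {e : ℝ} (he : 0 < e) :
    ∃ φ : E3 → ℂ, ∃ h : IsTest φ, (∀ x ∈ A, φ x = 0) ∧ h.memLp.toLp φ ≠ 0 ∧
      ‖-h.memLp_lap.toLp (lap φ) - (lam : ℂ) • h.memLp.toLp φ‖ ≤ e * ‖h.memLp.toLp φ‖ := by
  set k := Real.sqrt lam with hk
  have hk2 : k ^ 2 = lam := Real.sq_sqrt hlam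
  let b : ContDiffBump (0 : E3) := ⟨1, 2, one_pos, one_lt_two⟩
  set ρ : E3 → ℂ := fun x => (b x : ℂ) with hρ
  have hρt : IsTest ρ := ⟨Complex.ofRealCLM.contDiff.comp b.contDiff,
    b.hasCompactSupport.comp_left (g := fun t : ℝ => (t : ℂ)) (by simp)⟩
  have hbd : ∀ {f : E3 → ℂ}, IsTest f → ∃ C, 0 ≤ C ∧ ∀ x, ‖f x‖ ≤ C := fun {f} hf => by
    obtain ⟨C, hC⟩ := hf.2.exists_bound_of_continuous hf.1.continuous
    exact ⟨C, (norm_nonneg _).trans (hC 0), hC⟩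
  obtain ⟨C₁, hC₁0, hC₁⟩ := hbd (hρt.partialDeriv 0)
  choose C₂ hC₂0 hC₂ using fun i => hbd ((hρt.partialDeriv i).partialDeriv i)
  set C := (∑ i, C₂ i) + 2 * k * C₁ with hC
  have hC0 : 0 ≤ C := by
    have : 0 ≤ ∑ i, C₂ i := Finset.sum_nonneg fun i _ => hC₂0 i
    positivity
  -- `1 / s` is the length scale of the cutoff. Every term left in the residual contains a
  -- derivative of the cutoff and so a factor `s`; the 3 comes from `norm_toLp_le_of_ball`.
  obtain ⟨s, hs0, hs1, hsC⟩ : ∃ s : ℝ, 0 < s ∧ s ≤ 1 ∧ 3 * (s * C) ≤ e := by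
    refine ⟨min 1 (e / (3 * (C + 1))), by positivity, min_le_left _ _, ?_⟩
    have h1 : min 1 (e / (3 * (C + 1))) ≤ e / (3 * (C + 1)) := min_le_right _ _
    rw [le_div_iff₀ (by positivity)] at h1
    have h2 : 0 < min 1 (e / (3 * (C + 1))) := by positivity
    nlinarith
  obtain ⟨R, hR0, hR⟩ := hA.exists_pos_norm_le
  -- The cutoff lives within `2 / s` of its centre, so this centre keeps it off the ball of radius
  -- `R` that contains `A`.
  set c : E3 := EuclideanSpace.single 0 (R + 2 / s + 1) with hc
  have hcn : ‖c‖ = R + 2 / s + 1 := by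
    rw [hc, PiLp.norm_single, Real.norm_of_nonneg (by positivity)]
  set χ : E3 → ℂ := fun y => ρ (s • (y - c)) with hχ
  have hχt : IsTest χ := hρt.comp_smul_sub hs0.ne' c
  have hts : tsupport ρ ⊆ Metric.closedBall 0 2 := by
    rw [← b.tsupport_eq]
    exact closure_mono fun x hx => by simpa [hρ] using hx
  have hd₁ : ∀ i, tsupport (partialDeriv i ρ) ⊆ tsupport ρ := fun i =>
    tsupport_fderiv_apply_subset ℝ _
  have hd₂ : ∀ i, tsupport (partialDeriv i (partialDeriv i ρ)) ⊆ tsupport (partialDeriv i ρ) :=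
    fun i => tsupport_fderiv_apply_subset ℝ _
  have hfar : ∀ x : E3, x ∉ Metric.closedBall c (2 * (1 / s)) → s • (x - c) ∉ tsupport ρ := by
    intro x hx hmem
    have h1 := hts hmem
    rw [mem_closedBall_zero_iff, norm_smul, Real.norm_of_nonneg hs0.le] at h1
    apply hx
    rw [Metric.mem_closedBall, dist_eq_norm, mul_one_div, le_div_iff₀ hs0]
    linarith
  have hχ₁ : ∀ i, partialDeriv i χ = fun x => (s : ℂ) * partialDeriv i ρ (s • (x - c)) := fun i =>
    funext fun x => partialDeriv_comp_smul_sub (hρt.1.differentiable (by simp)) s c i x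
  have hχ₂ : ∀ i x, partialDeriv i (partialDeriv i χ) x =
      s * (s * partialDeriv i (partialDeriv i ρ) (s • (x - c))) := fun i x => by
    rw [hχ₁, partialDeriv_smul ((hρt.partialDeriv i).comp_smul_sub hs0.ne' c),
      partialDeriv_comp_smul_sub ((hρt.partialDeriv i).1.differentiable (by simp))]
  set φ : E3 → ℂ := fun x => planeWave k x * χ x with hφ
  have hφt : IsTest φ := ⟨(contDiff_planeWave k).mul hχt.1, hχt.2.mul_left⟩
  have hφA : ∀ x ∈ A, φ x = 0 := fun x hx => by
    have hxc : x ∉ Metric.closedBall c (2 * (1 / s)) := fun hxc => by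
      rw [Metric.mem_closedBall, dist_comm, dist_eq_norm] at hxc
      have h1 := norm_le_norm_add_norm_sub' c x
      have h2 := hR x hx
      have h3 : 2 * (1 / s) = 2 / s := by ring
      linarith
    simp [hφ, hχ, image_eq_zero_of_notMem_tsupport (hfar x hxc)]
  have hφ1 : ∀ x ∈ Metric.ball c (1 / s), ‖φ x‖ = 1 := fun x hx => by
    have h1 : b (s • (x - c)) = 1 := by
      refine b.one_of_mem_closedBall ?_
      rw [Metric.mem_ball, dist_eq_norm, lt_div_iff₀ hs0] at hx
      rw [mem_closedBall_zero_iff, norm_smul, Real.norm_of_nonneg hs0.le]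
      change _ ≤ (1 : ℝ)
      linarith
    simp [hφ, hχ, hρ, h1, norm_planeWave]
  set r : E3 → ℂ := fun x => -lap φ x - lam * φ x with hr
  have hrm : MemLp r 2 volume := hφt.memLp_lap.neg.sub (hφt.memLp.const_mul _)
  -- The term `k ^ 2` from differentiating the plane wave twice cancels `lam`.
  have hr1 : ∀ x, r x = -(planeWave k x *
      (∑ i, s * (s * partialDeriv i (partialDeriv i ρ) (s • (x - c))) +
        2 * k * Complex.I * (s * partialDeriv 0 ρ (s • (x - c))))) := fun x => by
    simp only [hr, hφ]
    have hlap : lap χ x = ∑ i, s * (s * partialDeriv i (partialDeriv i ρ) (s • (x - c))) :=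
      Finset.sum_congr rfl fun i _ => hχ₂ i x
    rw [hχt.lap_planeWave_mul, ← hk2, hlap]
    simp only [hχ₁]
    push_cast
    ring
  refine ⟨φ, hφt, hφA, fun h0 => ?_, ?_⟩
  · have h1 := measureReal_ball_le_norm_toLp_sq hφt.memLp hφ1
    rw [h0, norm_zero, zero_pow two_ne_zero] at h1
    exact absurd h1 (not_le.2 (ENNReal.toReal_pos
      (Metric.measure_ball_pos volume c (by positivity)).ne' measure_ball_lt_top.ne))
  · have h1 : -hφt.memLp_lap.toLp (lap φ) - (lam : ℂ) • hφt.memLp.toLp φ = hrm.toLp r := by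
      rw [← MemLp.toLp_neg, ← MemLp.toLp_const_smul, ← MemLp.toLp_sub]
      rfl
    rw [h1]
    refine (norm_toLp_le_of_ball hrm hφt.memLp (c := c) (r := 1 / s) (B := s * C)
      (by positivity) (by positivity) (fun x => ?_) (fun x hx => ?_) hφ1).trans (by gcongr)
    · rw [hr1, norm_neg, norm_mul, norm_planeWave, one_mul]
      calc _ ≤ (∑ i, s * (s * C₂ i)) + 2 * k * (s * C₁) := by
            refine (norm_add_le _ _).trans (add_le_add ((norm_sum_le _ _).trans
              (Finset.sum_le_sum fun i _ => ?_)) ?_)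
            · rw [norm_mul, norm_mul, Complex.norm_real, Real.norm_of_nonneg hs0.le]
              gcongr
              exact hC₂ i _
            · rw [norm_mul, norm_mul, norm_mul, norm_mul, Complex.norm_I, Complex.norm_real,
                Complex.norm_real, Real.norm_of_nonneg hs0.le,
                Real.norm_of_nonneg (Real.sqrt_nonneg _), Complex.norm_ofNat, mul_one]
              gcongr
              exact hC₁ _
        _ ≤ (∑ i, s * C₂ i) + 2 * k * (s * C₁) := by
            gcongr with i
            exact mul_le_of_le_one_left (hC₂0 i) hs1
        _ = s * C := by
            rw [hC, ← Finset.mul_sum]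
            ring
    · rw [hr1]
      have h2 := hfar x hx
      simp [image_eq_zero_of_notMem_tsupport fun h => h2 (hd₁ 0 h),
        fun i => image_eq_zero_of_notMem_tsupport fun h => h2 (hd₁ i (hd₂ i h))]

/-- A bounded inverse `R` of `H_α - lam` would give `‖φ‖ ≤ ‖R‖ ‖(H_α - lam)φ‖`, which the
approximate eigenfunctions violate once their error is below `1 / ‖R‖`. -/
theorem mem_opSpectrum_of_nonneg {A : Set E3} (hA : IsCompact A)
    [IsFiniteMeasure (surfaceMeasure A)] {M α : ℝ} (hM0 : 0 ≤ M)
    (hM : ∀ x, ∫⁻ y, (edist x y)⁻¹ ∂(surfaceMeasure A) ≤ ENNReal.ofReal M) {lam : ℝ}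
    (hlam : 0 ≤ lam) : (lam : ℂ) ∈ opSpectrum (hamiltonian A α) := by
  rintro ⟨R, -, hR⟩
  obtain ⟨φ, hφ, hφA, hφ0, hle⟩ := exists_approx_eigenfunction hA.isBounded hlam
    (e := 1 / (‖R‖ + 1)) (by positivity)
  have hmem : (hφ.memLp.toLp φ, -hφ.memLp_lap.toLp (lap φ)) ∈ (hamiltonian A α).graph := by
    rw [hamiltonian, Submodule.toLinearPMap_graph_eq _ (hamiltonianGraph_snd_eq_zero hM0 hM)]
    exact hφ.mem_hamiltonianGraph hA.measurableSet hφA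
  obtain ⟨u, hu1, hu2⟩ := (LinearPMap.mem_graph_iff _).1 hmem
  have h1 := hR u
  simp only at hu1 hu2
  rw [hu2, hu1] at h1
  have h2 := R.le_opNorm (-hφ.memLp_lap.toLp (lap φ) - (lam : ℂ) • hφ.memLp.toLp φ)
  rw [h1] at h2
  have h3 : 0 < ‖hφ.memLp.toLp φ‖ := norm_pos_iff.2 hφ0
  have h4 : ‖R‖ * (1 / (‖R‖ + 1) * ‖hφ.memLp.toLp φ‖) < ‖hφ.memLp.toLp φ‖ := by
    rw [← mul_assoc, mul_one_div]
    have : ‖R‖ / (‖R‖ + 1) < 1 := (div_lt_one (by positivity)).2 (by linarith)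
    nlinarith
  have h5 := mul_le_mul_of_nonneg_left hle (norm_nonneg R)
  linarith

/-- A positive operator of this kind has no discrete spectrum. -/
theorem discreteSpectrum_eq_empty {A : Set E3} (hA : IsCompact A)
    [IsFiniteMeasure (surfaceMeasure A)] {M α : ℝ} (hM0 : 0 ≤ M)
    (hM : ∀ x, ∫⁻ y, (edist x y)⁻¹ ∂(surfaceMeasure A) ≤ ENNReal.ofReal M)
    (hpos : IsPositiveForm A α) : discreteSpectrum (hamiltonian A α) = ∅ := by
  refine eq_empty_of_forall_notMem ?_
  rintro z ⟨hz, -, r, hr, hball⟩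
  obtain ⟨u, hu, hu0⟩ := Submodule.exists_mem_ne_zero_of_ne_bot hz
  obtain ⟨⟨v, hvd⟩, hv, rfl⟩ := hu
  have hTv : hamiltonian A α ⟨v, hvd⟩ = z • v := by
    have : hamiltonian A α ⟨v, hvd⟩ - z • v = 0 := hv
    exact sub_eq_zero.1 this
  change v ≠ 0 at hu0
  have hmem : (v, z • v) ∈ hamiltonianGraph A α := by
    rw [← Submodule.toLinearPMap_graph_eq _ (hamiltonianGraph_snd_eq_zero hM0 hM)]
    exact (LinearPMap.mem_graph_iff _).2 ⟨⟨v, hvd⟩, rfl, hTv⟩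
  obtain ⟨G, g, hd, hQ⟩ := hmem
  have h1 := hQ v G g hd
  -- Testing the eigenvalue equation with the eigenfunction itself gives `q = z ‖v‖ ^ 2`; positivity
  -- makes `z` real and nonnegative.
  set q := (∑ i, ‖G i‖ ^ 2) - α * ‖g‖ ^ 2 with hq
  have hq0 : 0 ≤ q := hpos v G g hd
  have h2 : (q : ℂ) = z * (‖v‖ ^ 2 : ℝ) := by
    simp only [formQ, inner_smul_right, inner_self_eq_norm_sq_to_K] at h1
    rw [hq]
    push_cast
    exact h1
  have hv2 : 0 < ‖v‖ ^ 2 := by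
    have := norm_pos_iff.2 hu0
    positivity
  have hz : z = ((q / ‖v‖ ^ 2 : ℝ) : ℂ) := by
    rw [Complex.ofReal_div, h2, mul_div_cancel_right₀]
    exact_mod_cast hv2.ne'
  -- `z + r / 2` is a second point of the spectrum in the ball that was to isolate `z`.
  have hmem2 : ((q / ‖v‖ ^ 2 + r / 2 : ℝ) : ℂ) ∈ Metric.ball z r ∩ opSpectrum (hamiltonian A α) := by
    refine ⟨?_, mem_opSpectrum_of_nonneg hA hM0 hM (by positivity)⟩
    rw [hz, Metric.mem_ball, dist_eq_norm, ← Complex.ofReal_sub, Complex.norm_real,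
      add_sub_cancel_left, Real.norm_of_nonneg (by positivity)]
    linarith
  rw [hball, mem_singleton_iff, hz, Complex.ofReal_inj] at hmem2
  linarith

/-! ### The Schur test -/

theorem sq_lintegral_mul_le {X : Type*} [MeasurableSpace X] {ν : Measure X} {k f : X → ℝ≥0∞}
    (hk : Measurable k) (hf : Measurable f) :
    (∫⁻ y, k y * f y ∂ν) ^ 2 ≤ (∫⁻ y, k y ∂ν) * ∫⁻ y, k y * f y ^ 2 ∂ν := by
  have hs : ∀ t : ℝ≥0∞, t ^ (1 / 2 : ℝ) * t ^ (1 / 2 : ℝ) = t := fun t => by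
    rw [← ENNReal.rpow_add_of_nonneg _ _ (by norm_num) (by norm_num)]
    norm_num
  have hs2 : ∀ t : ℝ≥0∞, (t ^ (1 / 2 : ℝ)) ^ 2 = t := fun t => by rw [sq, hs]
  have h := ENNReal.lintegral_mul_le_Lp_mul_Lq ν (p := 2) (q := 2) Real.HolderConjugate.two_two
    (f := fun y => k y ^ (1 / 2 : ℝ)) (g := fun y => k y ^ (1 / 2 : ℝ) * f y)
    (hk.pow_const _).aemeasurable ((hk.pow_const _).mul hf).aemeasurable
  have e1 : ∀ y, ((fun y => k y ^ (1 / 2 : ℝ)) * fun y => k y ^ (1 / 2 : ℝ) * f y) y =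
      k y * f y := fun y => by
    rw [Pi.mul_apply, ← mul_assoc, hs]
  simp only [e1, ENNReal.rpow_ofNat, mul_pow, hs2] at h
  calc _ ≤ ((∫⁻ y, k y ∂ν) ^ (1 / 2 : ℝ) * (∫⁻ y, k y * f y ^ 2 ∂ν) ^ (1 / 2 : ℝ)) ^ 2 := by gcongr
    _ = _ := by rw [mul_pow, hs2, hs2]

/-- Cauchy–Schwarz with respect to the measure `k x y dν(y)` produces one factor `M`; Tonelli and
the symmetry of `k`, which lets `M` bound the column integrals as well, produce the other. -/
theorem lintegral_sq_lintegral_kernel_le {X : Type*} [MeasurableSpace X] {ν : Measure X}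
    [SFinite ν] {k : X → X → ℝ≥0∞} (hk : Measurable (Function.uncurry k))
    (hsymm : ∀ x y, k x y = k y x) {M : ℝ≥0∞} (hM : ∀ᵐ x ∂ν, ∫⁻ y, k x y ∂ν ≤ M) {f : X → ℝ≥0∞}
    (hf : Measurable f) :
    ∫⁻ x, (∫⁻ y, k x y * f y ∂ν) ^ 2 ∂ν ≤ M ^ 2 * ∫⁻ y, f y ^ 2 ∂ν := by
  have hkx : ∀ x, Measurable (k x) := fun x => hk.comp measurable_prodMk_left
  calc ∫⁻ x, (∫⁻ y, k x y * f y ∂ν) ^ 2 ∂ν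
      ≤ ∫⁻ x, M * ∫⁻ y, k x y * f y ^ 2 ∂ν ∂ν := by
        refine lintegral_mono_ae ?_
        filter_upwards [hM] with x hx
        refine (sq_lintegral_mul_le (hkx x) hf).trans ?_
        gcongr
    _ = M * ∫⁻ y, ∫⁻ x, k x y * f y ^ 2 ∂ν ∂ν := by
        have hm : Measurable (Function.uncurry fun x y => k x y * f y ^ 2) :=
          hk.mul ((hf.comp measurable_snd).pow_const 2)
        rw [lintegral_const_mul _ (Measurable.lintegral_prod_right hm),
          lintegral_lintegral_swap hm.aemeasurable]
    _ ≤ M * ∫⁻ y, M * f y ^ 2 ∂ν := by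
        gcongr 1
        refine lintegral_mono_ae ?_
        filter_upwards [hM] with y hy
        rw [lintegral_mul_const _ (by simpa only [hsymm _ y] using hkx y)]
        gcongr
        simpa only [hsymm _ y] using hy
    _ = _ := by
        rw [lintegral_const_mul _ (hf.pow_const 2)]
        ring

theorem eLpNorm_two_sq {X : Type*} [MeasurableSpace X] {ν : Measure X} (f : X → ℂ) :
    eLpNorm f 2 ν ^ 2 = ∫⁻ x, ‖f x‖ₑ ^ 2 ∂ν := by
  rw [eLpNorm_eq_lintegral_rpow_enorm_toReal (by simp) (by simp)]
  simp only [ENNReal.toReal_ofNat, ENNReal.rpow_ofNat]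
  rw [← ENNReal.rpow_natCast, ← ENNReal.rpow_mul]
  norm_num

/-- The Schur test for symmetric nonnegative kernels. -/
theorem exists_integral_operator {X : Type*} [MeasurableSpace X] {ν : Measure X}
    [SFinite ν] {k : X → X → ℝ} (hk : Measurable (Function.uncurry k)) (hk0 : ∀ x y, 0 ≤ k x y)
    (hsymm : ∀ x y, k x y = k y x) {M : ℝ} (hM0 : 0 ≤ M)
    (hM : ∀ᵐ x ∂ν, ∫⁻ y, ENNReal.ofReal (k x y) ∂ν ≤ ENNReal.ofReal M) :
    ∃ T : Lp ℂ 2 ν →L[ℂ] Lp ℂ 2 ν, ‖T‖ ≤ M ∧ ∀ u : Lp ℂ 2 ν, ∀ᵐ x ∂ν,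
      Integrable (fun y => (k x y : ℂ) * u y) ν ∧ T u x = ∫ y, (k x y : ℂ) * u y ∂ν := by
  have hkx : ∀ x, Measurable (k x) := fun x => hk.comp measurable_prodMk_left
  have hum : ∀ u : Lp ℂ 2 ν, StronglyMeasurable u := fun u => Lp.stronglyMeasurable u
  have hjm : ∀ u : Lp ℂ 2 ν, StronglyMeasurable
      (Function.uncurry fun x y => (k x y : ℂ) * u y) := fun u =>
    (Complex.measurable_ofReal.comp hk).stronglyMeasurable.mul ((hum u).comp_measurable measurable_snd)
  have hen : ∀ (u : Lp ℂ 2 ν) x y, ‖(k x y : ℂ) * u y‖ₑ = ENNReal.ofReal (k x y) * ‖u y‖ₑ :=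
    fun u x y => by
      rw [enorm_mul, ← ofReal_norm, Complex.norm_real, Real.norm_of_nonneg (hk0 x y)]
  have hbound : ∀ u : Lp ℂ 2 ν, ∫⁻ x, (∫⁻ y, ‖(k x y : ℂ) * u y‖ₑ ∂ν) ^ 2 ∂ν ≤
      ENNReal.ofReal M ^ 2 * eLpNorm u 2 ν ^ 2 := fun u => by
    simp only [hen, eLpNorm_two_sq]
    exact lintegral_sq_lintegral_kernel_le hk.ennreal_ofReal (fun x y => by rw [hsymm]) hM
      (hum u).measurable.enorm
  -- `hbound` was stated with absolute values inside the integral, so its finiteness gives absolute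
  -- convergence for almost every `x`.
  have hint : ∀ u : Lp ℂ 2 ν, ∀ᵐ x ∂ν, Integrable (fun y => (k x y : ℂ) * u y) ν := fun u => by
    have hmI : Measurable fun x => ∫⁻ y, ‖(k x y : ℂ) * u y‖ₑ ∂ν :=
      Measurable.lintegral_prod_right (hjm u).enorm
    have hfin : ∫⁻ x, (∫⁻ y, ‖(k x y : ℂ) * u y‖ₑ ∂ν) ^ 2 ∂ν ≠ ⊤ :=
      ((hbound u).trans_lt (ENNReal.mul_lt_top (by simp)
        (ENNReal.pow_lt_top (Lp.memLp u).2))).ne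
    filter_upwards [ae_lt_top (hmI.pow_const 2) hfin] with x hx
    exact ⟨((hjm u).comp_measurable measurable_prodMk_left).aestronglyMeasurable,
      (ENNReal.pow_lt_top_iff.1 hx).resolve_right two_ne_zero⟩
  have hK : ∀ u : Lp ℂ 2 ν, eLpNorm (fun x => ∫ y, (k x y : ℂ) * u y ∂ν) 2 ν ≤
      ENNReal.ofReal M * eLpNorm u 2 ν := fun u => by
    refine (ENNReal.pow_le_pow_left_iff two_ne_zero).1 ?_
    rw [mul_pow, eLpNorm_two_sq]
    refine (lintegral_mono fun x => ?_).trans (hbound u)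
    gcongr
    exact enorm_integral_le_lintegral_enorm _
  have hmem : ∀ u : Lp ℂ 2 ν, MemLp (fun x => ∫ y, (k x y : ℂ) * u y ∂ν) 2 ν := fun u =>
    ⟨((hjm u).integral_prod_right').aestronglyMeasurable,
      (hK u).trans_lt (ENNReal.mul_lt_top (by simp) (Lp.memLp u).2)⟩
  let T₀ : Lp ℂ 2 ν →ₗ[ℂ] Lp ℂ 2 ν :=
    { toFun := fun u => (hmem u).toLp _
      map_add' := fun u v => by
        rw [← MemLp.toLp_add]
        refine MemLp.toLp_congr _ _ ?_
        filter_upwards [hint u, hint v] with x hu hv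
        rw [Pi.add_apply, ← integral_add hu hv]
        refine integral_congr_ae ?_
        filter_upwards [Lp.coeFn_add u v] with y hy
        simp only [hy, Pi.add_apply]
        ring
      map_smul' := fun c u => by
        rw [RingHom.id_apply, ← MemLp.toLp_const_smul]
        refine MemLp.toLp_congr _ _ (ae_of_all _ fun x => ?_)
        rw [Pi.smul_apply, smul_eq_mul, ← integral_const_mul]
        refine integral_congr_ae ?_
        filter_upwards [Lp.coeFn_smul c u] with y hy
        simp only [hy, Pi.smul_apply, smul_eq_mul]
        ring }
  have hT₀ : ∀ u, ‖T₀ u‖ ≤ M * ‖u‖ := fun u => by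
    change ‖(hmem u).toLp _‖ ≤ _
    rw [Lp.norm_toLp, Lp.norm_def, ← ENNReal.toReal_ofReal hM0, ← ENNReal.toReal_mul]
    exact ENNReal.toReal_mono (ENNReal.mul_ne_top (by simp) (Lp.memLp u).2.ne) (hK u)
  refine ⟨T₀.mkContinuous M hT₀, T₀.mkContinuous_norm_le hM0 hT₀, fun u => ?_⟩
  filter_upwards [hint u, (hmem u).coeFn_toLp] with x h1 h2
  exact ⟨h1, h2⟩

theorem IsClosedSmoothSurface.isFiniteMeasure {A : Set E3} (hA : IsClosedSmoothSurface A) :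
    IsFiniteMeasure (surfaceMeasure A) := ⟨hA.area_lt_top⟩

theorem IsClosedSmoothSurface.exists_gammaOperator {A : Set E3} (hA : IsClosedSmoothSurface A) :
    ∃ T : L2Surf A →L[ℂ] L2Surf A, IsGammaOperator A T ∧ ‖T‖ ≤ (gammaSup A).toReal := by
  have := hA.isFiniteMeasure
  have hM : ∀ᵐ x ∂(surfaceMeasure A), ∫⁻ y, ENNReal.ofReal (1 / (4 * Real.pi * dist x y))
      ∂(surfaceMeasure A) ≤ ENNReal.ofReal (gammaSup A).toReal := by
    rw [surfaceMeasure, ae_restrict_iff' hA.isCompact.measurableSet, ← surfaceMeasure]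
    refine ae_of_all _ fun x hx => ?_
    rw [ENNReal.ofReal_toReal hA.gammaSup_lt_top.ne]
    have h4 : ENNReal.ofReal (4 * Real.pi) ≠ 0 := by simp [Real.pi_pos]
    calc ∫⁻ y, ENNReal.ofReal (1 / (4 * Real.pi * dist x y)) ∂(surfaceMeasure A)
        ≤ ∫⁻ y, (ENNReal.ofReal (4 * Real.pi))⁻¹ * (edist x y)⁻¹ ∂(surfaceMeasure A) := by
          refine lintegral_mono fun y => ?_
          -- On the diagonal the real kernel has the default value `0` and `(edist x x)⁻¹ = ⊤`, so
          -- only an inequality holds there.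
          rcases eq_or_ne x y with rfl | hxy
          · simp
          have hd : 0 < dist x y := dist_pos.2 hxy
          rw [one_div, ENNReal.ofReal_inv_of_pos (by positivity), ENNReal.ofReal_mul (by positivity),
            ENNReal.mul_inv (Or.inl h4) (Or.inl ENNReal.ofReal_ne_top), edist_dist]
      _ = (ENNReal.ofReal (4 * Real.pi))⁻¹ * ∫⁻ y, (edist x y)⁻¹ ∂(surfaceMeasure A) :=
          lintegral_const_mul' _ _ (ENNReal.inv_ne_top.2 h4)
      _ ≤ (ENNReal.ofReal (4 * Real.pi))⁻¹ * (ENNReal.ofReal (4 * Real.pi) * gammaSup A) := by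
          gcongr
          exact lintegral_potential_le_gammaSup hx
      _ = gammaSup A := by
          rw [← mul_assoc, ENNReal.inv_mul_cancel h4 ENNReal.ofReal_ne_top, one_mul]
  obtain ⟨T, hT, hTk⟩ := exists_integral_operator (ν := surfaceMeasure A)
    (k := fun x y => 1 / (4 * Real.pi * dist x y)) (by unfold Function.uncurry; fun_prop)
    (fun x y => by positivity) (fun x y => by rw [dist_comm]) ENNReal.toReal_nonneg hM
  exact ⟨T, hTk, hT⟩

/-- Submultiplicativity and the Schur bound `‖T‖ ≤ ‖Γ‖_∞` give the estimate even without the factor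
2. -/
theorem IsClosedSmoothSurface.exists_gammaOperator_norm_comp_le {A : Set E3}
    (hA : IsClosedSmoothSurface A) :
    ∃ T : L2Surf A →L[ℂ] L2Surf A, IsGammaOperator A T ∧ ∀ α₀ : ℝ, 0 < α₀ →
      ‖((α₀ : ℂ) • T).comp ((α₀ : ℂ) • T)‖ ≤
        2 * α₀ * (gammaSup A).toReal * ‖(α₀ : ℂ) • T‖ := by
  obtain ⟨T, hT, hn⟩ := hA.exists_gammaOperator
  refine ⟨T, hT, fun α hα => ?_⟩
  refine (ContinuousLinearMap.opNorm_comp_le _ _).trans ?_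
  have h1 : ‖(α : ℂ) • T‖ ≤ α * (gammaSup A).toReal := by
    rw [norm_smul, Complex.norm_real, Real.norm_of_nonneg hα.le]
    gcongr
  have h2 : 0 ≤ α * (gammaSup A).toReal := by positivity
  refine mul_le_mul_of_nonneg_right ?_ (norm_nonneg _)
  linarith

/-! ### The area formula for parametrised surfaces -/

/-- A countable subcover, made disjoint, reduces the inequality to small pieces. Only subadditivity
of `m₁` and superadditivity of `m₂` over disjoint pieces of `Ω` are assumed, so set functions such
as `B ↦ μ (φ '' B)` are admitted. -/
theorem le_of_locally_le {E : Type*} [TopologicalSpace E] [SecondCountableTopology E]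
    [MeasurableSpace E] [OpensMeasurableSpace E] {Ω : Set E} (hne : Ω.Nonempty)
    {m₁ m₂ : Set E → ℝ≥0∞}
    (h₁ : ∀ s : ℕ → Set E, (∀ n, MeasurableSet (s n)) → (∀ n, s n ⊆ Ω) → Pairwise (Function.onFun Disjoint s) →
      m₁ (⋃ n, s n) ≤ ∑' n, m₁ (s n))
    (h₂ : ∀ s : ℕ → Set E, (∀ n, MeasurableSet (s n)) → (∀ n, s n ⊆ Ω) → Pairwise (Function.onFun Disjoint s) →
      ∑' n, m₂ (s n) ≤ m₂ (⋃ n, s n))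
    (hloc : ∀ x ∈ Ω, ∃ U ∈ 𝓝 x, ∀ B, MeasurableSet B → B ⊆ U ∩ Ω → m₁ B ≤ m₂ B)
    {B : Set E} (hB : MeasurableSet B) (hBΩ : B ⊆ Ω) : m₁ B ≤ m₂ B := by
  choose! U hU hUB using hloc
  obtain ⟨t, htΩ, htc, ht⟩ := TopologicalSpace.countable_cover_nhdsWithin
    (f := fun x => interior (U x)) (s := Ω) fun x hx =>
      mem_nhdsWithin_of_mem_nhds (interior_mem_nhds.2 (hU x hx))
  have htne : t.Nonempty := by
    obtain ⟨x, hx⟩ := hne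
    obtain ⟨y, hy, -⟩ := mem_iUnion₂.1 (ht hx)
    exact ⟨y, hy⟩
  obtain ⟨a, rfl⟩ := htc.exists_eq_range htne
  have haΩ : ∀ n, a n ∈ Ω := fun n => htΩ ⟨n, rfl⟩
  rw [biUnion_range] at ht
  set V : ℕ → Set E := fun n => interior (U (a n)) with hV
  set s : ℕ → Set E := fun n => B ∩ disjointed V n with hs
  have hsm : ∀ n, MeasurableSet (s n) := fun n =>
    hB.inter (MeasurableSet.disjointed (fun k => isOpen_interior.measurableSet) n)
  have hsΩ : ∀ n, s n ⊆ Ω := fun n => inter_subset_left.trans hBΩ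
  have hsd : Pairwise (Function.onFun Disjoint s) := fun i j hij =>
    ((disjoint_disjointed V) hij).mono inter_subset_right inter_subset_right
  have hsU : ⋃ n, s n = B := by
    rw [← inter_iUnion, iUnion_disjointed]
    exact inter_eq_left.2 (hBΩ.trans ht)
  rw [← hsU]
  refine (h₁ s hsm hsΩ hsd).trans (le_trans (ENNReal.tsum_le_tsum fun n => ?_) (h₂ s hsm hsΩ hsd))
  exact hUB _ (haΩ n) _ (hsm n) fun x hx =>
    ⟨interior_subset (disjointed_subset V n hx.2), hsΩ n hx⟩

/-- An injective linear map on a finite-dimensional space is bounded below, so the error in strict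
differentiability becomes a small fraction of `‖L (a - b)‖`. -/
theorem exists_nhds_dist_comparison {E F : Type*} [NormedAddCommGroup E] [NormedSpace ℝ E]
    [FiniteDimensional ℝ E] [NormedAddCommGroup F] [NormedSpace ℝ F] {φ : E → F} {L : E →L[ℝ] F}
    {p : E} (h : HasStrictFDerivAt φ L p) (hL : Function.Injective L) {c : ℝ} (hc : 1 < c) :
    ∃ U ∈ 𝓝 p, ∀ a ∈ U, ∀ b ∈ U, dist (φ a) (φ b) ≤ c * dist (L a) (L b) ∧
      dist (L a) (L b) ≤ c * dist (φ a) (φ b) := by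
  obtain ⟨K, hK, hKL⟩ := L.toLinearMap.exists_antilipschitzWith (LinearMap.ker_eq_bot.2 hL)
  -- This makes the fraction `1 - 1 / c`: the ratio of the two distances then lies between `1 / c`
  -- and `2 - 1 / c`, and the latter is at most `c`.
  have hη : 0 < (1 - 1 / c) / K := by
    have : 1 / c < 1 := (div_lt_one (by linarith)).2 hc
    have : (0 : ℝ) < K := hK
    apply div_pos <;> linarith
  have hev := h.isLittleO.def hη
  rw [nhds_prod_eq] at hev
  obtain ⟨U, hU, hev⟩ := (eventually_prod_self_iff (r := fun a b : E =>
    ‖φ a - φ b - L (a - b)‖ ≤ (1 - 1 / c) / K * ‖a - b‖)).1 hev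
  refine ⟨U, hU, fun a ha b hb => ?_⟩
  have h1 := hev a ha b hb
  have h2 : ‖a - b‖ ≤ K * ‖L (a - b)‖ := by
    have := hKL.le_mul_dist a b
    simpa [dist_eq_norm] using this
  have h3 : ‖φ a - φ b - L (a - b)‖ ≤ (1 - 1 / c) * ‖L (a - b)‖ := by
    refine h1.trans ?_
    calc (1 - 1 / c) / K * ‖a - b‖ ≤ (1 - 1 / c) / K * (K * ‖L (a - b)‖) := by gcongr
      _ = _ := by
        have : (K : ℝ) ≠ 0 := (NNReal.coe_pos.2 hK).ne'
        field_simp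
  rw [dist_eq_norm, dist_eq_norm, ← map_sub]
  have hcc : 1 - 1 / c + 1 ≤ c := by
    have hc0 : 0 < c := by linarith
    have : c * (1 / c) = 1 := by field_simp
    nlinarith [sq_nonneg (c - 1), mul_pos hc0 hc0]
  constructor
  · calc ‖φ a - φ b‖ ≤ ‖φ a - φ b - L (a - b)‖ + ‖L (a - b)‖ := norm_le_norm_sub_add _ _
      _ ≤ (1 - 1 / c + 1) * ‖L (a - b)‖ := by linarith
      _ ≤ _ := by gcongr
  · have h4 : ‖L (a - b)‖ ≤ ‖φ a - φ b‖ + ‖φ a - φ b - L (a - b)‖ := by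
      have := norm_le_norm_add_norm_sub (φ a - φ b) (L (a - b))
      linarith
    have h5 : 1 / c * ‖L (a - b)‖ ≤ ‖φ a - φ b‖ := by linarith
    rwa [one_div, inv_mul_le_iff₀ (by linarith)] at h5

theorem ENNReal.le_of_forall_one_lt_pow_three_mul_le {x y : ℝ≥0∞}
    (h : ∀ c : NNReal, 1 < c → x ≤ (c : ℝ≥0∞) ^ 3 * y) : x ≤ y := by
  have h1 : Tendsto (fun c : NNReal => (c : ℝ≥0∞) ^ 3) (𝓝[>] 1) (𝓝 1) := by
    have : Continuous fun c : NNReal => ((c ^ 3 : NNReal) : ℝ≥0∞) :=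
      ENNReal.continuous_coe.comp (continuous_pow 3)
    have h2 := (this.tendsto 1).mono_left (nhdsWithin_le_nhds (s := Ioi (1 : NNReal)))
    simpa using h2
  have h2 := ENNReal.Tendsto.mul_const (b := y) h1 (Or.inl one_ne_zero)
  rw [one_mul] at h2
  exact ge_of_tendsto h2 (eventually_mem_nhdsWithin.mono fun c hc => h c hc)

/-- The area formula for an injective immersion. -/
theorem euclideanHausdorffMeasure_image_eq_lintegral {Ω : Set (EuclideanSpace ℝ (Fin 2))}
    {φ : EuclideanSpace ℝ (Fin 2) → E3}
    {φ' : EuclideanSpace ℝ (Fin 2) → EuclideanSpace ℝ (Fin 2) →L[ℝ] E3}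
    (hd : ∀ p ∈ Ω, HasStrictFDerivAt φ (φ' p) p) {J : EuclideanSpace ℝ (Fin 2) → ℝ}
    (hJ : ∀ p ∈ Ω, J p = (φ' p).toLinearMap.normDet) (hJc : ContinuousOn J Ω)
    (hJpos : ∀ p ∈ Ω, 0 < J p) (hinj : InjOn φ Ω) {B : Set (EuclideanSpace ℝ (Fin 2))}
    (hB : MeasurableSet B) (hBΩ : B ⊆ Ω) :
    (Measure.euclideanHausdorffMeasure 2 : Measure E3) (φ '' B) =
      ∫⁻ p in B, ENNReal.ofReal (J p) := by
  rcases Ω.eq_empty_or_nonempty with rfl | hne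
  · simp [subset_empty_iff.1 hBΩ]
  have hcont : ContinuousOn φ Ω := fun p hp => (hd p hp).continuousAt.continuousWithinAt
  have hm : ∀ B, MeasurableSet B → B ⊆ Ω → MeasurableSet (φ '' B) := fun B hB hBΩ =>
    hB.image_of_continuousOn_injOn (hcont.mono hBΩ) (hinj.mono hBΩ)
  have himg : ∀ s : ℕ → Set (EuclideanSpace ℝ (Fin 2)), (∀ n, MeasurableSet (s n)) →
      (∀ n, s n ⊆ Ω) → Pairwise (Function.onFun Disjoint s) →
      (Measure.euclideanHausdorffMeasure 2 : Measure E3) (φ '' ⋃ n, s n) =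
        ∑' n, (Measure.euclideanHausdorffMeasure 2 : Measure E3) (φ '' s n) := by
    intro s hs hsΩ hsd
    rw [image_iUnion]
    refine measure_iUnion (fun i j hij => ?_) fun n => hm _ (hs n) (hsΩ n)
    rw [Function.onFun, disjoint_iff_inter_eq_empty, ← hinj.image_inter (hsΩ i) (hsΩ j),
      (hsd hij).inter_eq, image_empty]
  have hint : ∀ s : ℕ → Set (EuclideanSpace ℝ (Fin 2)), (∀ n, MeasurableSet (s n)) →
      Pairwise (Function.onFun Disjoint s) → ∫⁻ p in ⋃ n, s n, ENNReal.ofReal (J p) =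
        ∑' n, ∫⁻ p in s n, ENNReal.ofReal (J p) := fun s hs hsd => lintegral_iUnion hs hsd _
  have hlin : ∀ p ∈ Ω, ∀ B : Set (EuclideanSpace ℝ (Fin 2)),
      (Measure.euclideanHausdorffMeasure 2 : Measure E3) (φ' p '' B) =
        ENNReal.ofReal (J p) * volume B := fun p hp B => by
    have := (φ' p).toLinearMap.euclideanHausdorffMeasure_image_eq_normDet_mul_volume B
    rw [finrank_euclideanSpace, Fintype.card_fin] at this
    rw [hJ p hp]
    exact this
  -- Locally `φ` is compared with its derivative at `p`, for which the formula is linear algebra. Of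
  -- the three factors `c`, two come from the Lipschitz constant in dimension two and one from the
  -- oscillation of `J`. Finally `c` tends to 1.
  have hloc : ∀ c : NNReal, 1 < c → ∀ p ∈ Ω, ∃ U ∈ 𝓝 p, ∀ B, MeasurableSet B → B ⊆ U ∩ Ω →
      (Measure.euclideanHausdorffMeasure 2 : Measure E3) (φ '' B) ≤
        (c : ℝ≥0∞) ^ 3 * ∫⁻ p in B, ENNReal.ofReal (J p) ∧
      ∫⁻ p in B, ENNReal.ofReal (J p) ≤
        (c : ℝ≥0∞) ^ 3 * (Measure.euclideanHausdorffMeasure 2 : Measure E3) (φ '' B) := by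
    intro c hc p hp
    have hcr : (1 : ℝ) < c := hc
    have hJp := hJpos p hp
    have hLinj : Function.Injective (φ' p) := by
      have h0 : (φ' p).toLinearMap.normDet ≠ 0 := by
        rw [← hJ p hp]
        exact hJp.ne'
      have := mt LinearMap.normDet_eq_zero_iff_ker_ne_bot.2 h0
      exact LinearMap.ker_eq_bot.1 (not_not.1 this)
    obtain ⟨U, hU, hUd⟩ := exists_nhds_dist_comparison (hd p hp) hLinj hcr
    have hev : ∀ᶠ q in 𝓝[Ω] p, J p < c * J q ∧ J q < c * J p := by
      have h1 := hJc p hp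
      refine (((tendsto_const_nhds (x := (c : ℝ))).mul h1).eventually_const_lt ?_).and
        (h1.eventually_lt_const ?_) <;> nlinarith
    obtain ⟨V, hV, hVJ⟩ := mem_nhdsWithin_iff_exists_mem_nhds_inter.1 hev
    refine ⟨U ∩ V, inter_mem hU hV, fun B hB hBU => ?_⟩
    have h1 : (Measure.euclideanHausdorffMeasure 2 : Measure E3) (φ '' B) ≤
        (c : ℝ≥0∞) ^ 2 * (ENNReal.ofReal (J p) * volume B) := by
      rw [← hlin p hp]
      exact euclideanHausdorffMeasure_image_le 2 c fun a ha b hb =>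
        (hUd a (hBU ha).1.1 b (hBU hb).1.1).1
    have h2 : ENNReal.ofReal (J p) * volume B ≤
        (c : ℝ≥0∞) ^ 2 * (Measure.euclideanHausdorffMeasure 2 : Measure E3) (φ '' B) := by
      rw [← hlin p hp]
      exact euclideanHausdorffMeasure_image_le 2 c fun a ha b hb =>
        (hUd a (hBU ha).1.1 b (hBU hb).1.1).2
    have hofc : ENNReal.ofReal c = c := ENNReal.ofReal_coe_nnreal
    have h3 : ENNReal.ofReal (J p) * volume B ≤ c * ∫⁻ q in B, ENNReal.ofReal (J q) := by
      rw [← setLIntegral_const, ← lintegral_const_mul' _ _ ENNReal.coe_ne_top]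
      refine setLIntegral_mono' hB fun q hq => ?_
      rw [← hofc, ← ENNReal.ofReal_mul (by positivity)]
      exact ENNReal.ofReal_le_ofReal (hVJ ⟨(hBU hq).1.2, (hBU hq).2⟩).1.le
    have h4 : ∫⁻ q in B, ENNReal.ofReal (J q) ≤ c * (ENNReal.ofReal (J p) * volume B) := by
      rw [← setLIntegral_const, ← lintegral_const_mul' _ _ ENNReal.coe_ne_top]
      refine setLIntegral_mono' hB fun q hq => ?_
      rw [← hofc, ← ENNReal.ofReal_mul (by positivity)]
      exact ENNReal.ofReal_le_ofReal (hVJ ⟨(hBU hq).1.2, (hBU hq).2⟩).2.le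
    constructor
    · calc _ ≤ _ := h1
        _ ≤ (c : ℝ≥0∞) ^ 2 * (c * ∫⁻ p in B, ENNReal.ofReal (J p)) := by gcongr
        _ = _ := by ring
    · calc _ ≤ _ := h4
        _ ≤ (c : ℝ≥0∞) *
            ((c : ℝ≥0∞) ^ 2 * (Measure.euclideanHausdorffMeasure 2 : Measure E3) (φ '' B)) := by
          gcongr
        _ = _ := by ring
  refine le_antisymm (ENNReal.le_of_forall_one_lt_pow_three_mul_le fun c hc => ?_)
    (ENNReal.le_of_forall_one_lt_pow_three_mul_le fun c hc => ?_)
  · refine le_of_locally_le (m₁ := fun B => Measure.euclideanHausdorffMeasure 2 (φ '' B))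
      (m₂ := fun B => (c : ℝ≥0∞) ^ 3 * ∫⁻ p in B, ENNReal.ofReal (J p)) hne
      (fun s h1 h2 h3 => (himg s h1 h2 h3).le) (fun s h1 h2 h3 => ?_) (fun p hp => ?_) hB hBΩ
    · rw [hint s h1 h3, ENNReal.tsum_mul_left]
    · obtain ⟨U, hU, h⟩ := hloc c hc p hp
      exact ⟨U, hU, fun B hB hBU => (h B hB hBU).1⟩
  · refine le_of_locally_le (m₂ := fun B => (c : ℝ≥0∞) ^ 3 *
        Measure.euclideanHausdorffMeasure 2 (φ '' B))
      (m₁ := fun B => ∫⁻ p in B, ENNReal.ofReal (J p)) hne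
      (fun s h1 h2 h3 => (hint s h1 h3).le) (fun s h1 h2 h3 => ?_) (fun p hp => ?_) hB hBΩ
    · rw [himg s h1 h2 h3, ENNReal.tsum_mul_left]
    · obtain ⟨U, hU, h⟩ := hloc c hc p hp
      exact ⟨U, hU, fun B hB hBU => (h B hB hBU).2⟩

theorem lintegral_image_eq_lintegral_mul {Ω : Set (EuclideanSpace ℝ (Fin 2))}
    (hΩ : MeasurableSet Ω) {φ : EuclideanSpace ℝ (Fin 2) → E3}
    {φ' : EuclideanSpace ℝ (Fin 2) → EuclideanSpace ℝ (Fin 2) →L[ℝ] E3}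
    (hd : ∀ p ∈ Ω, HasStrictFDerivAt φ (φ' p) p) {J : EuclideanSpace ℝ (Fin 2) → ℝ}
    (hJ : ∀ p ∈ Ω, J p = (φ' p).toLinearMap.normDet) (hJc : ContinuousOn J Ω)
    (hJpos : ∀ p ∈ Ω, 0 < J p) (hinj : InjOn φ Ω) {g : E3 → ℝ≥0∞} (hg : Measurable g) :
    ∫⁻ x in φ '' Ω, g x ∂(Measure.euclideanHausdorffMeasure 2 : Measure E3) =
      ∫⁻ p in Ω, ENNReal.ofReal (J p) * g (φ p) := by
  have hcont : ContinuousOn φ Ω := fun p hp => (hd p hp).continuousAt.continuousWithinAt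
  have hφm : AEMeasurable φ (volume.restrict Ω) := hcont.aemeasurable hΩ
  have hJm : AEMeasurable (fun p => ENNReal.ofReal (J p)) (volume.restrict Ω) :=
    (hJc.aemeasurable hΩ).ennreal_ofReal
  set μ := (volume.restrict Ω).withDensity fun p => ENNReal.ofReal (J p) with hμ
  have hφμ : AEMeasurable φ μ := hφm.mono_ac (withDensity_absolutelyContinuous _ _)
  have hmap : (Measure.euclideanHausdorffMeasure 2 : Measure E3).restrict (φ '' Ω) = μ.map φ := by
    ext s hs
    have hB : MeasurableSet (Ω ∩ φ ⁻¹' s) := by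
      have := hΩ.subtype_image (hcont.domRestrict.measurable hs)
      convert this using 1
      ext p
      simp [and_comm]
    have hA := euclideanHausdorffMeasure_image_eq_lintegral hd hJ hJc hJpos hinj hB inter_subset_left
    rw [image_inter_preimage] at hA
    rw [Measure.restrict_apply hs, Measure.map_apply_of_aemeasurable hφμ hs, hμ,
      withDensity_apply', Measure.restrict_restrict' hΩ, inter_comm, hA, inter_comm]
  have hgm : AEMeasurable (fun p => g (φ p)) (volume.restrict Ω) := hg.comp_aemeasurable hφm
  rw [hmap, lintegral_map' hg.aemeasurable hφμ, hμ,
    lintegral_withDensity_eq_lintegral_mul₀ hJm hgm]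
  rfl

/-! ### The parametrisation of spindles -/

/-- The parametrisation of the spindle by `p = (v, t)`. -/
noncomputable def spindleMap (f : ℝ → ℝ) (ε : ℝ) (p : EuclideanSpace ℝ (Fin 2)) : E3 :=
  !₂[ε * f (p 0) * Real.cos (p 1), ε * f (p 0) * Real.sin (p 1), ε⁻¹ * p 0]

/-- The derivative of `spindleMap`, where `a = f v`, `b = f' v`. -/
noncomputable def spindleDeriv (ε a b t : ℝ) : EuclideanSpace ℝ (Fin 2) →L[ℝ] E3 :=
  (PiLp.continuousLinearEquiv 2 ℝ fun _ : Fin 3 => ℝ).symm.toContinuousLinearMap.comp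
    (ContinuousLinearMap.pi
      ![(ε * b * Real.cos t) • EuclideanSpace.proj 0 + (-(ε * a * Real.sin t)) • EuclideanSpace.proj 1,
        (ε * b * Real.sin t) • EuclideanSpace.proj 0 + (ε * a * Real.cos t) • EuclideanSpace.proj 1,
        ε⁻¹ • EuclideanSpace.proj 0])

theorem spindleDeriv_apply (ε a b t : ℝ) (w : EuclideanSpace ℝ (Fin 2)) :
    spindleDeriv ε a b t w = !₂[ε * b * Real.cos t * w 0 - ε * a * Real.sin t * w 1,
      ε * b * Real.sin t * w 0 + ε * a * Real.cos t * w 1, ε⁻¹ * w 0] := by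
  ext i
  fin_cases i <;> simp [spindleDeriv, sub_eq_add_neg]

theorem hasStrictFDerivAt_spindleMap {f : ℝ → ℝ} {ε b : ℝ} {p : EuclideanSpace ℝ (Fin 2)}
    (hf : HasStrictDerivAt f b (p 0)) :
    HasStrictFDerivAt (spindleMap f ε) (spindleDeriv ε (f (p 0)) b (p 1)) p := by
  have h0 : HasStrictFDerivAt (fun p : EuclideanSpace ℝ (Fin 2) => p 0)
      (EuclideanSpace.proj (0 : Fin 2) : EuclideanSpace ℝ (Fin 2) →L[ℝ] ℝ) p :=
    (EuclideanSpace.proj (0 : Fin 2) : EuclideanSpace ℝ (Fin 2) →L[ℝ] ℝ).hasStrictFDerivAt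
  have h1 : HasStrictFDerivAt (fun p : EuclideanSpace ℝ (Fin 2) => p 1)
      (EuclideanSpace.proj (1 : Fin 2) : EuclideanSpace ℝ (Fin 2) →L[ℝ] ℝ) p :=
    (EuclideanSpace.proj (1 : Fin 2) : EuclideanSpace ℝ (Fin 2) →L[ℝ] ℝ).hasStrictFDerivAt
  have hfp := (hf.comp_hasStrictFDerivAt p h0).const_mul ε
  have hc := (Real.hasStrictDerivAt_cos (p 1)).comp_hasStrictFDerivAt p h1
  have hs := (Real.hasStrictDerivAt_sin (p 1)).comp_hasStrictFDerivAt p h1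
  rw [hasStrictFDerivAt_euclidean]
  intro i
  fin_cases i
  · refine (hfp.mul hc).congr_fderiv ?_
    ext w
    simp [spindleDeriv_apply]
    ring
  · refine (hfp.mul hs).congr_fderiv ?_
    ext w
    simp [spindleDeriv_apply]
    ring
  · refine (h0.const_mul ε⁻¹).congr_fderiv ?_
    ext w
    simp [spindleDeriv_apply]

/-- The meridian and parallel tangents are orthogonal, with squared lengths `ε²b² + ε⁻²` and `ε²a²`;
the product is `a²(1 + ε⁴b²)`. The scalings `ε` and `ε⁻¹` cancel to leading order, which keeps the
area near 1. -/
theorem normDet_spindleDeriv {ε a : ℝ} (hε : 0 < ε) (ha : 0 < a) (b t : ℝ) :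
    (spindleDeriv ε a b t).toLinearMap.normDet = a * Real.sqrt (1 + ε ^ 4 * b ^ 2) := by
  have h := (spindleDeriv ε a b t).toLinearMap.normDet_sq_eq_det_gram
    (EuclideanSpace.basisFun (Fin 2) ℝ)
  have h0 := (spindleDeriv ε a b t).toLinearMap.normDet_nonneg
  have hcs := Real.sin_sq_add_cos_sq t
  refine (pow_left_inj₀ h0 (by positivity) two_ne_zero).1 ?_
  simp [Matrix.det_fin_two, Matrix.gram, spindleDeriv_apply, PiLp.inner_apply, Fin.sum_univ_three] at h
  rw [h, mul_pow, Real.sq_sqrt (by positivity)]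
  have e1 : ε * b * Real.cos t * (ε * b * Real.cos t) + ε * b * Real.sin t * (ε * b * Real.sin t) +
      ε⁻¹ * ε⁻¹ = ε ^ 2 * b ^ 2 + ε⁻¹ * ε⁻¹ := by
    linear_combination ε ^ 2 * b ^ 2 * hcs
  have e2 : ε * a * Real.sin t * (ε * a * Real.sin t) + ε * a * Real.cos t * (ε * a * Real.cos t) =
      ε ^ 2 * a ^ 2 := by
    linear_combination ε ^ 2 * a ^ 2 * hcs
  rw [e1, e2]
  field_simp
  ring

theorem measure_lintegral_euclidean_two (F : ℝ × ℝ → ℝ≥0∞) (S : Set (ℝ × ℝ)) :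
    ∫⁻ p in {p : EuclideanSpace ℝ (Fin 2) | (p 0, p 1) ∈ S}, F (p 0, p 1) =
      ∫⁻ q in S, F q ∂((volume : Measure ℝ).prod volume) := by
  have h1 := (EuclideanSpace.volume_preserving_symm_measurableEquiv_toLp (Fin 2))
  have h2 := (volume_preserving_finTwoArrow ℝ).comp h1
  exact h2.setLIntegral_comp_preimage_emb
    (MeasurableEquiv.finTwoArrow.measurableEmbedding.comp (MeasurableEquiv.measurableEmbedding _)) F S

/-- The rectangle of parameters with the meridian opposite to the angle `τ` as its cut. -/
def paramRect (τ : ℝ) : Set (ℝ × ℝ) := Ioo (-1) 1 ×ˢ Ioc (τ - Real.pi) (τ + Real.pi)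

theorem eq_of_cos_eq_of_sin_eq {τ s t : ℝ} (hs : s ∈ Ioc (τ - Real.pi) (τ + Real.pi))
    (ht : t ∈ Ioc (τ - Real.pi) (τ + Real.pi)) (hc : Real.cos s = Real.cos t)
    (hsin : Real.sin s = Real.sin t) : s = t := by
  obtain ⟨k, hk⟩ := Real.Angle.angle_eq_iff_two_pi_dvd_sub.1 (Real.Angle.cos_sin_inj hc hsin)
  have hpi := Real.pi_pos
  have h1 : |(k : ℝ)| < 1 := by
    have : |s - t| < 2 * Real.pi := by
      rw [abs_lt]
      constructor <;> linarith [hs.1, hs.2, ht.1, ht.2]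
    rw [hk, abs_mul, abs_of_pos (by positivity)] at this
    nlinarith [abs_nonneg (k : ℝ)]
  have h2 : k = 0 := Int.abs_lt_one_iff.1 (by exact_mod_cast h1)
  rw [h2] at hk
  simp at hk
  linarith

theorem exists_mem_Ioc_cos_sin_eq (τ t : ℝ) : ∃ s ∈ Ioc (τ - Real.pi) (τ + Real.pi),
    Real.cos s = Real.cos t ∧ Real.sin s = Real.sin t := by
  refine ⟨toIocMod Real.two_pi_pos (τ - Real.pi) t, ?_, ?_, ?_⟩
  · have := toIocMod_mem_Ioc Real.two_pi_pos (τ - Real.pi) t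
    rwa [show τ - Real.pi + 2 * Real.pi = τ + Real.pi by ring] at this
  · rw [← self_sub_toIocDiv_zsmul, zsmul_eq_mul, Real.cos_sub_int_mul_two_pi]
  · rw [← self_sub_toIocDiv_zsmul, zsmul_eq_mul, Real.sin_sub_int_mul_two_pi]

/-- The surface element of the spindle. -/
noncomputable def spindleDensity (f : ℝ → ℝ) (ε v : ℝ) : ℝ :=
  f v * Real.sqrt (1 + ε ^ 4 * deriv f v ^ 2)

namespace IsSpindleProfile

variable {f : ℝ → ℝ}

theorem hasStrictDerivAt (hf : IsSpindleProfile f) {v : ℝ} (hv : v ∈ Ioo (-1 : ℝ) 1) :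
    HasStrictDerivAt f (deriv f v) v :=
  (hf.smooth.contDiffAt (isOpen_Ioo.mem_nhds hv)).hasStrictDerivAt (by simp)

theorem continuousOn_deriv (hf : IsSpindleProfile f) : ContinuousOn (deriv f) (Ioo (-1) 1) :=
  hf.smooth.continuousOn_deriv_of_isOpen isOpen_Ioo (by simp)

theorem continuousOn_density (hf : IsSpindleProfile f) (ε : ℝ) :
    ContinuousOn (spindleDensity f ε) (Ioo (-1) 1) :=
  (hf.continuousOn.mono Ioo_subset_Icc_self).mul
    (continuousOn_const.add (continuousOn_const.mul (hf.continuousOn_deriv.pow 2))).sqrt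

theorem density_pos (hf : IsSpindleProfile f) (ε : ℝ) {v : ℝ} (hv : v ∈ Ioo (-1 : ℝ) 1) :
    0 < spindleDensity f ε v :=
  mul_pos (hf.pos v hv) (Real.sqrt_pos.2 (by positivity))

/-- The two poles, where the parametrisation degenerates, are set apart as a null set. The position
of the cut is left free so that it can be placed opposite to the point at which a potential is
evaluated. -/
theorem spindle_eq (hf : IsSpindleProfile f) (ε τ : ℝ) :
    spindle f ε = spindleMap f ε '' {p | (p 0, p 1) ∈ paramRect τ} ∪
      {!₂[0, 0, -ε⁻¹], !₂[0, 0, ε⁻¹]} := by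
  ext x
  constructor
  · rintro ⟨v, hv, t, rfl⟩
    rcases eq_or_lt_of_le hv.1 with h1 | h1
    · right; left
      simp [← h1, hf.left_end]
    rcases eq_or_lt_of_le hv.2 with h2 | h2
    · right; right
      simp [h2, hf.right_end]
    left
    obtain ⟨s, hs, hc, hsin⟩ := exists_mem_Ioc_cos_sin_eq τ t
    exact ⟨!₂[v, s], ⟨⟨h1, h2⟩, hs⟩, by simp [spindleMap, hc, hsin]⟩
  · rintro (⟨p, hp, rfl⟩ | rfl | rfl)
    · exact ⟨p 0, ⟨hp.1.1.le, hp.1.2.le⟩, p 1, rfl⟩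
    · exact ⟨-1, by simp, 0, by simp [hf.left_end]⟩
    · exact ⟨1, by simp, 0, by simp [hf.right_end]⟩

theorem injOn_spindleMap (hf : IsSpindleProfile f) {ε : ℝ} (hε : 0 < ε) (τ : ℝ) :
    InjOn (spindleMap f ε) {p | (p 0, p 1) ∈ paramRect τ} := by
  intro p hp q hq h
  have h0 : ε * f (p 0) * Real.cos (p 1) = ε * f (q 0) * Real.cos (q 1) :=
    congrArg (fun x : E3 => x 0) h
  have h1 : ε * f (p 0) * Real.sin (p 1) = ε * f (q 0) * Real.sin (q 1) :=
    congrArg (fun x : E3 => x 1) h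
  have h2 : ε⁻¹ * p 0 = ε⁻¹ * q 0 := congrArg (fun x : E3 => x 2) h
  have hv : p 0 = q 0 := mul_left_cancel₀ (inv_pos.2 hε).ne' h2
  have hne : ε * f (q 0) ≠ 0 := (mul_pos hε (hf.pos _ hq.1)).ne'
  rw [hv] at h0 h1
  have ht := eq_of_cos_eq_of_sin_eq hp.2 hq.2 (mul_left_cancel₀ hne h0) (mul_left_cancel₀ hne h1)
  ext i
  fin_cases i
  · exact hv
  · exact ht

/-- The surface measure of a spindle in the coordinates `(v, t)`. -/
theorem lintegral_spindle (hf : IsSpindleProfile f) {ε : ℝ} (hε : 0 < ε) (τ : ℝ) {g : E3 → ℝ≥0∞}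
    (hg : Measurable g) :
    ∫⁻ x, g x ∂(surfaceMeasure (spindle f ε)) =
      ∫⁻ v in Ioo (-1) 1, ∫⁻ t in Ioc (τ - Real.pi) (τ + Real.pi),
        ENNReal.ofReal (spindleDensity f ε v) *
          g !₂[ε * f v * Real.cos t, ε * f v * Real.sin t, ε⁻¹ * v] := by
  have hatoms : ∀ x : E3, (Measure.euclideanHausdorffMeasure 2 : Measure E3) {x} = 0 := fun x => by
    have : NullSingletonClass (Measure.hausdorffMeasure (2 : ℕ) : Measure E3) :=
      Measure.nullSingletonClass_hausdorff E3 (by norm_num)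
    rw [Measure.euclideanHausdorffMeasure_def, Measure.smul_apply, measure_singleton, smul_zero]
  have hΩm : MeasurableSet {p : EuclideanSpace ℝ (Fin 2) | (p 0, p 1) ∈ paramRect τ} := by
    have : Measurable fun p : EuclideanSpace ℝ (Fin 2) => (p 0, p 1) := by fun_prop
    exact this (measurableSet_Ioo.prod measurableSet_Ioc)
  have hmap : MapsTo (fun p : EuclideanSpace ℝ (Fin 2) => p 0)
      {p | (p 0, p 1) ∈ paramRect τ} (Ioo (-1) 1) := fun p hp => hp.1
  have h1 := lintegral_image_eq_lintegral_mul hΩm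
    (φ := spindleMap f ε) (φ' := fun p => spindleDeriv ε (f (p 0)) (deriv f (p 0)) (p 1))
    (J := fun p => spindleDensity f ε (p 0))
    (fun p hp => hasStrictFDerivAt_spindleMap (hf.hasStrictDerivAt hp.1))
    (fun p hp => (normDet_spindleDeriv hε (hf.pos _ hp.1) _ _).symm)
    ((hf.continuousOn_density ε).comp (by fun_prop) hmap)
    (fun p hp => hf.density_pos ε hp.1) (hf.injOn_spindleMap hε τ) hg
  have h2 : (surfaceMeasure (spindle f ε)) =
      (Measure.euclideanHausdorffMeasure 2 : Measure E3).restrict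
        (spindleMap f ε '' {p | (p 0, p 1) ∈ paramRect τ}) := by
    rw [surfaceMeasure, hf.spindle_eq ε τ]
    refine Measure.restrict_congr_set (union_ae_eq_left_of_ae_eq_empty ?_)
    rw [ae_eq_empty, ← union_singleton, measure_union_null_iff]
    exact ⟨hatoms _, hatoms _⟩
  have h3 := measure_lintegral_euclidean_two (fun q => ENNReal.ofReal (spindleDensity f ε q.1) *
          g !₂[ε * f q.1 * Real.cos q.2, ε * f q.1 * Real.sin q.2, ε⁻¹ * q.1]) (paramRect τ)
  rw [h2, h1]
  refine h3.trans ?_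
  rw [paramRect, ← Measure.prod_restrict, lintegral_prod]
  have hfm : AEMeasurable (fun q : ℝ × ℝ => f q.1)
      ((volume.restrict (Ioo (-1) 1)).prod (volume.restrict (Ioc (τ - Real.pi) (τ + Real.pi)))) :=
    ((hf.continuousOn.mono Ioo_subset_Icc_self).aemeasurable measurableSet_Ioo).comp_fst
  have hdm : AEMeasurable (fun q : ℝ × ℝ => spindleDensity f ε q.1)
      ((volume.restrict (Ioo (-1) 1)).prod (volume.restrict (Ioc (τ - Real.pi) (τ + Real.pi)))) :=
    ((hf.continuousOn_density ε).aemeasurable measurableSet_Ioo).comp_fst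
  refine hdm.ennreal_ofReal.mul (hg.comp_aemeasurable ?_)
  refine (MeasurableEquiv.toLp 2 (Fin 3 → ℝ)).measurable.comp_aemeasurable ?_
  refine aemeasurable_pi_lambda _ fun i => ?_
  fin_cases i
  · exact (hfm.const_mul ε).mul (by fun_prop)
  · exact (hfm.const_mul ε).mul (by fun_prop)
  · exact (measurable_fst.const_mul ε⁻¹).aemeasurable

end IsSpindleProfile

/-! ### Area of spindles -/

/-- Stretching of the three axes. -/
noncomputable def stretch (ε : ℝ) : E3 →L[ℝ] E3 :=
  (PiLp.continuousLinearEquiv 2 ℝ fun _ : Fin 3 => ℝ).symm.toContinuousLinearMap.comp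
    (ContinuousLinearMap.pi
      ![ε • EuclideanSpace.proj 0, ε • EuclideanSpace.proj 1, ε⁻¹ • EuclideanSpace.proj 2])

theorem stretch_apply (ε : ℝ) (x : E3) : stretch ε x = !₂[ε * x 0, ε * x 1, ε⁻¹ * x 2] := by
  ext i
  fin_cases i <;> simp [stretch]

/-- `stretch` as an equivalence. -/
noncomputable def stretchEquiv {ε : ℝ} (hε : ε ≠ 0) : E3 ≃L[ℝ] E3 :=
  ContinuousLinearEquiv.equivOfInverse (stretch ε) (stretch ε⁻¹)
    (fun x => by
      ext i
      fin_cases i <;> simp [stretch_apply, hε])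
    (fun x => by
      ext i
      fin_cases i <;> simp [stretch_apply, hε])

theorem spindle_eq_image_stretch (f : ℝ → ℝ) (ε : ℝ) : spindle f ε = stretch ε '' spindle f 1 := by
  ext x
  constructor
  · rintro ⟨v, hv, t, rfl⟩
    refine ⟨_, ⟨v, hv, t, rfl⟩, ?_⟩
    ext i
    fin_cases i <;> simp [stretch_apply, mul_assoc]
  · rintro ⟨_, ⟨v, hv, t, rfl⟩, rfl⟩
    refine ⟨v, hv, t, ?_⟩
    ext i
    fin_cases i <;> simp [stretch_apply, mul_assoc]

namespace IsSpindleProfile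

variable {f : ℝ → ℝ}

theorem isClosedSmoothSurface_spindle (hf : IsSpindleProfile f) {ε : ℝ} (hε : 0 < ε) :
    IsClosedSmoothSurface (spindle f ε) := by
  rw [spindle_eq_image_stretch]
  exact hf.closes_up.image (stretchEquiv hε.ne')

theorem area_eq (hf : IsSpindleProfile f) {ε : ℝ} (hε : 0 < ε) :
    area (spindle f ε) = ENNReal.ofReal (2 * Real.pi) *
      ∫⁻ v in Ioo (-1) 1, ENNReal.ofReal (spindleDensity f ε v) := by
  have h := hf.lintegral_spindle hε 0 (g := fun _ => 1) measurable_const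
  rw [lintegral_one] at h
  rw [area, h, ← lintegral_const_mul' _ _ ENNReal.ofReal_ne_top]
  refine lintegral_congr fun v => ?_
  rw [setLIntegral_const, Real.volume_Ioc, mul_one, mul_comm]
  congr 2
  ring

theorem lintegral_profile (hf : IsSpindleProfile f) :
    ENNReal.ofReal (2 * Real.pi) * ∫⁻ v in Ioo (-1) 1, ENNReal.ofReal (f v) = 1 := by
  have hi : IntegrableOn f (Ioo (-1) 1) :=
    (hf.continuousOn.integrableOn_Icc).mono_set Ioo_subset_Icc_self
  have h := hf.normalized
  rw [intervalIntegral.integral_of_le (by norm_num), integral_Ioc_eq_integral_Ioo] at h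
  rw [← ofReal_integral_eq_lintegral_ofReal hi, ← ENNReal.ofReal_mul (by positivity), h,
    ENNReal.ofReal_one]
  exact (ae_restrict_iff' measurableSet_Ioo).2 (ae_of_all _ fun v hv => (hf.pos v hv).le)

theorem le_density (hf : IsSpindleProfile f) (ε : ℝ) {v : ℝ} (hv : v ∈ Ioo (-1 : ℝ) 1) :
    f v ≤ spindleDensity f ε v :=
  le_mul_of_one_le_right (hf.pos v hv).le
    (Real.one_le_sqrt.2 (le_add_of_nonneg_right (by positivity)))

theorem density_le (hf : IsSpindleProfile f) (ε : ℝ) {v : ℝ} (hv : v ∈ Ioo (-1 : ℝ) 1) :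
    spindleDensity f ε v ≤ f v + ε ^ 2 * (f v * |deriv f v|) := by
  have h : Real.sqrt (1 + ε ^ 4 * deriv f v ^ 2) ≤ 1 + ε ^ 2 * |deriv f v| := by
    refine Real.sqrt_le_iff.2 ⟨by positivity, ?_⟩
    have : (1 + ε ^ 2 * |deriv f v|) ^ 2 = 1 + ε ^ 4 * |deriv f v| ^ 2 + 2 * (ε ^ 2 * |deriv f v|) := by
      ring
    rw [this, sq_abs]
    exact le_add_of_nonneg_right (by positivity)
  calc _ ≤ f v * (1 + ε ^ 2 * |deriv f v|) := mul_le_mul_of_nonneg_left h (hf.pos v hv).le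
    _ = _ := by ring

theorem exists_left (hf : IsSpindleProfile f) :
    ∃ a ∈ Ioo (-1 : ℝ) 1, ∀ v ∈ Ioo (-1) a, 1 ≤ deriv f v := by
  obtain ⟨a, ha, h⟩ := (mem_nhdsGT_iff_exists_Ioo_subset).1 (hf.deriv_left.eventually_ge_atTop 1)
  refine ⟨min a 0, ⟨lt_min ha (by norm_num), (min_le_right _ _).trans_lt one_pos⟩, fun v hv => ?_⟩
  exact h ⟨hv.1, hv.2.trans_le (min_le_left _ _)⟩

theorem exists_right (hf : IsSpindleProfile f) :
    ∃ b ∈ Ioo (-1 : ℝ) 1, ∀ v ∈ Ioo b 1, deriv f v ≤ -1 := by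
  obtain ⟨b, hb, h⟩ :=
    (mem_nhdsLT_iff_exists_Ioo_subset).1 (hf.deriv_right.eventually_le_atBot (-1))
  refine ⟨max b 0, ⟨(neg_one_lt_zero).trans_le (le_max_right _ _), max_lt hb one_pos⟩,
    fun v hv => ?_⟩
  exact h ⟨(le_max_left _ _).trans_lt hv.1, hv.2⟩

/-- The density exceeds `f` strictly wherever `f' ≠ 0`, in particular on an interval next to a pole.
-/
theorem one_lt_area (hf : IsSpindleProfile f) {ε : ℝ} (hε : 0 < ε) :
    1 < area (spindle f ε) := by
  rw [hf.area_eq hε, ← hf.lintegral_profile]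
  refine ENNReal.mul_lt_mul_right (by simp [Real.pi_pos]) ENNReal.ofReal_ne_top ?_
  have hfin : ∫⁻ v in Ioo (-1) 1, ENNReal.ofReal (f v) ≠ ⊤ := by
    intro h
    have := hf.lintegral_profile
    rw [h, ENNReal.mul_top (by simp [Real.pi_pos])] at this
    exact ENNReal.top_ne_one this
  obtain ⟨a, ha, hfa⟩ := hf.exists_left
  refine lintegral_strict_mono_of_ae_le_of_ae_lt_on
    ((hf.continuousOn_density ε).aemeasurable measurableSet_Ioo).ennreal_ofReal hfin ?_
    (s := Ioo (-1) a) ?_ ?_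
  · exact (ae_restrict_iff' measurableSet_Ioo).2 (ae_of_all _ fun v hv =>
      ENNReal.ofReal_le_ofReal (hf.le_density ε hv))
  · rw [Measure.restrict_apply measurableSet_Ioo,
      inter_eq_left.2 (Ioo_subset_Ioo_right ha.2.le), Real.volume_Ioo]
    simp
    linarith [ha.1]
  · refine ae_of_all _ fun v hv => ?_
    have hv' : v ∈ Ioo (-1 : ℝ) 1 := ⟨hv.1, hv.2.trans ha.2⟩
    refine (ENNReal.ofReal_lt_ofReal_iff (hf.density_pos ε hv')).2 ?_
    refine lt_mul_of_one_lt_right (hf.pos v hv') ?_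
    rw [Real.lt_sqrt (by norm_num)]
    have := hfa v hv
    have : 0 < ε ^ 4 * deriv f v ^ 2 := by positivity
    linarith

/-- The correction `f|f'|` is at most the density of the spindle with `ε = 1`, so its integral is
bounded by the area of that closed smooth surface. -/
theorem area_le (hf : IsSpindleProfile f) {ε : ℝ} (hε : 0 < ε) :
    area (spindle f ε) ≤ 1 + ENNReal.ofReal (ε ^ 2) * area (spindle f 1) := by
  rw [hf.area_eq hε, hf.area_eq one_pos, ← hf.lintegral_profile, mul_left_comm, ← mul_add,
    ← lintegral_const_mul' (ENNReal.ofReal (ε ^ 2)) _ ENNReal.ofReal_ne_top,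
    ← lintegral_add_left']
  · gcongr 1
    refine setLIntegral_mono' measurableSet_Ioo fun v hv => ?_
    have h1 := hf.pos v hv
    rw [← ENNReal.ofReal_mul (by positivity), ← ENNReal.ofReal_add h1.le
      (mul_nonneg (by positivity) (hf.density_pos 1 hv).le)]
    refine ENNReal.ofReal_le_ofReal ((hf.density_le ε hv).trans ?_)
    unfold spindleDensity
    gcongr
    refine Real.abs_le_sqrt ?_
    linarith
  · exact ((hf.continuousOn.mono Ioo_subset_Icc_self).aemeasurable measurableSet_Ioo).ennreal_ofReal

theorem tendsto_area (hf : IsSpindleProfile f) :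
    Tendsto (fun ε => area (spindle f ε)) (𝓝[>] 0) (𝓝 1) := by
  have h1 : Tendsto (fun ε : ℝ => ENNReal.ofReal (ε ^ 2)) (𝓝[>] 0) (𝓝 0) := by
    have : Continuous fun ε : ℝ => ENNReal.ofReal (ε ^ 2) :=
      ENNReal.continuous_ofReal.comp (continuous_pow 2)
    have := (this.tendsto 0).mono_left (nhdsWithin_le_nhds (s := Ioi (0 : ℝ)))
    simpa using this
  have h2 := (ENNReal.Tendsto.mul_const (b := area (spindle f 1)) h1
    (Or.inr hf.closes_up.area_lt_top.ne)).const_add 1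
  rw [zero_mul, add_zero] at h2
  refine tendsto_of_tendsto_of_tendsto_of_le_of_le' tendsto_const_nhds h2 ?_ ?_
  · exact eventually_mem_nhdsWithin.mono fun ε hε => (hf.one_lt_area hε).le
  · exact eventually_mem_nhdsWithin.mono fun ε hε => hf.area_le hε

end IsSpindleProfile

/-! ### The potential of spindles -/

theorem dist_cylindrical_sq (r r₀ z z₀ t t₀ : ℝ) :
    dist (!₂[r₀ * Real.cos t₀, r₀ * Real.sin t₀, z₀] : E3) !₂[r * Real.cos t, r * Real.sin t, z] ^ 2 =
      (r₀ - r) ^ 2 + 4 * r₀ * r * Real.sin ((t - t₀) / 2) ^ 2 + (z₀ - z) ^ 2 := by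
  have h : Real.cos (t - t₀) = 1 - 2 * Real.sin ((t - t₀) / 2) ^ 2 := by
    rw [← Real.cos_sq_add_sin_sq ((t - t₀) / 2)]
    have := Real.cos_two_mul ((t - t₀) / 2)
    rw [mul_div_cancel₀ _ two_ne_zero] at this
    rw [this]
    linarith [Real.cos_sq_add_sin_sq ((t - t₀) / 2)]
  have h2 : 4 * r₀ * r * Real.sin ((t - t₀) / 2) ^ 2 = 2 * r₀ * r * (1 - Real.cos (t - t₀)) := by
    rw [h]
    ring
  rw [h2, Real.cos_sub, EuclideanSpace.dist_eq, Real.sq_sqrt (by positivity), Fin.sum_univ_three]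
  simp only [Real.dist_eq, sq_abs]
  simp
  linear_combination r₀ ^ 2 * Real.sin_sq_add_cos_sq t₀ + r ^ 2 * Real.sin_sq_add_cos_sq t

theorem le_dist_cylindrical {r r₀ : ℝ} (hr : 0 ≤ r) (hr₀ : 0 ≤ r₀) (z z₀ t t₀ : ℝ) :
    |r - r₀| ≤ dist (!₂[r₀ * Real.cos t₀, r₀ * Real.sin t₀, z₀] : E3)
      !₂[r * Real.cos t, r * Real.sin t, z] ∧
    r * |Real.sin ((t - t₀) / 2)| ≤ dist (!₂[r₀ * Real.cos t₀, r₀ * Real.sin t₀, z₀] : E3)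
      !₂[r * Real.cos t, r * Real.sin t, z] ∧
    |z - z₀| ≤ dist (!₂[r₀ * Real.cos t₀, r₀ * Real.sin t₀, z₀] : E3)
      !₂[r * Real.cos t, r * Real.sin t, z] := by
  have h := dist_cylindrical_sq r r₀ z z₀ t t₀
  have hs := Real.sin_sq_le_one ((t - t₀) / 2)
  set s := Real.sin ((t - t₀) / 2)
  have h0 : 0 ≤ 4 * r₀ * r * s ^ 2 := by positivity
  refine ⟨?_, ?_, ?_⟩
  · refine abs_le_of_sq_le_sq ?_ dist_nonneg
    nlinarith [sq_nonneg (z₀ - z)]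
  -- Since `(r₀ - r)² + 4r₀rs² = (1 - s²)(r₀ - r)² + s²(r₀ + r)²`, this is at least `s²r²`.
  · refine abs_le_of_sq_le_sq' ?_ dist_nonneg |>.2
    rw [mul_pow, sq_abs, h]
    nlinarith [mul_nonneg (sub_nonneg.2 hs) (sq_nonneg (r₀ - r)), sq_nonneg (z₀ - z),
      mul_nonneg (sq_nonneg s) (sq_nonneg r₀), mul_nonneg (sq_nonneg s) (mul_nonneg hr hr₀)]
  · refine abs_le_of_sq_le_sq ?_ dist_nonneg
    nlinarith [sq_nonneg (r₀ - r)]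

/-- Both exponents are below 1, so each factor is integrable in its own variable. The larger one
goes to the direction that is stretched by `ε⁻¹`, so that a positive power of `ε` survives. -/
theorem enorm_inv_le_rpow_mul_rpow {a b d : ℝ≥0∞} (ha : a ≤ d) (hb : b ≤ d) (hd0 : d ≠ 0)
    (hd : d ≠ ⊤) : d⁻¹ ≤ a ^ (-(3 / 4) : ℝ) * b ^ (-(1 / 4) : ℝ) := by
  have h : d⁻¹ = d ^ (-(3 / 4) : ℝ) * d ^ (-(1 / 4) : ℝ) := by
    rw [← ENNReal.rpow_add _ _ hd0 hd]
    norm_num [ENNReal.rpow_neg_one]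
  rw [h]
  simp only [ENNReal.rpow_neg]
  gcongr

theorem ofReal_mul_inv_le {m c q B : ℝ} {α β d : ℝ≥0∞} (hm : 0 ≤ m) (hc : 0 < c) (hq : 0 < q)
    (hα : α ≠ ⊤) (hβ : β ≠ ⊤) (h : m * (c ^ (-(3 / 4) : ℝ) * q ^ (-(1 / 4) : ℝ)) ≤ B)
    (ha : ENNReal.ofReal c * α ≤ d) (hb : ENNReal.ofReal q * β ≤ d) (hd0 : d ≠ 0) (hd : d ≠ ⊤) :
    ENNReal.ofReal m * d⁻¹ ≤
      ENNReal.ofReal B * (α ^ (-(3 / 4) : ℝ) * β ^ (-(1 / 4) : ℝ)) := by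
  have h1 := enorm_inv_le_rpow_mul_rpow ha hb hd0 hd
  rw [ENNReal.mul_rpow_of_ne_top ENNReal.ofReal_ne_top hα,
    ENNReal.mul_rpow_of_ne_top ENNReal.ofReal_ne_top hβ, ENNReal.ofReal_rpow_of_pos hc,
    ENNReal.ofReal_rpow_of_pos hq, mul_mul_mul_comm, ← ENNReal.ofReal_mul (by positivity)] at h1
  calc _ ≤ ENNReal.ofReal m * _ := mul_le_mul_right h1 _
    _ = ENNReal.ofReal (m * (c ^ (-(3 / 4) : ℝ) * q ^ (-(1 / 4) : ℝ))) *
        (α ^ (-(3 / 4) : ℝ) * β ^ (-(1 / 4) : ℝ)) := by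
      rw [← mul_assoc, ← ENNReal.ofReal_mul hm]
    _ ≤ _ := by gcongr

/-- The source of the factor `√ε`, as `ε^(3/4) ε^(-1/4)`. The weight `y = f v` turns `y^(-1/4)` into
`y^(3/4)`, so the thin ends of the spindle do no harm. -/
theorem mul_rpow_le_sqrt_mul {ε y F : ℝ} (hε : 0 < ε) (hy : 0 < y) (hyF : y ≤ F) (hF : 1 ≤ F) :
    y * (ε⁻¹ ^ (-(3 / 4) : ℝ) * (ε * y / Real.pi) ^ (-(1 / 4) : ℝ)) ≤
      Real.sqrt ε * (F * Real.pi) := by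
  have h1 : (ε⁻¹ : ℝ) ^ (-(3 / 4) : ℝ) = ε ^ (3 / 4 : ℝ) := by
    rw [Real.inv_rpow hε.le, Real.rpow_neg hε.le, inv_inv]
  have h2 : (ε * y / Real.pi) ^ (-(1 / 4) : ℝ) =
      ε ^ (-(1 / 4) : ℝ) * y ^ (-(1 / 4) : ℝ) * Real.pi ^ (1 / 4 : ℝ) := by
    rw [Real.div_rpow (by positivity) Real.pi_pos.le, Real.mul_rpow hε.le hy.le,
      Real.rpow_neg Real.pi_pos.le, div_inv_eq_mul]
  have h3 : y * y ^ (-(1 / 4) : ℝ) = y ^ (3 / 4 : ℝ) := by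
    conv_lhs => rw [← Real.rpow_one y, ← Real.rpow_mul hy.le, ← Real.rpow_add hy]
    norm_num
  have h4 : ε ^ (3 / 4 : ℝ) * ε ^ (-(1 / 4) : ℝ) = Real.sqrt ε := by
    rw [← Real.rpow_add hε, Real.sqrt_eq_rpow]
    norm_num
  have h5 : y ^ (3 / 4 : ℝ) ≤ F :=
    (Real.rpow_le_rpow hy.le hyF (by norm_num)).trans
      ((Real.rpow_le_rpow_of_exponent_le hF (by norm_num : (3 / 4 : ℝ) ≤ 1)).trans_eq
        (Real.rpow_one F))
  have h6 : Real.pi ^ (1 / 4 : ℝ) ≤ Real.pi :=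
    (Real.rpow_le_rpow_of_exponent_le (by linarith [Real.pi_gt_three])
      (by norm_num : (1 / 4 : ℝ) ≤ 1)).trans_eq (Real.rpow_one _)
  calc _ = Real.sqrt ε * (y ^ (3 / 4 : ℝ) * Real.pi ^ (1 / 4 : ℝ)) := by
        rw [h1, h2, ← h3, ← h4]
        ring
    _ ≤ _ := by gcongr

namespace IsSpindleProfile

variable {f : ℝ → ℝ}

/-- A majorant, up to a constant factor, of the potential of the parallels of a spindle. -/
noncomputable def majorant (f : ℝ → ℝ) (v₀ v : ℝ) : ℝ≥0∞ :=
  ‖v - v₀‖ₑ ^ (-(3 / 4) : ℝ) + ENNReal.ofReal |deriv f v| *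
    min (‖v - v₀‖ₑ ^ (-(3 / 4) : ℝ)) (‖f v - f v₀‖ₑ ^ (-(3 / 4) : ℝ))

/-- The part `f` of the density is paired with the axial distance `|v - v₀|/ε`. The part `ε² f|f'|`
may be paired with either the axial or the radial distance `ε|f v - f v₀|`, the latter because `ε²`
pays for its bad power of `ε`. Hence the minimum in `majorant`. -/
theorem density_mul_inv_le (hf : IsSpindleProfile f) {F ε v v₀ t t₀ : ℝ} (hF : 1 ≤ F)
    (hfF : ∀ v ∈ Icc (-1 : ℝ) 1, f v ≤ F) (hε : 0 < ε) (hε1 : ε ≤ 1) (hv : v ∈ Ioo (-1 : ℝ) 1)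
    (hv₀ : v₀ ∈ Icc (-1 : ℝ) 1) (ht : |t - t₀| ≤ Real.pi) (htt : t ≠ t₀) :
    ENNReal.ofReal (spindleDensity f ε v) *
      (edist (!₂[ε * f v₀ * Real.cos t₀, ε * f v₀ * Real.sin t₀, ε⁻¹ * v₀] : E3)
        !₂[ε * f v * Real.cos t, ε * f v * Real.sin t, ε⁻¹ * v])⁻¹ ≤
      ENNReal.ofReal (Real.sqrt ε * (F * Real.pi)) * majorant f v₀ v *
        ‖t - t₀‖ₑ ^ (-(1 / 4) : ℝ) := by
  have hy := hf.pos v hv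
  have hy₀ : 0 ≤ f v₀ := by
    rcases hv₀.1.eq_or_lt with h | h
    · rw [← h, hf.left_end]
    rcases hv₀.2.eq_or_lt with h' | h'
    · rw [h', hf.right_end]
    exact (hf.pos v₀ ⟨h, h'⟩).le
  obtain ⟨h1, h2, h3⟩ := le_dist_cylindrical (mul_pos hε hy).le (mul_nonneg hε.le hy₀)
    (ε⁻¹ * v) (ε⁻¹ * v₀) t t₀
  rw [edist_dist]
  set d := dist (!₂[ε * f v₀ * Real.cos t₀, ε * f v₀ * Real.sin t₀, ε⁻¹ * v₀] : E3)
        !₂[ε * f v * Real.cos t, ε * f v * Real.sin t, ε⁻¹ * v]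
  have hq : 0 < ε * f v / Real.pi := by positivity
  have hs : ε * f v / Real.pi * |t - t₀| ≤ d := by
    refine le_trans ?_ h2
    -- Jordan's inequality; it needs `|t - t₀| ≤ π`, which the choice of the cut guarantees.
    have := Real.mul_abs_le_abs_sin (x := (t - t₀) / 2) (by rw [abs_div, abs_two]; linarith)
    rw [abs_div, abs_two] at this
    calc _ = ε * f v * (2 / Real.pi * (|t - t₀| / 2)) := by field_simp
      _ ≤ _ := by gcongr
  have hd : 0 < d := lt_of_lt_of_le (mul_pos hq (abs_pos.2 (sub_ne_zero.2 htt))) hs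
  have hb : ENNReal.ofReal (ε * f v / Real.pi) * ‖t - t₀‖ₑ ≤ ENNReal.ofReal d := by
    rw [Real.enorm_eq_ofReal_abs, ← ENNReal.ofReal_mul hq.le]
    exact ENNReal.ofReal_le_ofReal hs
  have ha1 : ENNReal.ofReal ε⁻¹ * ‖v - v₀‖ₑ ≤ ENNReal.ofReal d := by
    rw [Real.enorm_eq_ofReal_abs, ← ENNReal.ofReal_mul (by positivity)]
    refine ENNReal.ofReal_le_ofReal (le_trans (le_of_eq ?_) h3)
    rw [← mul_sub, abs_mul, abs_of_pos (inv_pos.2 hε)]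
  have ha2 : ENNReal.ofReal ε * ‖f v - f v₀‖ₑ ≤ ENNReal.ofReal d := by
    rw [Real.enorm_eq_ofReal_abs, ← ENNReal.ofReal_mul (by positivity)]
    refine ENNReal.ofReal_le_ofReal (le_trans (le_of_eq ?_) h1)
    rw [← mul_sub, abs_mul, abs_of_pos hε]
  have hd0 : ENNReal.ofReal d ≠ 0 := (ENNReal.ofReal_pos.2 hd).ne'
  have hB := mul_rpow_le_sqrt_mul hε hy (hfF v (Ioo_subset_Icc_self hv)) hF
  set B := Real.sqrt ε * (F * Real.pi) with hBdef
  have hB0 : 0 ≤ B := by positivity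
  have hm : 0 ≤ ε ^ 2 * (f v * |deriv f v|) := by positivity
  have e2 : ε ^ 2 ≤ 1 := pow_le_one₀ hε.le hε1
  have hB2 : ε ^ 2 * (f v * |deriv f v|) *
      (ε⁻¹ ^ (-(3 / 4) : ℝ) * (ε * f v / Real.pi) ^ (-(1 / 4) : ℝ)) ≤ B * |deriv f v| := by
    calc _ = ε ^ 2 * ((f v * (ε⁻¹ ^ (-(3 / 4) : ℝ) * (ε * f v / Real.pi) ^ (-(1 / 4) : ℝ))) *
          |deriv f v|) := by ring
      _ ≤ 1 * (B * |deriv f v|) := by gcongr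
      _ = _ := one_mul _
  have hB3 : ε ^ 2 * (f v * |deriv f v|) *
      (ε ^ (-(3 / 4) : ℝ) * (ε * f v / Real.pi) ^ (-(1 / 4) : ℝ)) ≤ B * |deriv f v| := by
    -- That is, `ε^(5/4) ≤ ε^(3/4)` for `ε ≤ 1`.
    have e3 : ε ^ 2 * ε ^ (-(3 / 4) : ℝ) ≤ ε⁻¹ ^ (-(3 / 4) : ℝ) := by
      rw [Real.inv_rpow hε.le, Real.rpow_neg hε.le, inv_inv, ← Real.rpow_natCast,
        ← Real.rpow_neg hε.le, ← Real.rpow_add hε]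
      exact Real.rpow_le_rpow_of_exponent_ge hε hε1 (by norm_num)
    calc _ = (f v * ((ε ^ 2 * ε ^ (-(3 / 4) : ℝ)) * (ε * f v / Real.pi) ^ (-(1 / 4) : ℝ))) *
          |deriv f v| := by ring
      _ ≤ (f v * (ε⁻¹ ^ (-(3 / 4) : ℝ) * (ε * f v / Real.pi) ^ (-(1 / 4) : ℝ))) *
          |deriv f v| := by gcongr
      _ ≤ B * |deriv f v| := by gcongr
  have i1 := ofReal_mul_inv_le hy.le (inv_pos.2 hε) hq enorm_ne_top enorm_ne_top hB ha1 hb hd0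
    ENNReal.ofReal_ne_top
  have i2 := ofReal_mul_inv_le hm (inv_pos.2 hε) hq enorm_ne_top enorm_ne_top hB2 ha1 hb hd0
    ENNReal.ofReal_ne_top
  have i3 := ofReal_mul_inv_le hm hε hq enorm_ne_top enorm_ne_top hB3 ha2 hb hd0
    ENNReal.ofReal_ne_top
  rw [ENNReal.ofReal_mul hB0] at i2 i3
  refine (mul_le_mul_left ((ENNReal.ofReal_le_ofReal (hf.density_le ε hv)).trans_eq
    (ENNReal.ofReal_add hy.le hm)) _).trans ?_
  rw [add_mul, majorant, mul_add, add_mul, ← mul_assoc _ _ (min _ _)]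
  refine add_le_add (i1.trans_eq (mul_assoc _ _ _).symm) ?_
  rcases min_choice (‖v - v₀‖ₑ ^ (-(3 / 4) : ℝ)) (‖f v - f v₀‖ₑ ^ (-(3 / 4) : ℝ)) with h | h
  · rw [h]
    exact i2.trans_eq (mul_assoc _ _ _).symm
  · rw [h]
    exact i3.trans_eq (mul_assoc _ _ _).symm

theorem exists_forall_le (hf : IsSpindleProfile f) :
    ∃ F, 1 ≤ F ∧ ∀ v ∈ Icc (-1 : ℝ) 1, f v ≤ F := by
  obtain ⟨F, hF⟩ := isCompact_Icc.bddAbove_image hf.continuousOn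
  exact ⟨max 1 F, le_max_left _ _, fun v hv => (hF (mem_image_of_mem f hv)).trans (le_max_right _ _)⟩

/-- The substitution `w = f v` absorbs the unbounded `|f'|` and leaves an integrable singularity at
`f v₀` over a bounded set of `w`. -/
theorem setLIntegral_deriv_le (hf : IsSpindleProfile f) {F v₀ a b : ℝ}
    (hfF : ∀ v ∈ Icc (-1 : ℝ) 1, f v ≤ F) (hab : Ioo a b ⊆ Ioo (-1) 1)
    (hinj : InjOn f (Ioo a b)) :
    ∫⁻ v in Ioo a b, ENNReal.ofReal |deriv f v| * ‖f v - f v₀‖ₑ ^ (-(3 / 4) : ℝ) ≤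
      (∫⁻ w in Metric.ball (0 : ℝ) 1, ‖w‖ₑ ^ (-(3 / 4) : ℝ)) + ENNReal.ofReal F := by
  rw [← lintegral_image_eq_lintegral_abs_deriv_mul measurableSet_Ioo
    (fun v hv => (hf.hasStrictDerivAt (hab hv)).hasDerivAt.hasDerivWithinAt) hinj
    (fun w => ‖w - f v₀‖ₑ ^ (-(3 / 4) : ℝ))]
  refine (setLIntegral_enorm_sub_rpow_le volume (by norm_num) _ _).trans ?_
  gcongr
  calc volume (f '' Ioo a b) ≤ volume (Icc 0 F) := by
        refine measure_mono ?_
        rintro _ ⟨v, hv, rfl⟩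
        exact ⟨(hf.pos v (hab hv)).le, hfF v (Ioo_subset_Icc_self (hab hv))⟩
    _ = _ := by rw [Real.volume_Icc, sub_zero]

/-- Next to each pole `f` is strictly monotone, and the radial term is integrated by substitution.
On the compact middle part `f'` is bounded and the axial term suffices; the radial one would not do,
as nothing controls `f` near its critical points. -/
theorem exists_lintegral_majorant_le (hf : IsSpindleProfile f) :
    ∃ C : ℝ≥0∞, C ≠ ⊤ ∧ ∀ v₀, ∫⁻ v in Ioo (-1) 1, majorant f v₀ v ≤ C := by
  obtain ⟨F, -, hfF⟩ := hf.exists_forall_le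
  obtain ⟨a, ha, hfa⟩ := hf.exists_left
  obtain ⟨b, hb, hfb⟩ := hf.exists_right
  have hsub : Icc a b ⊆ Ioo (-1) 1 := fun v hv => ⟨ha.1.trans_le hv.1, hv.2.trans_lt hb.2⟩
  obtain ⟨K, hK⟩ := isCompact_Icc.bddAbove_image (hf.continuousOn_deriv.mono hsub).abs
  set J := ∫⁻ w in Metric.ball (0 : ℝ) 1, ‖w‖ₑ ^ (-(3 / 4) : ℝ)
  have hJ : J ≠ ⊤ := (lintegral_ball_enorm_rpow_lt_top volume (by simp) (by norm_num)).ne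
  have hI : ∀ v₀ : ℝ, ∫⁻ v in Ioo (-1 : ℝ) 1, ‖v - v₀‖ₑ ^ (-(3 / 4) : ℝ) ≤ J + 2 := fun v₀ => by
    refine (setLIntegral_enorm_sub_rpow_le volume (by norm_num) _ _).trans ?_
    rw [Real.volume_Ioo]
    norm_num
    exact le_rfl
  have hl : Ioo (-1) a ⊆ Ioo (-1) 1 := Ioo_subset_Ioo_right ha.2.le
  have hr : Ioo b 1 ⊆ Ioo (-1) 1 := Ioo_subset_Ioo_left hb.1.le
  have hcont : ContinuousOn f (Ioo (-1) 1) := hf.continuousOn.mono Ioo_subset_Icc_self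
  have il : InjOn f (Ioo (-1) a) := (strictMonoOn_of_deriv_pos (convex_Ioo _ _) (hcont.mono hl)
    fun v hv => one_pos.trans_le (hfa v (interior_subset hv))).injOn
  have ir : InjOn f (Ioo b 1) := (strictAntiOn_of_deriv_neg (convex_Ioo _ _) (hcont.mono hr)
    fun v hv => (hfb v (interior_subset hv)).trans_lt (by norm_num)).injOn
  refine ⟨(J + 2) + ((J + ENNReal.ofReal F) + (ENNReal.ofReal K * (J + 2) +
    (J + ENNReal.ofReal F))), ?_, fun v₀ => ?_⟩
  · simp [hJ, ENNReal.mul_eq_top]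
  · unfold majorant
    rw [lintegral_add_left (by fun_prop)]
    refine add_le_add (hI v₀) ?_
    have hcover : Ioo (-1 : ℝ) 1 ⊆ Ioo (-1) a ∪ (Icc a b ∪ Ioo b 1) := fun v hv => by
      rcases lt_or_ge v a with h | h
      · exact Or.inl ⟨hv.1, h⟩
      · rcases lt_or_ge b v with h' | h'
        · exact Or.inr (Or.inr ⟨h', hv.2⟩)
        · exact Or.inr (Or.inl ⟨h, h'⟩)
    refine (lintegral_mono_set hcover).trans ((lintegral_union_le _ _ _).trans
      (add_le_add ?_ ((lintegral_union_le _ _ _).trans (add_le_add ?_ ?_))))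
    · refine (lintegral_mono fun v => ?_).trans (hf.setLIntegral_deriv_le (v₀ := v₀) hfF hl il)
      exact mul_le_mul_right (min_le_right _ _) _
    · refine le_trans ?_ (mul_le_mul_right ((lintegral_mono_set hsub).trans (hI v₀)) _)
      rw [← lintegral_const_mul' _ _ ENNReal.ofReal_ne_top]
      refine setLIntegral_mono' measurableSet_Icc fun v hv => ?_
      exact mul_le_mul' (ENNReal.ofReal_le_ofReal (hK (mem_image_of_mem _ hv))) (min_le_left _ _)
    · refine (lintegral_mono fun v => ?_).trans (hf.setLIntegral_deriv_le (v₀ := v₀) hfF hr ir)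
      exact mul_le_mul_right (min_le_right _ _) _

theorem exists_gammaSup_le (hf : IsSpindleProfile f) :
    ∃ C : ℝ≥0∞, C ≠ ⊤ ∧ ∀ ε : ℝ, 0 < ε → ε ≤ 1 →
      gammaSup (spindle f ε) ≤ C * ENNReal.ofReal (Real.sqrt ε) := by
  obtain ⟨F, hF, hfF⟩ := hf.exists_forall_le
  obtain ⟨C, hC, hCm⟩ := hf.exists_lintegral_majorant_le
  set J := ∫⁻ w in Metric.ball (0 : ℝ) 1, ‖w‖ₑ ^ (-(1 / 4) : ℝ)
  have hJ : J ≠ ⊤ := (lintegral_ball_enorm_rpow_lt_top volume (by simp) (by norm_num)).ne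
  have hI : ∀ t₀ : ℝ, ∫⁻ t in Ioc (t₀ - Real.pi) (t₀ + Real.pi), ‖t - t₀‖ₑ ^ (-(1 / 4) : ℝ) ≤
      J + ENNReal.ofReal (2 * Real.pi) := fun t₀ => by
    refine (setLIntegral_enorm_sub_rpow_le volume (by norm_num) _ _).trans_eq ?_
    rw [Real.volume_Ioc]
    congr 2
    ring
  set L := J + ENNReal.ofReal (2 * Real.pi)
  have hL : L ≠ ⊤ := ENNReal.add_ne_top.2 ⟨hJ, ENNReal.ofReal_ne_top⟩
  refine ⟨(ENNReal.ofReal (4 * Real.pi))⁻¹ * (ENNReal.ofReal (F * Real.pi) * L * C), ?_,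
    fun ε hε hε1 => ?_⟩
  · refine ENNReal.mul_ne_top (ENNReal.inv_ne_top.2 ?_)
      (ENNReal.mul_ne_top (ENNReal.mul_ne_top ENNReal.ofReal_ne_top hL) hC)
    simp [Real.pi_pos]
  rw [gammaSup, mul_assoc]
  refine mul_le_mul_right (iSup₂_le ?_) _
  rintro _ ⟨v₀, hv₀, t₀, rfl⟩
  -- The rectangle is centred at the angle `t₀` of the base point, so that `|t - t₀| ≤ π`
  -- throughout.
  rw [hf.lintegral_spindle hε t₀ (by fun_prop)]
  set B := ENNReal.ofReal (Real.sqrt ε * (F * Real.pi)) with hB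
  calc _ ≤ ∫⁻ v in Ioo (-1) 1, B * L * majorant f v₀ v := by
        refine setLIntegral_mono' measurableSet_Ioo fun v hv => ?_
        calc _ ≤ ∫⁻ t in Ioc (t₀ - Real.pi) (t₀ + Real.pi),
              B * majorant f v₀ v * ‖t - t₀‖ₑ ^ (-(1 / 4) : ℝ) := by
              refine setLIntegral_mono_ae' measurableSet_Ioc ?_
              have : ∀ᵐ t : ℝ, t ≠ t₀ := by
                simp [ae_iff]
              filter_upwards [this] with t ht htm
              refine hf.density_mul_inv_le hF hfF hε hε1 hv hv₀ ?_ ht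
              rw [abs_le]
              constructor <;> linarith [htm.1, htm.2]
          _ = B * majorant f v₀ v * ∫⁻ t in Ioc (t₀ - Real.pi) (t₀ + Real.pi),
              ‖t - t₀‖ₑ ^ (-(1 / 4) : ℝ) := lintegral_const_mul _ (by fun_prop)
          _ ≤ B * majorant f v₀ v * L := mul_le_mul_right (hI t₀) _
          _ = _ := mul_right_comm _ _ _
    _ = B * L * ∫⁻ v in Ioo (-1) 1, majorant f v₀ v :=
        lintegral_const_mul' _ _ (ENNReal.mul_ne_top ENNReal.ofReal_ne_top hL)
    _ ≤ B * L * C := mul_le_mul_right (hCm v₀) _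
    _ = _ := by
        rw [hB, ENNReal.ofReal_mul (Real.sqrt_nonneg _)]
        ring

theorem tendsto_gammaSup (hf : IsSpindleProfile f) :
    Tendsto (fun ε => gammaSup (spindle f ε)) (𝓝[>] 0) (𝓝 0) := by
  obtain ⟨C, hC, h⟩ := hf.exists_gammaSup_le
  have h1 : Tendsto (fun ε : ℝ => C * ENNReal.ofReal (Real.sqrt ε)) (𝓝[>] 0) (𝓝 (C * 0)) := by
    refine ENNReal.Tendsto.const_mul ?_ (Or.inr hC)
    have : Continuous fun ε : ℝ => ENNReal.ofReal (Real.sqrt ε) :=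
      ENNReal.continuous_ofReal.comp Real.continuous_sqrt
    have := (this.tendsto 0).mono_left (nhdsWithin_le_nhds (s := Ioi (0 : ℝ)))
    simpa using this
  rw [mul_zero] at h1
  refine tendsto_of_tendsto_of_tendsto_of_le_of_le' tendsto_const_nhds h1
    (Eventually.of_forall fun _ => zero_le) ?_
  filter_upwards [Ioc_mem_nhdsGT one_pos] with ε hε
  exact h ε hε.1 hε.2

end IsSpindleProfile

/-! ### Dilations -/

open scoped Pointwise in
theorem surfaceMeasure_smul_image (A : Set E3) {c : ℝ} (hc : 0 < c) :
    surfaceMeasure ((fun p : E3 => c • p) '' A) =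
      ENNReal.ofReal (c ^ 2) • Measure.map (fun p : E3 => c • p) (surfaceMeasure A) := by
  have hm : Measurable fun p : E3 => c • p := measurable_const_smul c
  ext s hs
  have h : s ∩ (fun p : E3 => c • p) '' A = c • ((fun p : E3 => c • p) ⁻¹' s ∩ A) := by
    rw [← image_smul, image_preimage_inter]
  rw [Measure.smul_apply, Measure.map_apply hm hs, surfaceMeasure, surfaceMeasure,
    Measure.restrict_apply hs, Measure.restrict_apply (hm hs), h,
    Measure.euclideanHausdorffMeasure_smul₀ _ hc.ne', ENNReal.smul_def, smul_eq_mul]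
  congr 1
  rw [ENNReal.ofReal_pow hc.le, ENNReal.coe_pow, ← enorm_eq_nnnorm, Real.enorm_eq_ofReal hc.le]

theorem area_smul_image (A : Set E3) {c : ℝ} (hc : 0 < c) :
    area ((fun p : E3 => c • p) '' A) = ENNReal.ofReal (c ^ 2) * area A := by
  rw [area, surfaceMeasure_smul_image A hc, Measure.smul_apply,
    Measure.map_apply (measurable_const_smul c) MeasurableSet.univ, preimage_univ, smul_eq_mul, area]

/-- Surface measure scales by `c ^ 2` and the kernel by `c⁻¹`. -/
theorem gammaSup_smul_image (A : Set E3) {c : ℝ} (hc : 0 < c) :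
    gammaSup ((fun p : E3 => c • p) '' A) = ENNReal.ofReal c * gammaSup A := by
  have hm : Measurable fun p : E3 => c • p := measurable_const_smul c
  have hc0 : ENNReal.ofReal c ≠ 0 := (ENNReal.ofReal_pos.2 hc).ne'
  rw [gammaSup, gammaSup, iSup_image, mul_left_comm]
  congr 1
  simp only [ENNReal.mul_iSup]
  refine iSup_congr fun x => iSup_congr fun _ => ?_
  rw [surfaceMeasure_smul_image A hc, lintegral_smul_measure, lintegral_map (by fun_prop) hm,
    smul_eq_mul]
  have h : ∀ y : E3, (edist (c • x) (c • y))⁻¹ = (ENNReal.ofReal c)⁻¹ * (edist x y)⁻¹ := fun y => by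
    rw [edist_smul₀, ENNReal.smul_def, smul_eq_mul, ← enorm_eq_nnnorm, Real.enorm_eq_ofReal hc.le,
      ENNReal.mul_inv (Or.inl hc0) (Or.inl ENNReal.ofReal_ne_top)]
  simp only [h]
  rw [lintegral_const_mul' _ _ (ENNReal.inv_ne_top.2 hc0), ← mul_assoc, ENNReal.ofReal_pow hc.le,
    sq, mul_assoc (ENNReal.ofReal c), ENNReal.mul_inv_cancel hc0 ENNReal.ofReal_ne_top, mul_one]

theorem IsClosedSmoothSurface.smul_image {A : Set E3} (hA : IsClosedSmoothSurface A) {c : ℝ}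
    (hc : c ≠ 0) : IsClosedSmoothSurface ((fun p : E3 => c • p) '' A) :=
  hA.image (ContinuousLinearEquiv.smulLeft (Units.mk0 c hc))

/-! ### Weak coupling -/

/-- The constant `8π` is the normalisation `4π` of `gammaSup` times the factor 2 for points off the
surface. -/
theorem IsClosedSmoothSurface.isPositiveForm_and_discreteSpectrum_eq_empty {A : Set E3}
    (hA : IsClosedSmoothSurface A) {α : ℝ} (hα : 0 ≤ α)
    (h : α * (8 * Real.pi * (gammaSup A).toReal) ≤ 1) :
    IsPositiveForm A α ∧ discreteSpectrum (hamiltonian A α) = ∅ := by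
  have := hA.isFiniteMeasure
  have hM0 : 0 ≤ 8 * Real.pi * (gammaSup A).toReal := by positivity
  have hM : ∀ x, ∫⁻ y, (edist x y)⁻¹ ∂(surfaceMeasure A) ≤
      ENNReal.ofReal (8 * Real.pi * (gammaSup A).toReal) := fun x => by
    rw [ENNReal.ofReal_mul (by positivity), ENNReal.ofReal_toReal hA.gammaSup_lt_top.ne]
    exact lintegral_potential_le_two_mul_gammaSup hA.isCompact hA.isConnected.nonempty x
  have hpos := isPositiveForm_of_potential_le hM0 hM hα h
  exact ⟨hpos, discreteSpectrum_eq_empty hA.isCompact hM0 hM hpos⟩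

theorem IsClosedSmoothSurface.surfaceRadius_lt_interactionRadius {A : Set E3} {S β : ℝ}
    (hS : 0 < S) (hA : area A = ENNReal.ofReal S) (hβ : IsPositiveForm A β)
    (h : Real.sqrt (S / (4 * Real.pi)) < β * (S / (4 * Real.pi))) :
    surfaceRadius A < interactionRadius A := by
  have hx : 0 < S / (4 * Real.pi) := by positivity
  have hβ0 : 0 ≤ β := by
    by_contra! hneg
    exact absurd ((Real.sqrt_nonneg _).trans_lt h) (mul_nonpos_of_nonpos_of_nonneg hneg.le hx.le).not_gt
  have h1 : surfaceRadius A = ENNReal.ofReal (Real.sqrt (S / (4 * Real.pi))) := by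
    rw [surfaceRadius, hA, ← ENNReal.ofReal_div_of_pos (by positivity),
      ENNReal.ofReal_rpow_of_nonneg hx.le (by norm_num), Real.sqrt_eq_rpow]
  have h2 : ENNReal.ofReal (β * (S / (4 * Real.pi))) ≤ interactionRadius A := by
    rw [← mul_div_assoc, ENNReal.ofReal_div_of_pos (by positivity), ENNReal.ofReal_mul hβ0,
      interactionRadius, ← hA]
    refine ENNReal.div_le_div_right ?_ _
    exact le_iSup_of_le β (le_iSup₂_of_le hβ0 hβ le_rfl)
  rw [h1]
  exact ((ENNReal.ofReal_lt_ofReal_iff ((Real.sqrt_nonneg _).trans_lt h)).2 h).trans_le h2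

namespace IsSpindleProfile

variable {f : ℝ → ℝ}

theorem eventually_gammaSup_le (hf : IsSpindleProfile f) {α : ℝ} (hα : 0 < α) :
    ∀ᶠ ε in 𝓝[>] 0, 0 < ε ∧ α * (8 * Real.pi * (gammaSup (spindle f ε)).toReal) ≤ 1 := by
  have hδ : 0 < ENNReal.ofReal (1 / (α * (8 * Real.pi))) := ENNReal.ofReal_pos.2 (by positivity)
  filter_upwards [hf.tendsto_gammaSup.eventually_le_const hδ, self_mem_nhdsWithin] with ε h1 h2
  refine ⟨h2, ?_⟩
  have := ENNReal.toReal_le_of_le_ofReal (by positivity) h1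
  rw [le_div_iff₀ (by positivity)] at this
  linarith

theorem eventually_spindle (hf : IsSpindleProfile f) {α : ℝ} (hα : 0 < α) :
    ∀ᶠ ε in 𝓝[>] 0,
      (∃ T : L2Surf (spindle f ε) →L[ℂ] L2Surf (spindle f ε),
        IsGammaOperator (spindle f ε) T ∧ ‖(α : ℂ) • T‖ < 1) ∧
      IsPositiveForm (spindle f ε) α ∧
      discreteSpectrum (hamiltonian (spindle f ε) α) = ∅ := by
  filter_upwards [hf.eventually_gammaSup_le hα] with ε ⟨hε, h⟩
  have hA := hf.isClosedSmoothSurface_spindle hε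
  refine ⟨?_, hA.isPositiveForm_and_discreteSpectrum_eq_empty hα.le h⟩
  obtain ⟨T, hT, hn⟩ := hA.exists_gammaOperator
  refine ⟨T, hT, ?_⟩
  rw [norm_smul, Complex.norm_real, Real.norm_of_nonneg hα.le]
  have h0 : 0 ≤ α * (gammaSup (spindle f ε)).toReal := by positivity
  have h1 : α * ‖T‖ ≤ α * (gammaSup (spindle f ε)).toReal := by gcongr
  nlinarith [Real.pi_gt_three]

theorem eventually_rescaleToArea (hf : IsSpindleProfile f) {S α : ℝ} (hS : 0 < S) (hα : 0 < α) :
    ∀ᶠ ε in 𝓝[>] 0, ∃ A : Set E3, A = rescaleToArea S (spindle f ε) ∧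
      IsClosedSmoothSurface A ∧ area A = ENNReal.ofReal S ∧ IsPositiveForm A α ∧
      discreteSpectrum (hamiltonian A α) = ∅ ∧ surfaceRadius A < interactionRadius A := by
  set r := Real.sqrt (S / (4 * Real.pi)) with hr
  have hr0 : 0 < r := Real.sqrt_pos.2 (by positivity)
  have hr2 : r * r = S / (4 * Real.pi) := Real.mul_self_sqrt (by positivity)
  -- With `S / (4π) = r²`, positivity at `β = α + 2 / r` makes the interaction radius at least `β r²
  -- = α r² + 2r`, which exceeds the surface radius `r`. Positivity at the smaller coupling `α`
  -- follows from the same smallness condition.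
  have hβ : 0 < α + 2 / r := by positivity
  filter_upwards [hf.eventually_gammaSup_le (mul_pos (Real.sqrt_pos.2 hS) hβ)] with ε ⟨hε, h⟩
  have hsp := hf.isClosedSmoothSurface_spindle hε
  have h1 : 1 < (area (spindle f ε)).toReal := by
    have := (ENNReal.toReal_lt_toReal ENNReal.one_ne_top hsp.area_lt_top.ne).2 (hf.one_lt_area hε)
    simpa using this
  set s := (area (spindle f ε)).toReal
  have hc : 0 < Real.sqrt (S / s) := Real.sqrt_pos.2 (by positivity)
  -- As the spindle has area above 1, the dilation factor is bounded independently of `ε`.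
  have hcS : Real.sqrt (S / s) ≤ Real.sqrt S := Real.sqrt_le_sqrt (div_le_self hS.le h1.le)
  have hA : IsClosedSmoothSurface (rescaleToArea S (spindle f ε)) := hsp.smul_image hc.ne'
  have harea : area (rescaleToArea S (spindle f ε)) = ENNReal.ofReal S := by
    rw [rescaleToArea, area_smul_image _ hc, Real.sq_sqrt (by positivity),
      ← ENNReal.ofReal_toReal hsp.area_lt_top.ne, ← ENNReal.ofReal_mul (by positivity),
      div_mul_cancel₀ _ (by positivity)]
  have hg : (gammaSup (rescaleToArea S (spindle f ε))).toReal =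
      Real.sqrt (S / s) * (gammaSup (spindle f ε)).toReal := by
    rw [rescaleToArea, gammaSup_smul_image _ hc, ENNReal.toReal_mul, ENNReal.toReal_ofReal hc.le]
  have hb : (α + 2 / r) *
      (8 * Real.pi * (gammaSup (rescaleToArea S (spindle f ε))).toReal) ≤ 1 := by
    refine le_trans ?_ h
    rw [hg]
    calc _ = Real.sqrt (S / s) * (α + 2 / r) * (8 * Real.pi * (gammaSup (spindle f ε)).toReal) := by
          ring
      _ ≤ _ := by gcongr
  have ha : α * (8 * Real.pi * (gammaSup (rescaleToArea S (spindle f ε))).toReal) ≤ 1 := by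
    refine le_trans ?_ hb
    gcongr
    exact le_add_of_nonneg_right (by positivity)
  obtain ⟨p1, p2⟩ := hA.isPositiveForm_and_discreteSpectrum_eq_empty hα.le ha
  refine ⟨_, rfl, hA, harea, p1, p2, IsClosedSmoothSurface.surfaceRadius_lt_interactionRadius hS harea
    (hA.isPositiveForm_and_discreteSpectrum_eq_empty hβ.le hb).1 ?_⟩
  rw [← hr, ← hr2, add_mul, ← mul_assoc (2 / r), div_mul_cancel₀ _ hr0.ne']
  have : 0 < α * (r * r) := by positivity
  linarith

end IsSpindleProfile

/-! ### Ellipsoids -/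

theorem isClosedSmoothSurface_sphere {r : ℝ} (hr : 0 < r) :
    IsClosedSmoothSurface (Metric.sphere 0 r) where
  isCompact := isCompact_sphere 0 r
  isConnected := isConnected_sphere (by
    rw [← Module.finrank_eq_rank, finrank_euclideanSpace_fin]
    norm_num) 0 hr.le
  regular := by
    have hd : ∀ q : E3, HasFDerivAt (fun q : E3 => ‖q‖ ^ 2 - r ^ 2) (2 • innerSL ℝ q) q := fun q =>
      (hasStrictFDerivAt_norm_sq q).hasFDerivAt.sub_const _
    refine fun p hp => ⟨univ, fun q => ‖q‖ ^ 2 - r ^ 2, isOpen_univ, mem_univ p,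
      ((contDiff_norm_sq ℝ).sub contDiff_const).contDiffOn, fun q _ => ?_, fun q hq h0 => ?_⟩
    · rw [mem_sphere_zero_iff_norm, sub_eq_zero, pow_left_inj₀ (norm_nonneg q) hr.le two_ne_zero]
    · rw [(hd q).fderiv] at h0
      have := congrArg (fun L => L q) h0
      have hq' := mem_sphere_zero_iff_norm.1 hq.2
      simp [hq', hr.ne'] at this

/-- The profile whose spindles are ellipsoids. -/
noncomputable def ellipsoidProfile (v : ℝ) : ℝ := (Real.pi ^ 2)⁻¹ * Real.sqrt (1 - v ^ 2)

/-- At `ε = π` the equatorial semi-axis `ε π⁻²` equals the polar one `ε⁻¹`. -/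
theorem spindle_ellipsoidProfile_pi :
    spindle ellipsoidProfile Real.pi = Metric.sphere (0 : E3) Real.pi⁻¹ := by
  have hpi := Real.pi_pos
  have hmul : ∀ v, Real.pi * ellipsoidProfile v = Real.pi⁻¹ * Real.sqrt (1 - v ^ 2) := fun v => by
    rw [ellipsoidProfile]
    field_simp
  ext p
  rw [mem_sphere_zero_iff_norm, ← pow_left_inj₀ (norm_nonneg p) (inv_pos.2 hpi).le two_ne_zero,
    EuclideanSpace.norm_sq_eq, Fin.sum_univ_three]
  simp only [Real.norm_eq_abs, sq_abs]
  constructor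
  · rintro ⟨v, hv, t, rfl⟩
    have h1 : Real.sqrt (1 - v ^ 2) ^ 2 = 1 - v ^ 2 := Real.sq_sqrt (by nlinarith [hv.1, hv.2])
    simp [hmul]
    linear_combination Real.pi⁻¹ ^ 2 * Real.sqrt (1 - v ^ 2) ^ 2 * Real.sin_sq_add_cos_sq t +
      Real.pi⁻¹ ^ 2 * h1
  · intro h
    have hz : (Real.pi * p 2) ^ 2 ≤ 1 := by
      have : Real.pi ^ 2 * Real.pi⁻¹ ^ 2 = 1 := by field_simp
      nlinarith [sq_nonneg (Real.pi * p 0), sq_nonneg (Real.pi * p 1)]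
    have hn : Real.pi * ellipsoidProfile (Real.pi * p 2) = ‖(⟨p 0, p 1⟩ : ℂ)‖ := by
      rw [hmul, Complex.norm_def, Complex.normSq_mk, ← Real.sqrt_sq (inv_pos.2 hpi).le,
        ← Real.sqrt_mul (sq_nonneg _)]
      congr 1
      have : Real.pi⁻¹ ^ 2 * Real.pi ^ 2 = 1 := by field_simp
      linear_combination - h - p 2 ^ 2 * this
    -- The angle `t` is the argument of `p 0 + i p 1`, whose modulus is the radius of the parallel
    -- by `hn`.
    refine ⟨Real.pi * p 2, abs_le.1 ((sq_le_one_iff_abs_le_one _).1 hz),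
      Complex.arg ⟨p 0, p 1⟩, ?_⟩
    rw [hn, Complex.norm_mul_cos_arg, Complex.norm_mul_sin_arg, inv_mul_cancel_left₀ hpi.ne']
    ext i
    fin_cases i <;> rfl

theorem hasDerivAt_ellipsoidProfile {v : ℝ} (hv : v ∈ Ioo (-1 : ℝ) 1) :
    HasDerivAt ellipsoidProfile (-((Real.pi ^ 2)⁻¹ * v) * (Real.sqrt (1 - v ^ 2))⁻¹) v := by
  have h0 : 1 - v ^ 2 ≠ 0 := by nlinarith [hv.1, hv.2]
  have h := ((((hasDerivAt_id v).pow 2).const_sub 1).sqrt h0).const_mul (Real.pi ^ 2)⁻¹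
  refine h.congr_deriv ?_
  simp
  ring

theorem tendsto_inv_sqrt_one_sub_sq {l : Filter ℝ} {a : ℝ} (hl : l ≤ 𝓝 a) (ha : a ^ 2 = 1)
    (hl' : Ioo (-1 : ℝ) 1 ∈ l) : Tendsto (fun v : ℝ => (Real.sqrt (1 - v ^ 2))⁻¹) l atTop := by
  refine Tendsto.inv_tendsto_nhdsGT_zero (tendsto_nhdsWithin_iff.2 ⟨?_, ?_⟩)
  · have : Continuous fun v : ℝ => Real.sqrt (1 - v ^ 2) := by fun_prop
    have := (this.tendsto a).mono_left hl
    simpa [ha] using this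
  · filter_upwards [hl'] with v hv
    exact Real.sqrt_pos.2 (by nlinarith [hv.1, hv.2])

theorem isSpindleProfile_ellipsoidProfile : IsSpindleProfile ellipsoidProfile where
  continuousOn := by
    unfold ellipsoidProfile
    fun_prop
  smooth v hv := by
    have h0 : 1 - v ^ 2 ≠ 0 := by nlinarith [hv.1, hv.2]
    have h1 : ContDiffAt ℝ ∞ (fun v : ℝ => 1 - v ^ 2) v := by fun_prop
    exact (contDiffAt_const.mul (h1.sqrt h0)).contDiffWithinAt
  pos v hv := mul_pos (by positivity) (Real.sqrt_pos.2 (by nlinarith [hv.1, hv.2]))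
  left_end := by simp [ellipsoidProfile]
  right_end := by simp [ellipsoidProfile]
  deriv_left := by
    have hl : Ioo (-1 : ℝ) 1 ∈ 𝓝[>] (-1 : ℝ) := Ioo_mem_nhdsGT (by norm_num)
    have h1 := tendsto_inv_sqrt_one_sub_sq nhdsWithin_le_nhds (by norm_num) hl
    have h2 : Tendsto (fun v : ℝ => -((Real.pi ^ 2)⁻¹ * v)) (𝓝[>] (-1)) (𝓝 (-((Real.pi ^ 2)⁻¹ * -1))) :=
      (Continuous.tendsto (by fun_prop) _).mono_left nhdsWithin_le_nhds
    refine (h2.pos_mul_atTop (by simp [Real.pi_pos]) h1).congr' ?_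
    filter_upwards [hl] with v hv
    exact (hasDerivAt_ellipsoidProfile hv).deriv.symm
  deriv_right := by
    have hl : Ioo (-1 : ℝ) 1 ∈ 𝓝[<] (1 : ℝ) := Ioo_mem_nhdsLT (by norm_num)
    have h1 := tendsto_inv_sqrt_one_sub_sq nhdsWithin_le_nhds (by norm_num) hl
    have h2 : Tendsto (fun v : ℝ => -((Real.pi ^ 2)⁻¹ * v)) (𝓝[<] 1) (𝓝 (-((Real.pi ^ 2)⁻¹ * 1))) :=
      (Continuous.tendsto (by fun_prop) _).mono_left nhdsWithin_le_nhds
    refine (h2.neg_mul_atTop (by simp [Real.pi_pos]) h1).congr' ?_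
    filter_upwards [hl] with v hv
    exact (hasDerivAt_ellipsoidProfile hv).deriv.symm
  normalized := by
    unfold ellipsoidProfile
    -- The half disc has area `π / 2`, and `2π · π⁻² · π/2 = 1`; this fixes the factor in the
    -- profile.
    rw [intervalIntegral.integral_const_mul, integral_sqrt_one_sub_sq]
    field_simp
  closes_up := by
    -- Smoothness at the poles is inherited from the round sphere, of which the ellipsoid is a
    -- linear image.
    have h : spindle ellipsoidProfile 1 =
        (stretchEquiv Real.pi_ne_zero).symm '' Metric.sphere 0 Real.pi⁻¹ := by
      rw [← spindle_ellipsoidProfile_pi, spindle_eq_image_stretch _ Real.pi]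
      exact ((stretchEquiv Real.pi_ne_zero).symm_image_image _).symm
    rw [h]
    exact (isClosedSmoothSurface_sphere (inv_pos.2 Real.pi_pos)).image _

theorem exists_surface_discreteSpectrum_eq_empty {α : ℝ} (hα : 0 < α) :
    ∃ A : Set E3, IsClosedSmoothSurface A ∧ area A = 1 ∧
      discreteSpectrum (hamiltonian A α) = ∅ := by
  obtain ⟨ε, A, -, h1, h2, -, h3, -⟩ :=
    (isSpindleProfile_ellipsoidProfile.eventually_rescaleToArea one_pos hα).exists
  exact ⟨A, h1, by simpa using h2, h3⟩

end SurfaceInteraction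

theorem mainTheorem4 :
    -- for every coupling there is a surface of unit area without bound states
    (∀ α₀ : ℝ, 0 < α₀ → ∃ A : Set SurfaceInteraction.E3,
      SurfaceInteraction.IsClosedSmoothSurface A ∧
      SurfaceInteraction.area A = 1 ∧
      SurfaceInteraction.discreteSpectrum (SurfaceInteraction.hamiltonian A α₀) = ∅) ∧
    -- the norm inequality
    (∀ A : Set SurfaceInteraction.E3, SurfaceInteraction.IsClosedSmoothSurface A →
      SurfaceInteraction.gammaSup A < ⊤ ∧
      ∃ T : SurfaceInteraction.L2Surf A →L[ℂ] SurfaceInteraction.L2Surf A,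
        SurfaceInteraction.IsGammaOperator A T ∧
        ∀ α₀ : ℝ, 0 < α₀ →
          ‖((α₀ : ℂ) • T).comp ((α₀ : ℂ) • T)‖ ≤
            2 * α₀ * (SurfaceInteraction.gammaSup A).toReal * ‖(α₀ : ℂ) • T‖) ∧
    -- admissible profiles exist, even with a round sphere in the family of spindles
    (∃ f : ℝ → ℝ, SurfaceInteraction.IsSpindleProfile f ∧
      ∃ ε > 0, ∃ r > 0, SurfaceInteraction.spindle f ε =
        Metric.sphere (0 : SurfaceInteraction.E3) r) ∧
    -- elongated spindles, for an arbitrary profile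
    (∀ f : ℝ → ℝ, SurfaceInteraction.IsSpindleProfile f →
      (∀ ε > 0, SurfaceInteraction.IsClosedSmoothSurface (SurfaceInteraction.spindle f ε) ∧
        1 < SurfaceInteraction.area (SurfaceInteraction.spindle f ε) ∧
        SurfaceInteraction.area (SurfaceInteraction.spindle f ε) < ⊤) ∧
      Filter.Tendsto (fun ε => SurfaceInteraction.area (SurfaceInteraction.spindle f ε))
        (nhdsWithin 0 (Set.Ioi 0)) (nhds 1) ∧
      Filter.Tendsto (fun ε => SurfaceInteraction.gammaSup (SurfaceInteraction.spindle f ε))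
        (nhdsWithin 0 (Set.Ioi 0)) (nhds 0) ∧
      (∀ α₀ : ℝ, 0 < α₀ → ∀ᶠ ε in nhdsWithin 0 (Set.Ioi 0),
        (∃ T : SurfaceInteraction.L2Surf (SurfaceInteraction.spindle f ε) →L[ℂ]
            SurfaceInteraction.L2Surf (SurfaceInteraction.spindle f ε),
          SurfaceInteraction.IsGammaOperator (SurfaceInteraction.spindle f ε) T ∧
          ‖(α₀ : ℂ) • T‖ < 1) ∧
        SurfaceInteraction.IsPositiveForm (SurfaceInteraction.spindle f ε) α₀ ∧
        SurfaceInteraction.discreteSpectrum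
          (SurfaceInteraction.hamiltonian (SurfaceInteraction.spindle f ε) α₀) = ∅) ∧
      -- the same after rescaling to a prescribed area, and failure of the isoperimetric inequality
      (∀ S : ℝ, 0 < S → ∀ α₀ : ℝ, 0 < α₀ → ∀ᶠ ε in nhdsWithin 0 (Set.Ioi 0),
        ∃ A : Set SurfaceInteraction.E3,
          A = SurfaceInteraction.rescaleToArea S (SurfaceInteraction.spindle f ε) ∧
          SurfaceInteraction.IsClosedSmoothSurface A ∧
          SurfaceInteraction.area A = ENNReal.ofReal S ∧
          SurfaceInteraction.IsPositiveForm A α₀ ∧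
          SurfaceInteraction.discreteSpectrum (SurfaceInteraction.hamiltonian A α₀) = ∅ ∧
          SurfaceInteraction.surfaceRadius A < SurfaceInteraction.interactionRadius A)) := by
  open SurfaceInteraction in
  exact ⟨fun α₀ hα => exists_surface_discreteSpectrum_eq_empty hα,
    fun A hA => ⟨hA.gammaSup_lt_top, hA.exists_gammaOperator_norm_comp_le⟩,
    ⟨ellipsoidProfile, isSpindleProfile_ellipsoidProfile, Real.pi, Real.pi_pos, Real.pi⁻¹,
      inv_pos.2 Real.pi_pos, spindle_ellipsoidProfile_pi⟩,
    fun f hf => ⟨fun ε hε => ⟨hf.isClosedSmoothSurface_spindle hε, hf.one_lt_area hε,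
      (hf.isClosedSmoothSurface_spindle hε).area_lt_top⟩, hf.tendsto_area, hf.tendsto_gammaSup,
      fun α₀ hα => hf.eventually_spindle hα, fun S hS α₀ hα => hf.eventually_rescaleToArea hS hα⟩⟩
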